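/- Let $\mathbb F$ be a field of characteristic $0$ and let $V$ be a differential algebra over $\mathbb F$, i.e. a unital commutative associative $\mathbb F$-algebra with an $\mathbb F$-linear derivation $\partial$. **Notation.** For $A(\lambda)=\sum_{n\le N}a_n\lambda^n$ and $B(\lambda)$ in $V((\lambda^{-1}))$ put $A(\lambda+\partial)B(\lambda)=\sum_{n\le N}a_n(\lambda+\partial)^nB(\lambda)$, where $(\lambda+\partial)^n=\sum_{k\ge0}\binom nk\lambda^{n-k}\partial^k$ and $\partial$ acts on the coefficients of $B$; this is the symbol of the product $A(\partial)\circ B(\partial)$ of pseudodifferential operators in $V((\partial^{-1}))$. If $A(\lambda)=\{a_\lambda b\}$ we also write $\{a_{\lambda+\partial}b\}_\to B(\lambda)$ for $A(\lambda+\partial)B(\lambda)$. Let $V_{\lambda,\mu}=V[[\lambda^{-1},\mu^{-1},(\lambda+\mu)^{-1}]][\lambda,\mu]$ be the quotient of $V[[\lambda^{-1},\mu^{-1},\nu^{-1}]][\lambda,\mu,\nu]$ by $(\nu-\lambda-\mu)V[[\lambda^{-1},\mu^{-1},\nu^{-1}]][\lambda,\mu,\nu]$. It is embedded * in $V((\lambda^{-1}))((\mu^{-1}))$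 by expanding powers of $\nu=\lambda+\mu$ for $|\mu|>|\lambda|$, * in $V((\mu^{-1}))((\lambda^{-1}))$ by expanding powers of $\nu=\lambda+\mu$ for $|\lambda|>|\mu|$, * in $V((\nu^{-1}))((\lambda^{-1}))$ by expanding powers of $\mu=\nu-\lambda$ for $|\lambda|>|\nu|$. **Definition.** A (non-local) PVA $\lambda$-bracket on $V$ is an $\mathbb F$-bilinear map $\{\cdot_\lambda\cdot\}:V\times V\to V((\lambda^{-1}))$ such that for all $a,b,c\in V$: * $\{\partial a_\lambda b\}=-\lambda\{a_\lambda b\}$ and $\{a_\lambda\partial b\}=(\lambda+\partial)\{a_\lambda b\}$; * $\{a_\lambda bc\}=b\{a_\lambda c\}+c\{a_\lambda b\}$ and $\{ab_\lambda c\}=\{a_{\lambda+\partial}c\}_\to b+\{b_{\lambda+\partial}c\}_\to a$; * $\{b_\lambda a\}=-\{a_{-\lambda-\partial}b\}$, where the right-hand side is $-\sum_n(-\lambda-\partial)^nc_n$ if $\{a_\lambda b\}=\sum_nc_n\lambda^n$ (powers expanded in non-negative powers of $\partial$, which act on the $c_n$); * $\{a_\lambda\{b_\mu c\}\}\in V((\lambda^{-1}))((\mu^{-1}))$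 lies in $V_{\lambda,\mu}$ (admissibility); * $\{a_\lambda\{b_\mu c\}\}-\{b_\mu\{a_\lambda c\}\}=\{\{a_\lambda b\}_{\lambda+\mu}c\}$ in $V_{\lambda,\mu}$, where the three terms, which a priori lie in $V((\lambda^{-1}))((\mu^{-1}))$, $V((\mu^{-1}))((\lambda^{-1}))$ and $V((\nu^{-1}))((\lambda^{-1}))$ with $\nu=\lambda+\mu$, are regarded as elements of $V_{\lambda,\mu}$ through the embeddings above (Jacobi identity). **Theorem.** Let $\{\cdot_\lambda\cdot\}$ be a PVA $\lambda$-bracket on $V$, and let $\theta_1,\dots,\theta_m\in V$ be such that the $m\times m$ matrix pseudodifferential operator $C(\partial)$ with symbol $C_{\alpha\beta}(\lambda)=\{\theta_{\beta\,\lambda}\theta_\alpha\}$ is invertible in $\mathrm{Mat}_{m\times m}\,V((\partial^{-1}))$, with inverse $C^{-1}(\partial)$. For $a,b\in V$ put $$\{a_\lambda b\}^D=\{a_\lambda b\}-\sum_{\alpha,\beta=1}^m\{\theta_{\beta\,\lambda+\partial}\,b\}_\to\,(C^{-1})_{\beta\alpha}(\lambda+\partial)\,\{a_\lambda\theta_\alpha\}.$$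 1. $\{\cdot_\lambda\cdot\}^D$ is a PVA $\lambda$-bracket on $V$. 2. Every $\theta_i$ is central for it: $\{a_\lambda\theta_i\}^D=\{\theta_{i\,\lambda}a\}^D=0$ for all $a\in V$ and $i=1,\dots,m$. 3. Let $I\subset V$ be the differential ideal generated by $\theta_1,\dots,\theta_m$. Then all coefficients of $\{x_\lambda a\}^D$ and of $\{a_\lambda x\}^D$ lie in $I$, for all $x\in I$ and $a\in V$. Moreover, $\{\cdot_\lambda\cdot\}^D$ induces a PVA $\lambda$-bracket on the quotient differential algebra $V/I$ (the Dirac reduction of $V$ by the constraints $\theta_1,\dots,\theta_m$). -/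

import Mathlib

noncomputable section

namespace PVA

open HahnSeries

/-! The space `V((λ⁻¹))` is `LaurentSeries V`, the variable of the Laurent series being `λ⁻¹`: the
coefficient of `λ ^ n` in `f` is `f.coeff (-n)`. Likewise `LaurentSeries (LaurentSeries V)` is
`V((λ⁻¹))((μ⁻¹))`, where the outer Laurent series is the one in `μ⁻¹`. -/

section OneVariable

variable {F V : Type*} [CommRing F] [CommRing V] [Algebra F V]

/-- A Laurent series has a lower bound for the exponents of the inverse variable. -/
theorem exists_lower {M : Type*} [Zero M] (f : LaurentSeries M) :
    ∃ N : ℤ, ∀ n < N, f.coeff n = 0 := by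
  by_cases hf : f = 0
  · exact ⟨0, fun n _ => by simp [hf]⟩
  · exact ⟨f.order, fun n hn => coeff_eq_zero_of_lt_order hn⟩

/-- The indeterminate `λ` of `V((λ⁻¹))`. -/
def lam (V : Type*) [CommRing V] : LaurentSeries V := single (-1 : ℤ) 1

theorem opProd_finite (d : Derivation F V V) (A B : LaurentSeries V) (j : ℤ) :
    (Function.support fun q : ℕ × ℤ => Ring.choose (-q.2) q.1 •
      (A.coeff q.2 * ((d : V →ₗ[F] V) ^ q.1) (B.coeff (j - q.2 - q.1)))).Finite := by
  obtain ⟨N, hN⟩ := exists_lower A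
  obtain ⟨M, hM⟩ := exists_lower B
  refine ((Finset.range (j - N - M + 1).toNat ×ˢ Finset.Icc N (j - M)).finite_toSet).subset ?_
  rintro ⟨k, r⟩ h
  have h1 : N ≤ r := by
    by_contra! hlt
    exact h (by simp [hN r hlt])
  have h2 : M ≤ j - r - k := by
    by_contra! hlt
    exact h (by simp [hM _ hlt])
  simp only [Finset.coe_product, Set.mem_prod, Finset.mem_coe, Finset.mem_range, Finset.mem_Icc]
  omega

/-- The series `A(λ + ∂) B(λ) = ∑ₙ aₙ (λ + ∂)ⁿ B(λ)`, where `A(λ) = ∑ₙ aₙ λⁿ` and where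
`(λ + ∂)ⁿ = ∑ₖ binom(n, k) λⁿ⁻ᵏ ∂ᵏ` for every integer `n`, the powers of `∂` acting on the
coefficients of `B`. It is the symbol of the product of the pseudodifferential operators with
symbols `A` and `B`. (In the formula, `n = -q.2` and `k = q.1`; all the sums are finite.) -/
def opProd (d : Derivation F V V) (A B : LaurentSeries V) : LaurentSeries V :=
  ofSuppBddBelow
    (fun j : ℤ => ∑ᶠ q : ℕ × ℤ, Ring.choose (-q.2) q.1 •
      (A.coeff q.2 * ((d : V →ₗ[F] V) ^ q.1) (B.coeff (j - q.2 - q.1)))) (by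
    obtain ⟨N, hN⟩ := exists_lower A
    obtain ⟨M, hM⟩ := exists_lower B
    refine ⟨N + M, fun j hj => ?_⟩
    by_contra! hlt
    refine hj (finsum_eq_zero_of_forall_eq_zero fun q => ?_)
    by_cases h1 : q.2 < N
    · simp [hN _ h1]
    · simp [hM (j - q.2 - q.1) (by omega)])

/-- The product of symbols as a bilinear map. -/
def opProdL (d : Derivation F V V) :
    LaurentSeries V →ₗ[F] LaurentSeries V →ₗ[F] LaurentSeries V :=
  LinearMap.mk₂ F (opProd d)
    (fun A A' B => by
      ext j
      simp only [opProd, coeff_ofSuppBddBelow, coeff_add, add_mul, smul_add]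
      exact finsum_add_distrib (opProd_finite d A B j) (opProd_finite d A' B j))
    (fun c A B => by
      ext j
      simp only [opProd, coeff_ofSuppBddBelow, coeff_smul, smul_mul_assoc]
      rw [smul_finsum' c (opProd_finite d A B j)]
      exact finsum_congr fun q => smul_comm _ _ _)
    (fun A B B' => by
      ext j
      simp only [opProd, coeff_ofSuppBddBelow, coeff_add, map_add, mul_add, smul_add]
      exact finsum_add_distrib (opProd_finite d A B j) (opProd_finite d A B' j))
    (fun c A B => by
      ext j
      simp only [opProd, coeff_ofSuppBddBelow, coeff_smul, map_smul, mul_smul_comm]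
      rw [smul_finsum' c (opProd_finite d A B j)]
      exact finsum_congr fun q => smul_comm _ _ _)

/-- The series `A(-λ - ∂) = ∑ₙ (-λ - ∂)ⁿ aₙ`, where `A(λ) = ∑ₙ aₙ λⁿ`: the powers of `-λ - ∂` are
moved to the left and expanded in non-negative powers of `∂`, acting on the coefficients `aₙ`.
(In the formula, `n = k - j`; all the sums are finite.) -/
def reflect (d : Derivation F V V) (A : LaurentSeries V) : LaurentSeries V :=
  ofSuppBddBelow
    (fun j : ℤ => ∑ᶠ k : ℕ, (((k : ℤ) - j).negOnePow : ℤ) •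
      Ring.choose ((k : ℤ) - j) k • ((d : V →ₗ[F] V) ^ k) (A.coeff (j - k))) (by
    obtain ⟨N, hN⟩ := exists_lower A
    refine ⟨N, fun j hj => ?_⟩
    by_contra! hlt
    refine hj (finsum_eq_zero_of_forall_eq_zero fun k => ?_)
    simp [hN (j - k) (by omega)])

end OneVariable

section TwoVariables

/-- The space `V[[λ⁻¹, μ⁻¹, ν⁻¹]][λ, μ, ν]` of formal series in integral powers of three
variables, with exponents bounded above: the coefficient of `λ ^ l * μ ^ m * ν ^ n` in `P` is
`P.coeff (-l, -m, -n)`. (A subset of `ℤ × ℤ × ℤ` is partially well ordered if and only if it is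
bounded below.) -/
abbrev Series₃ (V : Type*) [CommRing V] : Type _ := HahnSeries (ℤ × ℤ × ℤ) V

/-- The element `ν - λ - μ`. -/
def rel (V : Type*) [CommRing V] : Series₃ V :=
  single (0, 0, -1) 1 - single (-1, 0, 0) 1 - single (0, -1, 0) 1

/-- The submodule `(ν - λ - μ) · V[[λ⁻¹, μ⁻¹, ν⁻¹]][λ, μ, ν]`. -/
def relSubmodule (V : Type*) [CommRing V] : Submodule V (Series₃ V) :=
  (Ideal.span {rel V}).restrictScalars V

/-- The space `V_{λ,μ} = V[[λ⁻¹, μ⁻¹, (λ + μ)⁻¹]][λ, μ]`. -/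
abbrev TwoVar (V : Type*) [CommRing V] : Type _ := Series₃ V ⧸ relSubmodule V

variable {V : Type*} [CommRing V]

/-- All the exponents that occur in `p` are bounded. -/
def Bounded (p : ℤ → ℤ → ℤ → V) : Prop :=
  ∃ N : ℤ, ∀ i j r, p i j r ≠ 0 → N ≤ i ∧ N ≤ j ∧ N ≤ r

theorem bounded_coeff (P : Series₃ V) :
    ∃ N : ℤ, ∀ l m n, P.coeff (l, m, n) ≠ 0 → N ≤ l ∧ N ≤ m ∧ N ≤ n := by
  have key : ∀ φ : ℤ × ℤ × ℤ → ℤ, Monotone φ → ∃ N : ℤ, ∀ q, P.coeff q ≠ 0 → N ≤ φ q := by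
    intro φ hφ
    have hw := (P.isPWO_support.image_of_monotone hφ).isWF
    by_cases hne : (φ '' P.support).Nonempty
    · exact ⟨hw.min hne, fun q hq => hw.min_le hne ⟨q, hq, rfl⟩⟩
    · exact ⟨0, fun q hq => (hne ⟨φ q, q, hq, rfl⟩).elim⟩
  obtain ⟨A, hA⟩ := key (fun q => q.1) (fun _ _ h => h.1)
  obtain ⟨B, hB⟩ := key (fun q => q.2.1) (fun _ _ h => h.2.1)
  obtain ⟨C, hC⟩ := key (fun q => q.2.2) (fun _ _ h => h.2.2)
  refine ⟨min A (min B C), fun l m n h => ?_⟩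
  have h1 := hA _ h
  have h2 := hB _ h
  have h3 := hC _ h
  simp only at h1 h2 h3
  omega

/-- Let `p i j r` be the coefficient of `u ^ (-i) * w ^ (-j) * e ^ (-r)` in a series. The value of
`expandCoeff s p i j` is the coefficient of `u ^ (-i) * w ^ (-j)` in the series obtained by
the substitution `e = u + s w`, where `s = ± 1` and the powers of `u + s w` are expanded in
non-negative powers of `u`, that is in the domain `|w| > |u|`:
`(u + s w) ^ (-r) = ∑ₖ binom(-r, k) u ^ k (s w) ^ (-r - k)`. -/
def expandCoeff (s : ℤˣ) (p : ℤ → ℤ → ℤ → V) (i j : ℤ) : V :=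
  ∑ᶠ q : ℕ × ℤ, (Ring.choose (-q.2) q.1 * ((s ^ (-q.2 - q.1) : ℤˣ) : ℤ)) •
    p (i + q.1) (j - q.2 - q.1) q.2

theorem finite_aux {p : ℤ → ℤ → ℤ → V} (hp : Bounded p) (f : ℕ × ℤ → ℤ) (i j : ℤ) :
    (Function.support fun q : ℕ × ℤ => f q • p (i + q.1) (j - q.2 - q.1) q.2).Finite := by
  obtain ⟨N, hN⟩ := hp
  refine ((Finset.range (j - N - N + 1).toNat ×ˢ Finset.Icc N (j - N)).finite_toSet).subset ?_
  rintro ⟨k, r⟩ h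
  have h1 := hN (i + k) (j - r - k) r (fun h0 => h (by simp [h0]))
  simp only [Finset.coe_product, Set.mem_prod, Finset.mem_coe, Finset.mem_range, Finset.mem_Icc]
  omega

theorem expandCoeff_inner {p : ℤ → ℤ → ℤ → V} (s : ℤˣ) (hp : Bounded p) (j : ℤ) :
    BddBelow (Function.support fun i => expandCoeff s p i j) := by
  obtain ⟨N, hN⟩ := hp
  refine ⟨N - (j - N - N), fun i hi => ?_⟩
  by_contra! hlt
  refine hi (finsum_eq_zero_of_forall_eq_zero fun q => ?_)
  by_cases h : p (i + q.1) (j - q.2 - q.1) q.2 = 0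
  · simp [h]
  · have := hN _ _ _ h
    omega

theorem expandCoeff_outer {p : ℤ → ℤ → ℤ → V} (s : ℤˣ) (hp : Bounded p) :
    BddBelow (Function.support fun j =>
      (ofSuppBddBelow (fun i => expandCoeff s p i j) (expandCoeff_inner s hp j) :
        LaurentSeries V)) := by
  have hp' := hp
  obtain ⟨N, hN⟩ := hp'
  refine ⟨N + N, fun j hj => ?_⟩
  by_contra! hlt
  refine hj ?_
  ext i
  refine finsum_eq_zero_of_forall_eq_zero fun q => ?_
  by_cases h : p (i + q.1) (j - q.2 - q.1) q.2 = 0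
  · simp [h]
  · have := hN _ _ _ h
    omega

/-- The expansion of a series in three variables `u, w, e` under the substitution `e = u + s w`,
in the domain `|w| > |u|`, as an element of `V((u⁻¹))((w⁻¹))`. -/
def expand (s : ℤˣ) (p : ℤ → ℤ → ℤ → V) (hp : Bounded p) : LaurentSeries (LaurentSeries V) :=
  ofSuppBddBelow
    (fun j : ℤ => ofSuppBddBelow (fun i : ℤ => expandCoeff s p i j) (expandCoeff_inner s hp j))
    (expandCoeff_outer s hp)

theorem coeff_expand (s : ℤˣ) (p : ℤ → ℤ → ℤ → V) (hp : Bounded p) (i j : ℤ) :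
    ((expand s p hp).coeff j).coeff i = expandCoeff s p i j := rfl

theorem expandCoeff_add (s : ℤˣ) {p p' : ℤ → ℤ → ℤ → V} (hp : Bounded p) (hp' : Bounded p')
    (i j : ℤ) : expandCoeff s (fun i j r => p i j r + p' i j r) i j
      = expandCoeff s p i j + expandCoeff s p' i j := by
  simp only [expandCoeff, smul_add]
  exact finsum_add_distrib (finite_aux hp _ i j) (finite_aux hp' _ i j)

theorem expandCoeff_smul (s : ℤˣ) {p : ℤ → ℤ → ℤ → V} (hp : Bounded p) (c : V)
    (i j : ℤ) : expandCoeff s (fun i j r => c * p i j r) i j = c * expandCoeff s p i j := by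
  simp only [expandCoeff]
  rw [← smul_eq_mul, smul_finsum' c (finite_aux hp _ i j)]
  exact finsum_congr fun q => by rw [smul_eq_mul, mul_smul_comm]

/-- The expansion respects the relation `e - u - s w = 0`. -/
theorem expandCoeff_rel (s : ℤˣ) {p : ℤ → ℤ → ℤ → V} (hp : Bounded p) (i j : ℤ) :
    expandCoeff s (fun i j r => p i j (r + 1) - p (i + 1) j r - (s : ℤ) • p i (j + 1) r) i j
      = 0 := by
  let c : ℕ × ℤ → V := fun q => ((s ^ (-q.2 - q.1 + 1) : ℤˣ) : ℤ) •
    p (i + q.1) (j + 1 - q.2 - q.1) q.2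
  have hc : ∀ f : ℕ × ℤ → ℤ, (Function.support fun q => f q • c q).Finite := by
    intro f
    have := finite_aux hp (fun q => f q * ((s ^ (-q.2 - q.1 + 1) : ℤˣ) : ℤ)) i (j + 1)
    simpa only [c, smul_smul] using this
  let f₁ : ℕ × ℤ → V := fun q => Ring.choose (-q.2 + 1) q.1 • c q
  let f₂ : ℕ × ℤ → V := fun q => (if q.1 = 0 then 0 else Ring.choose (-q.2) (q.1 - 1)) • c q
  let f₃ : ℕ × ℤ → V := fun q => Ring.choose (-q.2) q.1 • c q
  let e₁ : ℕ × ℤ ≃ ℕ × ℤ := Equiv.prodCongr (Equiv.refl ℕ) (Equiv.addRight (1 : ℤ))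
  let e₂ : ℕ × ℤ → ℕ × ℤ := fun q => (q.1 + 1, q.2)
  have he₂ : Function.Injective e₂ := by
    rintro ⟨a, b⟩ ⟨a', b'⟩ h
    simpa [e₂] using h
  have hf₁ : f₁.support.Finite := hc _
  have hf₂ : f₂.support.Finite := hc _
  have hf₃ : f₃.support.Finite := hc _
  have s₂ : ∑ᶠ q, f₂ (e₂ q) = ∑ᶠ q, f₂ q := by
    rw [← finsum_mem_range he₂, finsum_mem_def]
    refine finsum_congr fun q => ?_
    rcases q with ⟨k, r⟩
    cases k with
    | zero =>
      have : f₂ (0, r) = 0 := by simp [f₂]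
      rw [Set.indicator_apply_eq_self.2 (fun _ => this)]
    | succ k => exact Set.indicator_of_mem (Set.mem_range.2 ⟨(k, r), rfl⟩) _
  have hterm : ∀ q : ℕ × ℤ, (Ring.choose (-q.2) q.1 * ((s ^ (-q.2 - q.1) : ℤˣ) : ℤ)) •
      (p (i + q.1) (j - q.2 - q.1) (q.2 + 1) - p (i + q.1 + 1) (j - q.2 - q.1) q.2
        - (s : ℤ) • p (i + q.1) (j - q.2 - q.1 + 1) q.2)
      = f₁ (e₁ q) - f₂ (e₂ q) - f₃ q := by
    rintro ⟨k, r⟩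
    have a₁ : f₁ (e₁ (k, r)) = (Ring.choose (-r) k * ((s ^ (-r - k) : ℤˣ) : ℤ)) •
        p (i + k) (j - r - k) (r + 1) := by
      have x₁ : -(r + 1) + 1 = -r := by ring
      have x₂ : -(r + 1) - (k : ℤ) + 1 = -r - k := by ring
      have x₃ : j + 1 - (r + 1) - (k : ℤ) = j - r - k := by ring
      simp only [f₁, e₁, c, Equiv.prodCongr_apply, Prod.map, Equiv.refl_apply,
        Equiv.coe_addRight, x₁, x₂, x₃, smul_smul]
    have a₂ : f₂ (e₂ (k, r)) = (Ring.choose (-r) k * ((s ^ (-r - k) : ℤˣ) : ℤ)) •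
        p (i + k + 1) (j - r - k) r := by
      have x₂ : -r - ((k + 1 : ℕ) : ℤ) + 1 = -r - k := by push_cast; ring
      have x₃ : j + 1 - r - ((k + 1 : ℕ) : ℤ) = j - r - k := by push_cast; ring
      have x₄ : i + ((k + 1 : ℕ) : ℤ) = i + k + 1 := by push_cast; ring
      simp only [f₂, e₂, c, x₂, x₃, x₄, smul_smul, Nat.add_sub_cancel,
        if_neg (Nat.succ_ne_zero k)]
    have a₃ : f₃ (k, r) = (Ring.choose (-r) k * ((s ^ (-r - k) : ℤˣ) : ℤ)) •
        ((s : ℤ) • p (i + k) (j - r - k + 1) r) := by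
      have x₃ : j + 1 - r - (k : ℤ) = j - r - k + 1 := by ring
      simp only [f₃, c, x₃, smul_smul, zpow_add_one, Units.val_mul, mul_assoc]
    rw [a₁, a₂, a₃, smul_sub, smul_sub]
  have hg₁ : (Function.support fun q => f₁ (e₁ q)).Finite :=
    Set.Finite.preimage e₁.injective.injOn hf₁
  have hg₂ : (Function.support fun q => f₂ (e₂ q)).Finite :=
    Set.Finite.preimage he₂.injOn hf₂
  have hg : (Function.support fun q => f₁ (e₁ q) - f₂ (e₂ q)).Finite :=
    (hg₁.union hg₂).subset (Function.support_sub _ _)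
  unfold expandCoeff
  rw [finsum_congr hterm, finsum_sub_distrib hg hf₃, finsum_sub_distrib hg₁ hg₂, s₂,
    finsum_comp_equiv e₁ (f := f₁), ← finsum_sub_distrib hf₁ hf₂,
    ← finsum_sub_distrib ((hf₁.union hf₂).subset (Function.support_sub _ _)) hf₃]
  refine finsum_eq_zero_of_forall_eq_zero ?_
  rintro ⟨k, r⟩
  cases k with
  | zero => simp [f₁, f₂, f₃]
  | succ k =>
    simp only [f₁, f₂, f₃, Ring.choose_succ_succ, add_smul, if_neg (Nat.succ_ne_zero k),
      Nat.add_sub_cancel]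
    abel

theorem coeff_rel_mul (S : Series₃ V) (l m n : ℤ) :
    (rel V * S).coeff (l, m, n)
      = S.coeff (l, m, n + 1) - S.coeff (l + 1, m, n) - S.coeff (l, m + 1, n) := by
  simp [rel, sub_mul, coeff_single_mul]

/-- Linear extension to the quotient `V_{λ,μ}` of an expansion. The map `σ` lists the variables
`λ, μ, ν` in the order `u, w, e`. -/
def expandLin (s : ℤˣ) (σ : ℤ → ℤ → ℤ → ℤ × ℤ × ℤ)
    (hσ : ∀ P : Series₃ V, Bounded fun i j r => P.coeff (σ i j r))
    (hrel : ∃ t : ℤ, ∀ (S : Series₃ V) (i j r : ℤ), (rel V * S).coeff (σ i j r)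
      = t • (S.coeff (σ i j (r + 1)) - S.coeff (σ (i + 1) j r)
        - (s : ℤ) • S.coeff (σ i (j + 1) r))) :
    TwoVar V →ₗ[V] LaurentSeries (LaurentSeries V) :=
  (relSubmodule V).liftQ
    { toFun := fun P => expand s (fun i j r => P.coeff (σ i j r)) (hσ P)
      map_add' := fun P P' => by
        ext j i
        exact expandCoeff_add s (hσ P) (hσ P') i j
      map_smul' := fun c P => by
        ext j i
        exact expandCoeff_smul s (hσ P) c i j }
    (by
      intro P hP
      obtain ⟨S, rfl⟩ := Ideal.mem_span_singleton'.1 hP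
      obtain ⟨t, ht⟩ := hrel
      ext j i
      have hfun : (fun i j r => (S * rel V).coeff (σ i j r)) = fun i j r =>
          (fun i j r => (t : V) * S.coeff (σ i j r)) i j (r + 1)
          - (fun i j r => (t : V) * S.coeff (σ i j r)) (i + 1) j r
          - (s : ℤ) • (fun i j r => (t : V) * S.coeff (σ i j r)) i (j + 1) r := by
        funext i j r
        rw [mul_comm S, ht]
        simp only [zsmul_eq_mul]
        ring
      have hb : Bounded fun i j r => (t : V) * S.coeff (σ i j r) := by
        obtain ⟨N, hN⟩ := hσ S
        exact ⟨N, fun i j r h => hN i j r fun h0 => h (by simp only [h0, mul_zero])⟩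
      change expandCoeff s (fun i j r => (S * rel V).coeff (σ i j r)) i j = 0
      rw [hfun]
      exact expandCoeff_rel s hb i j)

/-- The embedding `ι_{μ,λ} : V_{λ,μ} → V((λ⁻¹))((μ⁻¹))`, in which the powers of `ν = λ + μ` are
expanded in the domain `|μ| > |λ|`. -/
def iotaMuLam (V : Type*) [CommRing V] : TwoVar V →ₗ[V] LaurentSeries (LaurentSeries V) :=
  expandLin 1 (fun i j r => (i, j, r))
    (fun P => (bounded_coeff P).imp fun _ h i j r => h i j r)
    ⟨1, fun S i j r => by simp [coeff_rel_mul]⟩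

/-- The embedding `ι_{λ,μ} : V_{λ,μ} → V((μ⁻¹))((λ⁻¹))`, in which the powers of `ν = μ + λ` are
expanded in the domain `|λ| > |μ|`. -/
def iotaLamMu (V : Type*) [CommRing V] : TwoVar V →ₗ[V] LaurentSeries (LaurentSeries V) :=
  expandLin 1 (fun i j r => (j, i, r))
    (fun P => (bounded_coeff P).imp fun _ h i j r h0 => by have := h j i r h0; omega)
    ⟨1, fun S i j r => by simp [coeff_rel_mul, sub_right_comm]⟩

/-- The embedding `ι_{λ,ν} : V_{λ,μ} → V((ν⁻¹))((λ⁻¹))`, where `ν = λ + μ`, in which the powers of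
`μ = ν - λ` are expanded in the domain `|λ| > |ν|`. -/
def iotaLamNu (V : Type*) [CommRing V] : TwoVar V →ₗ[V] LaurentSeries (LaurentSeries V) :=
  expandLin (-1) (fun i j r => (j, r, i))
    (fun P => (bounded_coeff P).imp fun _ h i j r h0 => by have := h j r i h0; omega)
    ⟨-1, fun S i j r => by simp [coeff_rel_mul]; abel⟩

end TwoVariables

section Brackets

variable {F V : Type*} [Field F] [CommRing V] [Algebra F V]

/-- A non-local PVA `λ`-bracket on the differential algebra `(V, ∂ = d)`, given as an `F`-bilinear
map `br`, where `br a b` is `{a_λ b} ∈ V((λ⁻¹))`.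

* `(br b c).map (br a)` is `{a_λ {b_μ c}} ∈ V((λ⁻¹))((μ⁻¹))`;
* `(br a c).map (br b)` is `{b_μ {a_λ c}} ∈ V((μ⁻¹))((λ⁻¹))`;
* `(br a b).map (br.flip c)` is `{{a_λ b}_ν c} ∈ V((ν⁻¹))((λ⁻¹))`, where `ν = λ + μ`. -/
structure IsPVABracket (d : Derivation F V V) (br : V →ₗ[F] V →ₗ[F] LaurentSeries V) : Prop where
  sesq_left : ∀ a b, br (d a) b = -(lam V * br a b)
  sesq_right : ∀ a b, br a (d b) = lam V * br a b + (br a b).map d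
  leibniz_left : ∀ a b c, br a (b * c) = b • br a c + c • br a b
  leibniz_right : ∀ a b c, br (a * b) c = opProd d (br a c) (C b) + opProd d (br b c) (C a)
  skew : ∀ a b, br b a = -reflect d (br a b)
  admissible : ∀ a b c, ∃ P : TwoVar V, iotaMuLam V P = (br b c).map (br a)
  jacobi : ∀ a b c, ∃ P Q R : TwoVar V, iotaMuLam V P = (br b c).map (br a) ∧
    iotaLamMu V Q = (br a c).map (br b) ∧ iotaLamNu V R = (br a b).map (br.flip c) ∧ P - Q = R

/-- `θ` is central: `{a_λ θ} = {θ_λ a} = 0` for all `a`. -/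
def IsCentral (br : V →ₗ[F] V →ₗ[F] LaurentSeries V) (θ : V) : Prop :=
  ∀ a, br a θ = 0 ∧ br θ a = 0

/-- The symbol `C_{αβ}(λ) = {θ_β _λ θ_α}`. -/
def constraintMatrix (br : V →ₗ[F] V →ₗ[F] LaurentSeries V) {m : ℕ} (θ : Fin m → V) :
    Matrix (Fin m) (Fin m) (LaurentSeries V) :=
  Matrix.of fun α β => br (θ β) (θ α)

/-- The matrix pseudodifferential operators with symbols `A` and `B` are inverse to each other:
`A(∂) ∘ B(∂) = B(∂) ∘ A(∂) = 1`. -/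
def IsInverseOp (d : Derivation F V V) {m : ℕ}
    (A B : Matrix (Fin m) (Fin m) (LaurentSeries V)) : Prop :=
  (∀ α γ, ∑ β, opProd d (A α β) (B β γ) = if α = γ then 1 else 0) ∧
  (∀ α γ, ∑ β, opProd d (B α β) (A β γ) = if α = γ then 1 else 0)

/-- The Dirac modification
`{a_λ b}ᴰ = {a_λ b} - ∑ {θ_β _{λ+∂} b}_→ (C⁻¹)_{βα}(λ + ∂) {a_λ θ_α}`,
where `D` is the symbol of `C⁻¹`. -/
def dirac (d : Derivation F V V) (br : V →ₗ[F] V →ₗ[F] LaurentSeries V) {m : ℕ} (θ : Fin m → V)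
    (D : Matrix (Fin m) (Fin m) (LaurentSeries V)) : V →ₗ[F] V →ₗ[F] LaurentSeries V :=
  LinearMap.mk₂ F
    (fun a b => br a b -
      ∑ α, ∑ β, opProdL d (br (θ β) b) (opProdL d (D β α) (br a (θ α))))
    (fun a a' b => by
      simp only [map_add, LinearMap.add_apply, Finset.sum_add_distrib]; abel)
    (fun c a b => by
      simp only [map_smul, LinearMap.smul_apply, Finset.smul_sum, smul_sub])
    (fun a b b' => by
      simp only [map_add, LinearMap.add_apply, Finset.sum_add_distrib]; abel)
    (fun c a b => by
      simp only [map_smul, LinearMap.smul_apply, Finset.smul_sum, smul_sub])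

/-- The differential ideal generated by the elements `θ i`. -/
def diffIdeal (d : Derivation F V V) {m : ℕ} (θ : Fin m → V) : Ideal V :=
  Ideal.span {x | ∃ (i : Fin m) (n : ℕ), x = ((d : V →ₗ[F] V) ^ n) (θ i)}

theorem diffIdeal_stable (d : Derivation F V V) {m : ℕ} (θ : Fin m → V) (x : V)
    (hx : x ∈ diffIdeal d θ) : d x ∈ diffIdeal d θ := by
  unfold diffIdeal at hx
  induction hx using Submodule.span_induction with
  | mem x h =>
    obtain ⟨i, n, rfl⟩ := h
    refine Ideal.subset_span ⟨i, n + 1, ?_⟩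
    rw [pow_succ', Module.End.mul_apply]
    rfl
  | zero => simp
  | add x y _ _ hx hy => rw [map_add]; exact add_mem hx hy
  | smul a x hx' hx =>
    rw [smul_eq_mul, Derivation.leibniz, smul_eq_mul, smul_eq_mul, mul_comm x]
    exact add_mem (Ideal.mul_mem_left _ _ hx) (Ideal.mul_mem_left _ _ hx')

/-- The derivation of `V ⧸ I` induced by the derivation of `V`, for a differential ideal `I`. -/
def quotDer (d : Derivation F V V) (I : Ideal V) (hI : ∀ x ∈ I, d x ∈ I) :
    Derivation F (V ⧸ I) (V ⧸ I) :=
  Derivation.liftOfRightInverse (f := Ideal.Quotient.mkₐ F I) (f_inv := Quotient.out)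
    (fun x => Quotient.out_eq x) (d := d) (fun x hx => by
      rw [Ideal.Quotient.mkₐ_eq_mk, Ideal.Quotient.eq_zero_iff_mem] at hx ⊢
      exact hI x hx)

theorem quotDer_mk (d : Derivation F V V) (I : Ideal V) (hI : ∀ x ∈ I, d x ∈ I) (x : V) :
    quotDer d I hI (Ideal.Quotient.mk I x) = Ideal.Quotient.mk I (d x) :=
  Derivation.liftOfRightInverse_apply (f := Ideal.Quotient.mkₐ F I) _ _ x

end Brackets

end PVA

end

/-! Put X_β(a) = ∑_α (C⁻¹)_{βα}(λ+∂){a_λ θ_α} (`diracCoef`), so that {a_λ b}ᴰ = {a_λ b} − ∑_β {θ_β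
λ+∂ b}_→ X_β(a). Everything except the Jacobi identity is algebra of pseudodifferential operators.
The vector X(a) is the solution of C X(a) = ({a_λ θ_γ})_γ, which gives {a_λ θ_i}ᴰ = 0; and X_β(θ_i)
is the Kronecker delta, which gives {θ_i λ a}ᴰ = 0. Sesquilinearity and the Leibniz rules pass
through the formula. The matrix C is skew-adjoint, hence so is its inverse (`reflect_inverse`), and
skewsymmetry follows. The derivatives of θ_i are central by sesquilinearity, so the Leibniz rule and
skewsymmetry give the statement on the ideal, and the bracket descends to the quotient.

For the Jacobi identity, the point is that the three terms for the Dirac bracket arise from the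
three terms for the original bracket by one and the same additive operation `reduceNu` on families
J(a, b, c) of series in λ, μ, ν, performed before any expansion. It corrects the first argument by
X(a), then the second by X(b), then the third by C⁻¹. Being additive, it preserves P − Q = R. What
remains is to identify its image under the three expansions: `iota₁_reduceNu`, `iota₂_reduceNu`,
`iota₃_reduceNu`. For the first two, {a_λ ·}ᴰ has to be applied to X_β(b), hence apparently to the
entries of C⁻¹. This is avoided: {b_μ θ_α}ᴰ = 0 is a linear system for the unknowns {a_λ X_β(b)}ᴰ,
with matrix C(λ+μ+∂), and it can be inverted (`lmap_dirac_dirac`). For the third, the left Leibniz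
rule produces extra terms, which cancel against the correction in b because C X(b) = ({b_λ θ_γ})_γ
(`iota₃_reduceMu`).

The operations involved are products such as P(λ+∂, μ, ν+∂) A(λ), and the analytic content is that
the expansions carry them to the corresponding products of iterated Laurent series
(`IsExpansion.map_star`). Two principles replace binomial computations. Both sides are continuous
for a suitable degree filtration, so monomials suffice (`IsFiltered.ext_dense`). And an operator
"variable plus derivation" is injective, so all its integral powers, negative ones included, are
determined by the recursion p_{n+1} = T p_n and by p_0 (`eq_of_injective_recursion`).

The embeddings enter only through explicit preimages; their injectivity plays no role. -/

noncomputable section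

namespace PVA

open HahnSeries

/-! ### Filtered additive maps and density -/

section Filtration

variable {X Y Z : Type*} [AddCommGroup X] [AddCommGroup Y] [AddCommGroup Z]

/-- An additive map that changes the degree by a bounded amount. -/
structure IsFiltered (G : ℤ → AddSubgroup X) (G' : ℤ → AddSubgroup Y) (f : X → Y) : Prop where
  map_add : ∀ x y, f (x + y) = f x + f y
  bound : ∃ c : ℤ, ∀ n x, x ∈ G n → f x ∈ G' (n + c)

variable {G : ℤ → AddSubgroup X} {G' : ℤ → AddSubgroup Y} {G'' : ℤ → AddSubgroup Z}

theorem IsFiltered.comp {g : Y → Z} {f : X → Y} (hg : IsFiltered G' G'' g)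
    (hf : IsFiltered G G' f) : IsFiltered G G'' (fun x => g (f x)) := by
  obtain ⟨c, hc⟩ := hf.bound
  obtain ⟨c', hc'⟩ := hg.bound
  refine ⟨fun x y => by rw [hf.map_add, hg.map_add], c + c', fun n x hx => ?_⟩
  rw [← add_assoc]
  exact hc' _ _ (hc _ _ hx)

theorem IsFiltered.add (hG' : Antitone G') {f g : X → Y} (hf : IsFiltered G G' f)
    (hg : IsFiltered G G' g) : IsFiltered G G' (fun x => f x + g x) := by
  obtain ⟨c, hc⟩ := hf.bound
  obtain ⟨c', hc'⟩ := hg.bound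
  refine ⟨fun x y => by rw [hf.map_add, hg.map_add]; abel, min c c', fun n x hx => ?_⟩
  exact add_mem (hG' (by simp) (hc n x hx)) (hG' (by simp) (hc' n x hx))

theorem IsFiltered.neg {f : X → Y} (hf : IsFiltered G G' f) :
    IsFiltered G G' (fun x => -f x) := by
  obtain ⟨c, hc⟩ := hf.bound
  exact ⟨fun x y => by rw [hf.map_add]; abel, c, fun n x hx => neg_mem (hc n x hx)⟩

/-- Filtered maps into a separated group are determined by their values on a dense set. -/
theorem IsFiltered.ext_dense (hG : Antitone G) (hsep : ∀ y, (∀ n, y ∈ G' n) → y = 0) {D : Set X}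
    (hD : ∀ x n, ∃ s ∈ AddSubgroup.closure D, x - s ∈ G n) {f g : X → Y}
    (hf : IsFiltered G G' f) (hg : IsFiltered G G' g) (h : ∀ x ∈ D, f x = g x) (x : X) :
    f x = g x := by
  obtain ⟨c, hc⟩ := hf.bound
  obtain ⟨c', hc'⟩ := hg.bound
  rw [← sub_eq_zero]
  refine hsep _ fun n => ?_
  -- The accuracy of the approximation makes up for the degree shifts of both maps.
  obtain ⟨s, hs, hx⟩ := hD x (max (n - c) (n - c'))
  have hfg : f s = g s := by
    let f' : X →+ Y := AddMonoidHom.mk' f hf.map_add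
    let g' : X →+ Y := AddMonoidHom.mk' g hg.map_add
    change f' s = g' s
    clear hx
    induction hs using AddSubgroup.closure_induction with
    | mem x hx => exact h x hx
    | zero => rw [map_zero, map_zero]
    | add x y _ _ hx hy => rw [_root_.map_add, _root_.map_add, hx, hy]
    | neg x _ hx => rw [map_neg, map_neg, hx]
  have e : f x - g x = f (x - s) - g (x - s) := by
    have h1 : f x = f (x - s) + f s := by rw [← hf.map_add, sub_add_cancel]
    have h2 : g x = g (x - s) + g s := by rw [← hg.map_add, sub_add_cancel]
    rw [h1, h2, hfg]; abel
  rw [e]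
  have h1 := hc _ _ (hG (le_max_left (n - c) (n - c')) hx)
  have h2 := hc' _ _ (hG (le_max_right (n - c) (n - c')) hx)
  rw [sub_add_cancel] at h1 h2
  exact sub_mem h1 h2

end Filtration

/-! ### Order and total degree of Laurent series -/

section LaurentFiltration

variable {M N : Type*} [AddCommGroup M] [AddCommGroup N]

/-- The trivial filtration. -/
def trivFilt (M : Type*) [AddCommGroup M] (k : ℤ) : AddSubgroup M := if 0 < k then ⊥ else ⊤

/-- The filtration of Laurent series by the total degree, for a given filtration of the
coefficients. -/
def laurentFilt (H : ℤ → AddSubgroup M) (n : ℤ) : AddSubgroup (LaurentSeries M) where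
  carrier := {A | ∀ j, A.coeff j ∈ H (n - j)}
  zero_mem' _ := zero_mem _
  add_mem' hA hB j := add_mem (hA j) (hB j)
  neg_mem' hA j := neg_mem (hA j)

/-- The filtration of Laurent series by the order. -/
abbrev ordFilt (M : Type*) [AddCommGroup M] : ℤ → AddSubgroup (LaurentSeries M) :=
  laurentFilt (trivFilt M)

theorem mem_laurentFilt {H : ℤ → AddSubgroup M} {n : ℤ} {A : LaurentSeries M} :
    A ∈ laurentFilt H n ↔ ∀ j, A.coeff j ∈ H (n - j) := Iff.rfl

theorem mem_trivFilt {k : ℤ} {m : M} : m ∈ trivFilt M k ↔ (0 < k → m = 0) := by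
  unfold trivFilt
  split_ifs with h <;> simp [h]

theorem mem_ordFilt {n : ℤ} {A : LaurentSeries M} :
    A ∈ ordFilt M n ↔ ∀ j < n, A.coeff j = 0 := by
  simp only [mem_laurentFilt, mem_trivFilt, sub_pos]

theorem antitone_trivFilt : Antitone (trivFilt M) := fun a b h m hm => by
  rw [mem_trivFilt] at hm ⊢
  exact fun h0 => hm (by omega)

theorem antitone_laurentFilt {H : ℤ → AddSubgroup M} (hH : Antitone H) :
    Antitone (laurentFilt H) := fun _ _ h _ hA j => hH (by omega) (hA j)

theorem trivFilt_sep (m : M) (h : ∀ n, m ∈ trivFilt M n) : m = 0 :=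
  mem_trivFilt.1 (h 1) one_pos

theorem laurentFilt_sep {H : ℤ → AddSubgroup M} (hH : ∀ m, (∀ n, m ∈ H n) → m = 0)
    (A : LaurentSeries M) (h : ∀ n, A ∈ laurentFilt H n) : A = 0 := by
  ext j
  refine hH _ fun n => ?_
  have := h (n + j) j
  rwa [add_sub_cancel_right] at this

theorem exists_mem_ordFilt (A : LaurentSeries M) : ∃ n, A ∈ ordFilt M n := by
  obtain ⟨n, hn⟩ := exists_lower A
  exact ⟨n, mem_ordFilt.2 hn⟩

/-- The monomials of the Laurent series. -/
def monomials (M : Type*) [AddCommGroup M] : Set (LaurentSeries M) :=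
  {A | ∃ (r : ℤ) (m : M), A = single r m}

theorem monomials_dense (A : LaurentSeries M) (n : ℤ) :
    ∃ s ∈ AddSubgroup.closure (monomials M), A - s ∈ ordFilt M n := by
  obtain ⟨k, hk⟩ := exists_lower A
  refine ⟨∑ r ∈ Finset.Ico k n, single r (A.coeff r), sum_mem fun r _ =>
    AddSubgroup.subset_closure ⟨r, _, rfl⟩, mem_ordFilt.2 fun j hj => ?_⟩
  rw [coeff_sub, coeff_sum]
  by_cases h : k ≤ j
  · rw [Finset.sum_eq_single j]
    · simp
    · intro r _ hr
      exact coeff_single_of_ne hr.symm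
    · intro h'
      exact absurd (Finset.mem_Ico.2 ⟨h, hj⟩) h'
  · rw [hk j (by omega), zero_sub, neg_eq_zero]
    refine Finset.sum_eq_zero fun r hr => coeff_single_of_ne ?_
    have := (Finset.mem_Ico.1 hr).1
    omega

/-- Filtered maps of Laurent series are determined by their values on monomials. -/
theorem IsFiltered.ext_single {Y : Type*} [AddCommGroup Y] {G' : ℤ → AddSubgroup Y}
    (hsep : ∀ y, (∀ n, y ∈ G' n) → y = 0) {f g : LaurentSeries M → Y}
    (hf : IsFiltered (ordFilt M) G' f) (hg : IsFiltered (ordFilt M) G' g)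
    (h : ∀ r m, f (single r m) = g (single r m)) (A : LaurentSeries M) : f A = g A :=
  hf.ext_dense (antitone_laurentFilt antitone_trivFilt) hsep monomials_dense hg
    (by rintro _ ⟨r, m, rfl⟩; exact h r m) A

theorem ordFilt_sep (A : LaurentSeries M) (h : ∀ n, A ∈ ordFilt M n) : A = 0 :=
  laurentFilt_sep trivFilt_sep A h

end LaurentFiltration

/-! ### The operator y + δ and its integral powers -/

section Twist

variable {M N : Type*} [AddCommGroup M] [AddCommGroup N]

/-- An additive map applied to the coefficients. -/
def lmap (α : M →+ N) : LaurentSeries M →+ LaurentSeries N where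
  toFun A := A.map α
  map_zero' := by ext; simp
  map_add' A B := by ext; simp

@[simp] theorem coeff_lmap (α : M →+ N) (A : LaurentSeries M) (j : ℤ) :
    (lmap α A).coeff j = α (A.coeff j) := rfl

theorem lmap_single (α : M →+ N) (r : ℤ) (m : M) : lmap α (single r m) = single r (α m) := by
  ext j
  by_cases h : j = r
  · simp [h]
  · simp [coeff_single_of_ne h]

theorem isFiltered_lmap {H : ℤ → AddSubgroup M} {H' : ℤ → AddSubgroup N} (α : M →+ N) (c : ℤ)
    (h : ∀ k m, m ∈ H k → α m ∈ H' (k + c)) :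
    IsFiltered (laurentFilt H) (laurentFilt H') (lmap α) :=
  ⟨map_add _, c, fun n A hA j => by
    have := h _ _ (hA j)
    rwa [sub_add_eq_add_sub] at this⟩

theorem map_trivFilt (α : M →+ N) (k : ℤ) (m : M) (h : m ∈ trivFilt M k) :
    α m ∈ trivFilt N k := by
  rw [mem_trivFilt] at h ⊢
  intro hk
  rw [h hk, map_zero]

/-- A coefficientwise map preserves the order; the bound is weakened to the loss of one degree that
is allowed to δ because y itself loses one. -/
theorem map_trivFilt_pred (α : M →+ N) (k : ℤ) (m : M) (h : m ∈ trivFilt M k) :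
    α m ∈ trivFilt N (k - 1) :=
  antitone_trivFilt (by omega) (map_trivFilt α k m h)

theorem isFiltered_lmap_ord (α : M →+ N) : IsFiltered (ordFilt M) (ordFilt N) (lmap α) :=
  isFiltered_lmap α 0 fun k m h => by rw [add_zero]; exact map_trivFilt α k m h

/-- The operator `y + δ`, where `y` is the variable of the Laurent series in `y⁻¹` and where `δ`
acts on the coefficients. -/
def twist (δ : AddMonoid.End N) : LaurentSeries N →+ LaurentSeries N where
  toFun A := ofSuppBddBelow (fun j => A.coeff (j + 1) + δ (A.coeff j)) (by
    obtain ⟨n, hn⟩ := exists_lower A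
    refine ⟨n - 1, fun j hj => ?_⟩
    by_contra! h
    exact hj (by simp [hn (j + 1) (by omega), hn j (by omega)]))
  map_zero' := by ext; simp
  map_add' A B := by ext; simp; abel

@[simp] theorem coeff_twist (δ : AddMonoid.End N) (A : LaurentSeries N) (j : ℤ) :
    (twist δ A).coeff j = A.coeff (j + 1) + δ (A.coeff j) := rfl

/-- If (y + δ)A = 0, every coefficient is −δ of the preceding one, and those of small index vanish.
This is what makes the negative powers unique. -/
theorem twist_injective (δ : AddMonoid.End N) : Function.Injective (twist δ) := by
  rw [injective_iff_map_eq_zero]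
  intro A hA
  obtain ⟨n, hn⟩ := exists_lower A
  ext j
  have key : ∀ k : ℕ, A.coeff (n - 1 + k) = 0 := by
    intro k
    induction k with
    | zero => exact hn _ (by simp)
    | succ k ih =>
      have := congrArg (fun B => B.coeff (n - 1 + k)) hA
      simp only [coeff_twist, ih, map_zero, add_zero, coeff_zero] at this
      rw [← this]
      push_cast
      ring_nf
  by_cases h : j < n
  · exact hn j h
  · have := key (j - (n - 1)).toNat
    rwa [Int.toNat_of_nonneg (by omega), add_sub_cancel] at this

theorem isFiltered_twist {H : ℤ → AddSubgroup N} (δ : AddMonoid.End N)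
    (h : ∀ k m, m ∈ H k → δ m ∈ H (k - 1)) :
    IsFiltered (laurentFilt H) (laurentFilt H) (twist δ) :=
  ⟨map_add _, -1, fun n A hA j => by
    refine add_mem ?_ ?_
    · have := hA (j + 1)
      rwa [show n + -1 - j = n - (j + 1) by ring]
    · have := h _ _ (hA j)
      rwa [show n + -1 - j = n - j - 1 by ring]⟩

theorem end_pow_succ (δ : AddMonoid.End N) (k : ℕ) (x : N) :
    (δ ^ (k + 1)) x = δ ((δ ^ k) x) := by
  rw [pow_succ']
  rfl

/-- The coefficients of `(y + δ) ^ n f`, the powers being expanded in non-negative powers of `δ`. -/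
def binPow (δ : AddMonoid.End N) (n : ℤ) (f : ℤ → N) (j : ℤ) : N :=
  ∑ᶠ k : ℕ, Ring.choose n k • (δ ^ k) (f (j + n - k))

theorem binPow_eq_sum (δ : AddMonoid.End N) (n : ℤ) {f : ℤ → N} {a : ℤ} (hf : ∀ i < a, f i = 0)
    (j : ℤ) {K : ℕ} (hK : j + n - a < K) :
    binPow δ n f j = ∑ k ∈ Finset.range K, Ring.choose n k • (δ ^ k) (f (j + n - k)) := by
  refine finsum_eq_finsetSum_of_support_subset _ fun k hk => ?_
  rw [Finset.coe_range, Set.mem_Iio]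
  by_contra! h
  exact hk (by simp [hf (j + n - k) (by omega)])

/-- Since δ loses at most as much degree as y, all terms of the binomial expansion obey the same
bound. -/
theorem binPow_mem {H : ℤ → AddSubgroup N} (δ : AddMonoid.End N)
    (h : ∀ k m, m ∈ H k → δ m ∈ H (k - 1)) (n a : ℤ) {f : ℤ → N} (hf : ∀ j, f j ∈ H (a - j))
    (j : ℤ) : binPow δ n f j ∈ H (a - n - j) := by
  have h' : ∀ (k : ℕ) b m, m ∈ H b → (δ ^ k) m ∈ H (b - k) := by
    intro k
    induction k with
    | zero => intro b m hm; simpa using hm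
    | succ k ih =>
      intro b m hm
      rw [end_pow_succ]
      have := h _ _ (ih b m hm)
      rwa [sub_sub] at this
  refine finsum_induction (· ∈ H (a - n - j)) (zero_mem _) (fun _ _ => add_mem) fun k => ?_
  refine zsmul_mem ?_ _
  have := h' k _ _ (hf (j + n - k))
  rwa [show a - (j + n - k) - (k : ℤ) = a - n - j by ring] at this

theorem binPow_eq_zero (δ : AddMonoid.End N) (n : ℤ) {f : ℤ → N} {a : ℤ}
    (hf : ∀ i < a, f i = 0) (j : ℤ) (hj : j < a - n) : binPow δ n f j = 0 := by
  rw [binPow_eq_sum δ n hf j (K := 0) (by simp; omega)]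
  simp

theorem binPow_zero (δ : AddMonoid.End N) (f : ℤ → N) (j : ℤ) : binPow δ 0 f j = f j := by
  unfold binPow
  rw [finsum_eq_single _ 0]
  · simp
  · intro k hk
    rw [Ring.choose_zero_pos _ (Nat.pos_of_ne_zero hk), zero_smul]

/-- Pascal's rule, in the form of the recursion through which the powers of y + δ are characterized.
-/
theorem binPow_add_one (δ : AddMonoid.End N) (n : ℤ) {f : ℤ → N} {a : ℤ}
    (hf : ∀ i < a, f i = 0) (j : ℤ) :
    binPow δ (n + 1) f j = binPow δ n f (j + 1) + δ (binPow δ n f j) := by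
  -- One truncation serves all three sums: K + 1 terms for the two undifferentiated ones, and K
  -- terms for the one on which δ acts and raises the index by one.
  obtain ⟨K, hK⟩ : ∃ K : ℕ, j + n + 1 - a < K := ⟨(j + n + 1 - a).toNat + 1, by omega⟩
  rw [binPow_eq_sum δ (n + 1) hf j (K := K + 1) (by push_cast; omega),
    binPow_eq_sum δ n hf (j + 1) (K := K + 1) (by push_cast; omega),
    binPow_eq_sum δ n hf j (K := K) (by omega), Finset.sum_range_succ', Finset.sum_range_succ',
    map_sum]
  have : ∀ k : ℕ, Ring.choose (n + 1) (k + 1) • (δ ^ (k + 1)) (f (j + (n + 1) - ((k + 1 : ℕ) : ℤ)))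
      = Ring.choose n (k + 1) • (δ ^ (k + 1)) (f (j + 1 + n - ((k + 1 : ℕ) : ℤ)))
        + δ (Ring.choose n k • (δ ^ k) (f (j + n - k))) := by
    intro k
    rw [Ring.choose_succ_succ, add_smul, add_comm, map_zsmul, ← end_pow_succ]
    congr 4 <;> (push_cast; ring)
  rw [Finset.sum_congr rfl fun k _ => this k, Finset.sum_add_distrib]
  simp only [Ring.choose_zero_right]
  rw [show j + (n + 1) - ((0 : ℕ) : ℤ) = j + 1 + n - ((0 : ℕ) : ℤ) by ring]
  abel

theorem binPow_add (δ : AddMonoid.End N) (n : ℤ) {f g : ℤ → N} {a : ℤ}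
    (hf : ∀ i < a, f i = 0) (hg : ∀ i < a, g i = 0) (j : ℤ) :
    binPow δ n (fun i => f i + g i) j = binPow δ n f j + binPow δ n g j := by
  obtain ⟨K, hK⟩ : ∃ K : ℕ, j + n - a < K := ⟨(j + n - a).toNat + 1, by omega⟩
  rw [binPow_eq_sum δ n hf j hK, binPow_eq_sum δ n hg j hK,
    binPow_eq_sum δ n (f := fun i => f i + g i) (a := a)
      (fun i hi => by simp [hf i hi, hg i hi]) j hK,
    ← Finset.sum_add_distrib]
  simp

theorem binPow_map {K : Type*} [AddCommGroup K] (α : N →+ K) (δ : AddMonoid.End N)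
    (δ' : AddMonoid.End K) (h : ∀ x, α (δ x) = δ' (α x)) (n : ℤ) {f : ℤ → N} {a : ℤ}
    (hf : ∀ i < a, f i = 0) (j : ℤ) :
    α (binPow δ n f j) = binPow δ' n (fun i => α (f i)) j := by
  obtain ⟨k, hk⟩ : ∃ k : ℕ, j + n - a < k := ⟨(j + n - a).toNat + 1, by omega⟩
  have h' : ∀ (k : ℕ) x, α ((δ ^ k) x) = (δ' ^ k) (α x) := by
    intro k
    induction k with
    | zero => intro x; rfl
    | succ k ih =>
      intro x
      rw [end_pow_succ, h, ih, end_pow_succ]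
  rw [binPow_eq_sum δ n hf j hk, binPow_eq_sum δ' n (f := fun i => α (f i)) (a := a)
      (fun i hi => by simp [hf i hi]) j hk, map_sum]
  simp only [map_zsmul, h']

/-- The operator `(y + δ) ^ n`, for an integer `n`. -/
def twistPow (δ : AddMonoid.End N) (n : ℤ) : LaurentSeries N →+ LaurentSeries N where
  toFun A := ofSuppBddBelow (binPow δ n A.coeff) (by
    obtain ⟨a, ha⟩ := exists_lower A
    refine ⟨a - n, fun j hj => ?_⟩
    by_contra! h
    exact hj (binPow_eq_zero δ n ha j h))
  map_zero' := by ext; simp [binPow]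
  map_add' A B := by
    ext j
    obtain ⟨a, ha⟩ := exists_lower A
    obtain ⟨b, hb⟩ := exists_lower B
    exact binPow_add δ n (a := min a b) (fun i hi => ha i (by omega)) (fun i hi => hb i (by omega)) j

theorem coeff_twistPow (δ : AddMonoid.End N) (n : ℤ) (A : LaurentSeries N) (j : ℤ) :
    (twistPow δ n A).coeff j = binPow δ n A.coeff j := rfl

theorem twistPow_zero (δ : AddMonoid.End N) (A : LaurentSeries N) : twistPow δ 0 A = A := by
  ext j
  exact binPow_zero δ _ j

theorem twist_twistPow (δ : AddMonoid.End N) (n : ℤ) (A : LaurentSeries N) :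
    twist δ (twistPow δ n A) = twistPow δ (n + 1) A := by
  ext j
  obtain ⟨a, ha⟩ := exists_lower A
  exact (binPow_add_one δ n ha j).symm

/-- Two families indexed by the integers agree if they satisfy the same recursion given by an
injective map and agree at `0`. -/
theorem eq_of_injective_recursion {Y : Type*} {t : Y → Y} (ht : Function.Injective t)
    {g g' : ℤ → Y} (hg : ∀ n, t (g n) = g (n + 1)) (hg' : ∀ n, t (g' n) = g' (n + 1))
    (h : g 0 = g' 0) (n : ℤ) : g n = g' n := by
  induction n using Int.induction_on with
  | zero => exact h
  | succ n ih => rw [← hg, ← hg', ih]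
  | pred n ih => exact ht (by rw [hg, hg', sub_add_cancel, ih])

/-- A map intertwining y + δ with an injective t intertwines the negative powers too, since both
sides satisfy the same two-sided recursion. -/
theorem map_twistPow {Y : Type*} (Φ : LaurentSeries N → Y) (δ : AddMonoid.End N)
    {t : Y → Y} (ht : Function.Injective t) (h : ∀ A, Φ (twist δ A) = t (Φ A))
    (A : LaurentSeries N) {g : ℤ → Y} (hg : ∀ n, t (g n) = g (n + 1)) (h0 : g 0 = Φ A) (n : ℤ) :
    Φ (twistPow δ n A) = g n := by
  refine eq_of_injective_recursion (g := fun n => Φ (twistPow δ n A)) ht ?_ hg ?_ n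
  · intro n
    rw [← twist_twistPow, h]
  · rw [twistPow_zero, h0]

theorem map_twistPow_twistPow {K : Type*} [AddCommGroup K]
    (Φ : LaurentSeries N → LaurentSeries K) (δ : AddMonoid.End N) (δ' : AddMonoid.End K)
    (h : ∀ A, Φ (twist δ A) = twist δ' (Φ A)) (n : ℤ) (A : LaurentSeries N) :
    Φ (twistPow δ n A) = twistPow δ' n (Φ A) :=
  map_twistPow Φ δ (twist_injective δ') h A (g := fun n => twistPow δ' n (Φ A))
    (fun n => twist_twistPow δ' n _) (twistPow_zero _ _) n

theorem twistPow_twist (δ : AddMonoid.End N) (n : ℤ) (A : LaurentSeries N) :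
    twistPow δ n (twist δ A) = twistPow δ (n + 1) A := by
  rw [← twist_twistPow, map_twistPow_twistPow (twist δ) δ δ fun _ => rfl]

theorem twist_lmap {K : Type*} [AddCommGroup K] (α : N →+ K) {δ : AddMonoid.End N}
    {δ' : AddMonoid.End K} (h : ∀ x, α (δ x) = δ' (α x)) (A : LaurentSeries N) :
    lmap α (twist δ A) = twist δ' (lmap α A) := by
  ext j
  simp [h]

theorem twistPow_lmap {K : Type*} [AddCommGroup K] (α : N →+ K) {δ : AddMonoid.End N}
    {δ' : AddMonoid.End K} (h : ∀ x, α (δ x) = δ' (α x)) (n : ℤ) (A : LaurentSeries N) :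
    lmap α (twistPow δ n A) = twistPow δ' n (lmap α A) :=
  map_twistPow_twistPow _ δ δ' (twist_lmap α h) n A

theorem twist_single (δ : AddMonoid.End N) (r : ℤ) (x : N) :
    twist δ (single r x) = single (r - 1) x + single r (δ x) := by
  ext j
  simp only [coeff_twist, coeff_add, coeff_single, apply_ite δ, map_zero, eq_sub_iff_add_eq]
  congr

theorem twistPow_mem {H : ℤ → AddSubgroup N} (δ : AddMonoid.End N)
    (h : ∀ k m, m ∈ H k → δ m ∈ H (k - 1)) (n : ℤ) {a : ℤ} {A : LaurentSeries N}
    (hA : A ∈ laurentFilt H a) : twistPow δ n A ∈ laurentFilt H (a - n) :=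
  fun j => binPow_mem δ h n a hA j

end Twist

/-! ### Products of symbols with coefficients in arbitrary groups -/

section Gop

variable {M N K : Type*} [AddCommGroup M] [AddCommGroup N] [AddCommGroup K]

theorem gop_support (φ : M →+ N →+ K) (δ : AddMonoid.End N) {A : LaurentSeries M}
    {B : LaurentSeries N} {a b : ℤ} (hA : A ∈ ordFilt M a) (hB : B ∈ ordFilt N b) (j : ℤ) :
    (Function.support fun r : ℤ => φ (A.coeff r) ((twistPow δ (-r) B).coeff j)) ⊆
      (Finset.Icc a (j - b) : Finset ℤ) := by
  intro r hr
  rw [Finset.coe_Icc, Set.mem_Icc]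
  by_contra h
  refine hr ?_
  by_cases h1 : r < a
  · simp [mem_ordFilt.1 hA r h1]
  · have := mem_ordFilt.1 (twistPow_mem δ (map_trivFilt_pred δ) (-r) hB) j (by omega)
    simp [this]

/-- The series `∑ A_r (y + δ) ^ (-r) B`, the coefficients being multiplied by means of `φ`. -/
def gop (φ : M →+ N →+ K) (δ : AddMonoid.End N) :
    LaurentSeries M →+ LaurentSeries N →+ LaurentSeries K :=
  AddMonoidHom.mk' (fun A => AddMonoidHom.mk' (fun B =>
    ofSuppBddBelow (fun j => ∑ᶠ r : ℤ, φ (A.coeff r) ((twistPow δ (-r) B).coeff j)) (by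
      obtain ⟨a, ha⟩ := exists_mem_ordFilt A
      obtain ⟨b, hb⟩ := exists_mem_ordFilt B
      refine ⟨a + b, fun j hj => ?_⟩
      by_contra! h
      refine hj ?_
      dsimp only
      rw [finsum_eq_finsetSum_of_support_subset _ (gop_support φ δ ha hb j),
        Finset.Icc_eq_empty (by omega), Finset.sum_empty]))
    (fun B B' => by
      obtain ⟨a, ha⟩ := exists_mem_ordFilt A
      obtain ⟨b, hb⟩ := exists_mem_ordFilt B
      obtain ⟨b', hb'⟩ := exists_mem_ordFilt B'
      ext j
      simp only [coeff_ofSuppBddBelow, coeff_add, map_add]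
      exact finsum_add_distrib ((Finset.finite_toSet _).subset (gop_support φ δ ha hb j))
        ((Finset.finite_toSet _).subset (gop_support φ δ ha hb' j))))
    (fun A A' => by
      ext B j
      obtain ⟨a, ha⟩ := exists_mem_ordFilt A
      obtain ⟨a', ha'⟩ := exists_mem_ordFilt A'
      obtain ⟨b, hb⟩ := exists_mem_ordFilt B
      simp only [AddMonoidHom.mk'_apply, AddMonoidHom.add_apply, coeff_ofSuppBddBelow, coeff_add,
        map_add]
      exact finsum_add_distrib ((Finset.finite_toSet _).subset (gop_support φ δ ha hb j))
        ((Finset.finite_toSet _).subset (gop_support φ δ ha' hb j)))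

theorem coeff_gop (φ : M →+ N →+ K) (δ : AddMonoid.End N) (A : LaurentSeries M)
    (B : LaurentSeries N) (j : ℤ) :
    (gop φ δ A B).coeff j = ∑ᶠ r : ℤ, φ (A.coeff r) ((twistPow δ (-r) B).coeff j) := rfl

theorem gop_single (φ : M →+ N →+ K) (δ : AddMonoid.End N) (r : ℤ) (m : M)
    (B : LaurentSeries N) : gop φ δ (single r m) B = lmap (φ m) (twistPow δ (-r) B) := by
  ext j
  rw [coeff_gop, finsum_eq_single _ r]
  · simp
  · intro s hs
    rw [coeff_single_of_ne hs, map_zero, AddMonoidHom.zero_apply]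

theorem gop_mem {H : ℤ → AddSubgroup M} {H' : ℤ → AddSubgroup N} {H'' : ℤ → AddSubgroup K}
    (φ : M →+ N →+ K) (δ : AddMonoid.End N) (hδ : ∀ k n, n ∈ H' k → δ n ∈ H' (k - 1))
    (hφ : ∀ k l m n, m ∈ H k → n ∈ H' l → φ m n ∈ H'' (k + l)) {a b : ℤ}
    {A : LaurentSeries M} {B : LaurentSeries N} (hA : A ∈ laurentFilt H a)
    (hB : B ∈ laurentFilt H' b) : gop φ δ A B ∈ laurentFilt H'' (a + b) := by
  intro j
  rw [coeff_gop]
  refine finsum_induction (· ∈ H'' (a + b - j)) (zero_mem _) (fun _ _ => add_mem) fun r => ?_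
  have := hφ _ _ _ _ (hA r) (twistPow_mem δ hδ (-r) hB j)
  rwa [show a - r + (b - -r - j) = a + b - j by ring] at this

theorem trivFilt_mul (φ : M →+ N →+ K) (k l : ℤ) (m : M) (n : N) (hm : m ∈ trivFilt M k)
    (hn : n ∈ trivFilt N l) : φ m n ∈ trivFilt K (k + l) := by
  rw [mem_trivFilt] at *
  intro h
  by_cases hk : 0 < k
  · rw [hm hk, map_zero, AddMonoidHom.zero_apply]
  · rw [hn (by omega), map_zero]

theorem gop_mem_ord (φ : M →+ N →+ K) (δ : AddMonoid.End N) {a b : ℤ}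
    {A : LaurentSeries M} {B : LaurentSeries N} (hA : A ∈ ordFilt M a)
    (hB : B ∈ ordFilt N b) : gop φ δ A B ∈ ordFilt K (a + b) :=
  gop_mem φ δ (map_trivFilt_pred δ) (trivFilt_mul φ) hA hB

theorem isFiltered_gop_left (φ : M →+ N →+ K) (δ : AddMonoid.End N) (B : LaurentSeries N) :
    IsFiltered (ordFilt M) (ordFilt K) (fun A => gop φ δ A B) := by
  obtain ⟨b, hb⟩ := exists_mem_ordFilt B
  exact ⟨fun A A' => by rw [map_add, AddMonoidHom.add_apply], b, fun n A hA =>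
    gop_mem_ord φ δ hA hb⟩

theorem isFiltered_gop_right (φ : M →+ N →+ K) (δ : AddMonoid.End N) (A : LaurentSeries M) :
    IsFiltered (ordFilt N) (ordFilt K) (fun B => gop φ δ A B) := by
  obtain ⟨a, ha⟩ := exists_mem_ordFilt A
  exact ⟨fun A A' => by rw [map_add], a, fun n B hB => by
    rw [add_comm]; exact gop_mem_ord φ δ ha hB⟩

theorem lmap_gop {M' N' K' : Type*} [AddCommGroup M'] [AddCommGroup N'] [AddCommGroup K']
    (φ : M →+ N →+ K) (φ' : M' →+ N' →+ K') {δ : AddMonoid.End N} {δ' : AddMonoid.End N'}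
    (α : M →+ M') (β : N →+ N') (γ : K →+ K') (hδ : ∀ n, β (δ n) = δ' (β n))
    (h : ∀ m n, γ (φ m n) = φ' (α m) (β n)) (A : LaurentSeries M) (B : LaurentSeries N) :
    lmap γ (gop φ δ A B) = gop φ' δ' (lmap α A) (lmap β B) := by
  refine IsFiltered.ext_single ordFilt_sep (f := fun A => lmap γ (gop φ δ A B))
    (g := fun A => gop φ' δ' (lmap α A) (lmap β B))
    ((isFiltered_lmap_ord γ).comp (isFiltered_gop_left φ δ B))
    ((isFiltered_gop_left φ' δ' _).comp (isFiltered_lmap_ord α)) (fun r m => ?_) A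
  rw [lmap_single, gop_single, gop_single, ← twistPow_lmap β hδ]
  ext j
  simp [h]

/-- For operators this is A ∘ (∂ ∘ B) = (A ∘ ∂) ∘ B: a factor ∂ on the right of A multiplies its
symbol by the variable. -/
theorem gop_twist_right (φ : M →+ N →+ K) (δ : AddMonoid.End N) (A : LaurentSeries M)
    (B : LaurentSeries N) : gop φ δ A (twist δ B) = gop φ δ (twist 0 A) B := by
  refine IsFiltered.ext_single ordFilt_sep (f := fun A => gop φ δ A (twist δ B))
    (g := fun A => gop φ δ (twist 0 A) B) (isFiltered_gop_left φ δ _)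
    ((isFiltered_gop_left φ δ _).comp (isFiltered_twist _ (map_trivFilt_pred _)))
    (fun r m => ?_) A
  rw [gop_single, twistPow_twist, twist_single]
  simp only [AddMonoid.End.zero_apply, map_zero, add_zero]
  rw [gop_single, neg_sub, sub_eq_add_neg, add_comm]

/-- For operators this is ∂ ∘ (A ∘ B) = (∂ ∘ A) ∘ B; the hypothesis is the Leibniz rule for the
pairing φ. -/
theorem twist_gop (φ : M →+ N →+ K) {δ : AddMonoid.End N} {δM : AddMonoid.End M}
    {δK : AddMonoid.End K} (h : ∀ m n, δK (φ m n) = φ (δM m) n + φ m (δ n))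
    (A : LaurentSeries M) (B : LaurentSeries N) :
    twist δK (gop φ δ A B) = gop φ δ (twist δM A) B := by
  refine IsFiltered.ext_single ordFilt_sep (f := fun A => twist δK (gop φ δ A B))
    (g := fun A => gop φ δ (twist δM A) B)
    ((isFiltered_twist _ (map_trivFilt_pred _)).comp (isFiltered_gop_left φ δ _))
    ((isFiltered_gop_left φ δ _).comp (isFiltered_twist _ (map_trivFilt_pred _)))
    (fun r m => ?_) A
  rw [gop_single, twist_single, map_add, AddMonoidHom.add_apply, gop_single, gop_single,
    show -(r - 1) = -r + 1 by ring, ← twist_twistPow]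
  ext j
  simp only [coeff_twist, coeff_lmap, coeff_add, h, map_add]
  abel

theorem twistPow_gop (φ : M →+ N →+ K) {δ : AddMonoid.End N} {δM : AddMonoid.End M}
    {δK : AddMonoid.End K} (h : ∀ m n, δK (φ m n) = φ (δM m) n + φ m (δ n)) (n : ℤ)
    (A : LaurentSeries M) (B : LaurentSeries N) :
    twistPow δK n (gop φ δ A B) = gop φ δ (twistPow δM n A) B :=
  (map_twistPow_twistPow (fun A => gop φ δ A B) δM δK (fun A => (twist_gop φ h A B).symm) n A).symm

/-- By density A is a monomial; its power of y + δ is then absorbed in B by `twistPow_gop`, and its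
coefficient by the associativity of the pairings. -/
theorem gop_assoc {P Q R : Type*} [AddCommGroup P] [AddCommGroup Q] [AddCommGroup R]
    (φ₁ : M →+ Q →+ R) (φ₂ : N →+ P →+ Q) (φ₃ : K →+ P →+ R) (φ₄ : M →+ N →+ K)
    {δN : AddMonoid.End N} {δP : AddMonoid.End P} {δQ : AddMonoid.End Q}
    (hδ : ∀ n p, δQ (φ₂ n p) = φ₂ (δN n) p + φ₂ n (δP p))
    (h : ∀ m n p, φ₁ m (φ₂ n p) = φ₃ (φ₄ m n) p)
    (A : LaurentSeries M) (B : LaurentSeries N) (E : LaurentSeries P) :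
    gop φ₁ δQ A (gop φ₂ δP B E) = gop φ₃ δP (gop φ₄ δN A B) E := by
  refine IsFiltered.ext_single ordFilt_sep (f := fun A => gop φ₁ δQ A (gop φ₂ δP B E))
    (g := fun A => gop φ₃ δP (gop φ₄ δN A B) E) (isFiltered_gop_left φ₁ δQ _)
    ((isFiltered_gop_left φ₃ δP E).comp (isFiltered_gop_left φ₄ δN B)) (fun r m => ?_) A
  rw [gop_single, gop_single, twistPow_gop φ₂ hδ]
  have := lmap_gop φ₂ φ₃ (δ := δP) (δ' := δP) (φ₄ m) (AddMonoidHom.id P) (φ₁ m) (fun _ => rfl)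
    (h m) (twistPow δN (-r) B) E
  rw [this]
  rfl

end Gop

/-- No additivity or injectivity is required of f: for negative powers, A is written as y + δ
applied to its own inverse image, and one factor is moved across. -/
theorem balanced_twistPow {M N Y : Type*} [AddCommGroup M] [AddCommGroup N]
    (f : LaurentSeries M → LaurentSeries N → Y) (δ : AddMonoid.End M) (δ' : AddMonoid.End N)
    (h : ∀ A B, f A (twist δ' B) = f (twist δ A) B) (n : ℤ) (A : LaurentSeries M)
    (B : LaurentSeries N) : f A (twistPow δ' n B) = f (twistPow δ n A) B := by
  induction n using Int.induction_on generalizing A with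
  | zero => rw [twistPow_zero, twistPow_zero]
  | succ n ih => rw [← twist_twistPow, h, ih, twistPow_twist]
  | pred n ih =>
    have hA : twist δ (twistPow δ (-1) A) = A := by
      rw [twist_twistPow, neg_add_cancel, twistPow_zero]
    conv_lhs => rw [← hA, ← h, twist_twistPow, sub_add_cancel, ih]
    conv_rhs => rw [← hA, twistPow_twist, sub_add_cancel]

theorem gop_twistPow_right {M N K : Type*} [AddCommGroup M] [AddCommGroup N] [AddCommGroup K]
    (φ : M →+ N →+ K) (δ : AddMonoid.End N) (n : ℤ) (A : LaurentSeries M)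
    (B : LaurentSeries N) : gop φ δ A (twistPow δ n B) = gop φ δ (twistPow 0 n A) B :=
  balanced_twistPow (fun A B => gop φ δ A B) 0 δ (gop_twist_right φ δ) n A B

/-- For operators this is A ∘ (B ∘ ∂) = (A ∘ B) ∘ ∂. -/
theorem gop_twist_zero {M N K : Type*} [AddCommGroup M] [AddCommGroup N] [AddCommGroup K]
    (φ : M →+ N →+ K) (δ : AddMonoid.End N) (A : LaurentSeries M)
    (B : LaurentSeries N) : gop φ δ A (twist 0 B) = twist 0 (gop φ δ A B) := by
  refine IsFiltered.ext_single ordFilt_sep (f := fun A => gop φ δ A (twist 0 B))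
    (g := fun A => twist 0 (gop φ δ A B)) (isFiltered_gop_left φ δ _)
    ((isFiltered_twist _ (map_trivFilt_pred _)).comp (isFiltered_gop_left φ δ _))
    (fun r m => ?_) A
  rw [gop_single, gop_single,
    ← map_twistPow_twistPow (twist 0) δ δ (fun A => by ext j; simp), twist_lmap (δ' := 0)]
  simp

/-! ### The algebra of scalar pseudodifferential operators -/

section OneVariable

variable {F V : Type*} [CommRing F] [CommRing V] [Algebra F V] (d : Derivation F V V)

/-- A derivation as an additive endomorphism. -/
def derEnd : AddMonoid.End V := (d : V →ₗ[F] V).toAddMonoidHom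

@[simp] theorem derEnd_apply (x : V) : derEnd d x = d x := rfl

theorem derEnd_pow_apply (k : ℕ) (x : V) : (derEnd d ^ k) x = ((d : V →ₗ[F] V) ^ k) x := by
  induction k with
  | zero => rfl
  | succ k ih =>
    rw [end_pow_succ, ih, pow_succ', Module.End.mul_apply]
    rfl

/-- The product of symbols as a biadditive map. -/
def opMul : LaurentSeries V →+ LaurentSeries V →+ LaurentSeries V :=
  gop AddMonoidHom.mul (derEnd d)

/-- The double sum over (k, r) is summed first over k, which produces the powers of λ + ∂ applied to
B. -/
theorem opProd_eq_opMul (A B : LaurentSeries V) : opProd d A B = opMul d A B := by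
  ext j
  obtain ⟨a, ha⟩ := exists_lower A
  obtain ⟨b, hb⟩ := exists_lower B
  have hfin := opProd_finite d A B j
  have h1 : (opProd d A B).coeff j = ∑ r ∈ Finset.Icc a (j - b),
      ∑ k ∈ Finset.range (j - a - b + 1).toNat, Ring.choose (-r) k •
        (A.coeff r * ((d : V →ₗ[F] V) ^ k) (B.coeff (j - r - k))) := by
    rw [Finset.sum_comm, ← Finset.sum_product']
    refine finsum_eq_finsetSum_of_support_subset _ ?_
    rintro ⟨k, r⟩ h
    have h1 : a ≤ r := by
      by_contra! hlt
      exact h (by simp [ha r hlt])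
    have h2 : b ≤ j - r - k := by
      by_contra! hlt
      exact h (by simp [hb _ hlt])
    simp only [Finset.coe_product, Set.mem_prod, Finset.mem_coe, Finset.mem_range, Finset.mem_Icc]
    omega
  rw [h1, opMul, coeff_gop, finsum_eq_finsetSum_of_support_subset _
    (gop_support _ (derEnd d) (mem_ordFilt.2 ha) (mem_ordFilt.2 hb) j)]
  refine Finset.sum_congr rfl fun r hr => ?_
  rw [Finset.mem_Icc] at hr
  rw [coeff_twistPow, binPow_eq_sum _ _ hb j (K := (j - a - b + 1).toNat) (by omega),
    map_sum]
  refine Finset.sum_congr rfl fun k _ => ?_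
  rw [map_zsmul, derEnd_pow_apply, ← sub_eq_add_neg]
  rfl

theorem opMul_assoc (A B E : LaurentSeries V) :
    opMul d (opMul d A B) E = opMul d A (opMul d B E) :=
  (gop_assoc _ _ _ _ (fun n p => by simp [mul_comm, add_comm])
    (fun m n p => by simp [mul_assoc]) A B E).symm

theorem opMul_single (r : ℤ) (a : V) (B : LaurentSeries V) :
    opMul d (single r a) B = a • twistPow (derEnd d) (-r) B :=
  gop_single _ _ _ _ _

theorem opMul_C_left (a : V) (B : LaurentSeries V) : opMul d (C a) B = a • B := by
  rw [C_apply, opMul_single, neg_zero, twistPow_zero]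

theorem opMul_one_left (B : LaurentSeries V) : opMul d 1 B = B := by
  rw [← C_one, opMul_C_left, one_smul]

theorem opMul_smul_left (a : V) (A B : LaurentSeries V) :
    opMul d (a • A) B = a • opMul d A B := by
  rw [← opMul_C_left d, opMul_assoc, opMul_C_left]

theorem smul_single (r : ℤ) (a b : V) :
    a • (single r b : LaurentSeries V) = single r (a * b) :=
  lmap_single (AddMonoidHom.mulLeft a) r b

theorem opMul_C_C (a b : V) : opMul d (C a) (C b) = C (a * b) := by
  rw [opMul_C_left, C_apply, C_apply, smul_single]

theorem twist_opMul (A B : LaurentSeries V) :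
    twist (derEnd d) (opMul d A B) = opMul d (twist (derEnd d) A) B :=
  twist_gop _ (fun m n => by simp [mul_comm, add_comm]) A B

theorem twistPow_opMul (n : ℤ) (A B : LaurentSeries V) :
    twistPow (derEnd d) n (opMul d A B) = opMul d (twistPow (derEnd d) n A) B :=
  twistPow_gop _ (fun m n => by simp [mul_comm, add_comm]) n A B

theorem opMul_twist (A B : LaurentSeries V) :
    opMul d A (twist (derEnd d) B) = opMul d (twist 0 A) B :=
  gop_twist_right _ _ A B

theorem opMul_twist_zero (A B : LaurentSeries V) :
    opMul d A (twist 0 B) = twist 0 (opMul d A B) :=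
  gop_twist_zero _ _ A B

theorem lam_mul (A : LaurentSeries V) : lam V * A = twist 0 A := by
  ext j
  simp [lam, coeff_single_mul]

theorem lam_mul_add_map (A : LaurentSeries V) :
    lam V * A + A.map d = twist (derEnd d) A := by
  rw [lam_mul]
  ext j
  simp

theorem twistPow_one (n : ℤ) : twistPow (derEnd d) n (1 : LaurentSeries V) = single (-n) 1 := by
  refine map_twistPow (fun A => A) (derEnd d) (twist_injective (derEnd d)) (fun _ => rfl) 1
    (g := fun n => single (-n) (1 : V)) (fun n => ?_) (by simp) n
  rw [twist_single, derEnd_apply, Derivation.map_one_eq_zero, map_zero, add_zero]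
  congr 2
  ring

theorem opMul_one_right (A : LaurentSeries V) : opMul d A 1 = A := by
  refine IsFiltered.ext_single ordFilt_sep (f := fun A => opMul d A 1) (g := fun A => A)
    (isFiltered_gop_left _ _ _) ⟨fun _ _ => rfl, 0, fun n x hx => by simpa using hx⟩
    (fun r m => ?_) A
  rw [opMul_single, twistPow_one, neg_neg]
  ext j
  by_cases h : j = r
  · simp [h]
  · simp [coeff_single_of_ne h]

end OneVariable

/-! ### The formal adjoint -/

section Adjoint

variable {F V : Type*} [CommRing F] [CommRing V] [Algebra F V] (d : Derivation F V V)

theorem coeff_reflect (A : LaurentSeries V) (j : ℤ) : (reflect d A).coeff j =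
    ∑ᶠ k : ℕ, (((k : ℤ) - j).negOnePow : ℤ) •
      Ring.choose ((k : ℤ) - j) k • ((d : V →ₗ[F] V) ^ k) (A.coeff (j - k)) := rfl

theorem reflect_finite (A : LaurentSeries V) (j : ℤ) :
    (Function.support fun k : ℕ => (((k : ℤ) - j).negOnePow : ℤ) •
      Ring.choose ((k : ℤ) - j) k • ((d : V →ₗ[F] V) ^ k) (A.coeff (j - k))).Finite := by
  obtain ⟨a, ha⟩ := exists_lower A
  refine (Finset.finite_toSet (Finset.range (j - a + 1).toNat)).subset fun k hk => ?_
  rw [Finset.coe_range, Set.mem_Iio]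
  by_contra! h
  exact hk (by simp [ha (j - k) (by omega)])

theorem isFiltered_reflect : IsFiltered (ordFilt V) (ordFilt V) (reflect d) where
  map_add A B := by
    ext j
    rw [coeff_add, coeff_reflect, coeff_reflect, coeff_reflect,
      ← finsum_add_distrib (reflect_finite d A j) (reflect_finite d B j)]
    exact finsum_congr fun k => by rw [coeff_add, map_add, smul_add, smul_add]
  bound := ⟨0, fun n A hA => by
    rw [mem_ordFilt] at hA ⊢
    intro j hj
    rw [coeff_reflect]
    exact finsum_eq_zero_of_forall_eq_zero fun k => by simp [hA (j - k) (by omega)]⟩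

theorem reflect_add (A B : LaurentSeries V) :
    reflect d (A + B) = reflect d A + reflect d B := (isFiltered_reflect d).map_add A B

/-- The adjoint as an additive map. -/
def reflectHom : LaurentSeries V →+ LaurentSeries V :=
  AddMonoidHom.mk' (reflect d) (reflect_add d)

theorem reflectHom_apply (A : LaurentSeries V) : reflectHom d A = reflect d A := rfl

/-- The adjoint of a ∂^(−r) is (−∂)^(−r) ∘ a. -/
theorem reflect_single (r : ℤ) (a : V) : reflectHom d (single r a)
    = (r.negOnePow : ℤ) • twistPow (derEnd d) (-r) (C a) := by
  ext j
  rw [reflectHom_apply, coeff_reflect, coeff_smul, coeff_twistPow, binPow, smul_finsum']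
  · refine finsum_congr fun k => ?_
    rw [derEnd_pow_apply, C_apply]
    by_cases h : j - k = r
    · rw [h, show j + -r - k = 0 by omega, show (k : ℤ) - j = -r by omega, coeff_single_same,
        coeff_single_same, Int.negOnePow_neg]
    · rw [coeff_single_of_ne h, coeff_single_of_ne (by omega)]
      simp
  · refine (Finset.finite_toSet (Finset.range (j - r + 1).toNat)).subset fun k hk => ?_
    rw [Finset.coe_range, Set.mem_Iio]
    by_contra! h
    refine hk ?_
    dsimp only
    rw [C_apply, coeff_single_of_ne (by omega), map_zero, smul_zero]

theorem negOnePow_sub_one (r : ℤ) : ((r - 1).negOnePow : ℤ) = -(r.negOnePow : ℤ) := by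
  rw [Int.negOnePow_sub, Int.negOnePow_one]
  simp

theorem negOnePow_add_one (r : ℤ) : ((r + 1).negOnePow : ℤ) = -(r.negOnePow : ℤ) := by
  rw [Int.negOnePow_succ]
  simp

theorem isFiltered_twist_ord {N : Type*} [AddCommGroup N] (δ : AddMonoid.End N) :
    IsFiltered (ordFilt N) (ordFilt N) (twist δ) :=
  isFiltered_twist _ (map_trivFilt_pred _)

theorem twist_comm {N : Type*} [AddCommGroup N] (δ δ' : AddMonoid.End N)
    (h : ∀ x, δ (δ' x) = δ' (δ x)) (A : LaurentSeries N) :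
    twist δ (twist δ' A) = twist δ' (twist δ A) := by
  ext j
  simp only [coeff_twist, map_add, h]
  abel

/-- For operators this is (∂ ∘ A)* = −A* ∘ ∂. -/
theorem reflect_twist (A : LaurentSeries V) :
    reflectHom d (twist (derEnd d) A) = -twist 0 (reflectHom d A) := by
  refine IsFiltered.ext_single ordFilt_sep (f := fun A => reflectHom d (twist (derEnd d) A))
    (g := fun A => -twist 0 (reflectHom d A))
    ((isFiltered_reflect d).comp (isFiltered_twist_ord _))
    ((isFiltered_twist_ord _).comp (isFiltered_reflect d)).neg (fun r a => ?_) A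
  have h0 : twist 0 (C a : LaurentSeries V) = twist (derEnd d) (C a) - C (derEnd d a) := by
    rw [C_apply, twist_single, twist_single, C_apply]
    simp
  rw [twist_single, map_add, reflect_single, reflect_single, reflect_single, negOnePow_sub_one,
    map_zsmul, map_twistPow_twistPow (twist 0) (derEnd d) (derEnd d)
      (twist_comm _ _ fun x => by simp), h0, map_sub, twistPow_twist,
    show -(r - 1) = -r + 1 by ring, neg_smul, smul_sub]
  abel

theorem reflect_smul (a : V) (A : LaurentSeries V) :
    reflectHom d (a • A) = opMul d (reflectHom d A) (C a) := by
  refine IsFiltered.ext_single ordFilt_sep (f := fun A => reflectHom d (a • A))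
    (g := fun A => opMul d (reflectHom d A) (C a))
    ((isFiltered_reflect d).comp (isFiltered_lmap_ord (AddMonoidHom.mulLeft a)))
    ((isFiltered_gop_left _ _ _).comp (isFiltered_reflect d)) (fun r x => ?_) A
  rw [smul_single, reflect_single, reflect_single, map_zsmul, AddMonoidHom.zsmul_apply, ← twistPow_opMul,
    opMul_C_C, mul_comm]

theorem reflect_twistPow (n : ℤ) (A : LaurentSeries V) :
    reflectHom d (twistPow (derEnd d) n A) = (n.negOnePow : ℤ) • twistPow 0 n (reflectHom d A) := by
  refine map_twistPow (reflectHom d) (derEnd d) (t := fun X => -twist 0 X)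
    (neg_injective.comp (twist_injective 0)) (reflect_twist d) A
    (g := fun n => (n.negOnePow : ℤ) • twistPow 0 n (reflectHom d A)) (fun n => ?_) ?_ n
  · rw [map_zsmul, twist_twistPow, negOnePow_add_one, neg_smul]
  · simp [twistPow_zero]

/-- The adjoint is an anti-automorphism. -/
theorem reflect_opMul (A B : LaurentSeries V) :
    reflectHom d (opMul d A B) = opMul d (reflectHom d B) (reflectHom d A) := by
  refine IsFiltered.ext_single ordFilt_sep (f := fun A => reflectHom d (opMul d A B))
    (g := fun A => opMul d (reflectHom d B) (reflectHom d A))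
    ((isFiltered_reflect d).comp (isFiltered_gop_left _ _ _))
    ((isFiltered_gop_right _ _ _).comp (isFiltered_reflect d)) (fun r a => ?_) A
  rw [opMul_single, reflect_smul, reflect_twistPow, reflect_single, map_zsmul, map_zsmul,
    AddMonoidHom.zsmul_apply, Int.negOnePow_neg, opMul, gop_twistPow_right]

theorem reflect_one : reflectHom d (1 : LaurentSeries V) = 1 := by
  have := reflect_single d 0 1
  rw [neg_zero, twistPow_zero, Int.negOnePow_zero, C_one] at this
  simpa using this

end Adjoint

/-! ### The Dirac bracket: every property except the Jacobi identity -/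

section Dirac

variable {F V : Type*} [Field F] [CommRing V] [Algebra F V] {d : Derivation F V V}
  {br : V →ₗ[F] V →ₗ[F] LaurentSeries V}

theorem IsPVABracket.twist_left (hbr : IsPVABracket d br) (a b : V) :
    br (d a) b = -twist 0 (br a b) := by
  rw [hbr.sesq_left, lam_mul]

theorem IsPVABracket.twist_right (hbr : IsPVABracket d br) (a b : V) :
    br a (d b) = twist (derEnd d) (br a b) := by
  rw [hbr.sesq_right, lam_mul_add_map]

theorem IsPVABracket.mul_left (hbr : IsPVABracket d br) (a b c : V) :
    br (a * b) c = opMul d (br a c) (C b) + opMul d (br b c) (C a) := by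
  rw [hbr.leibniz_right, opProd_eq_opMul, opProd_eq_opMul]

theorem IsPVABracket.skew' (hbr : IsPVABracket d br) (a b : V) :
    br b a = -reflectHom d (br a b) := hbr.skew a b

variable {m : ℕ} {θ : Fin m → V} {D : Matrix (Fin m) (Fin m) (LaurentSeries V)}

/-- The coefficients `∑ (C⁻¹)_{βα}(λ + ∂) {a_λ θ_α}` of the constraints in the Dirac
modification of a bracket. -/
def diracCoef (d : Derivation F V V) (br : V →ₗ[F] V →ₗ[F] LaurentSeries V) (θ : Fin m → V)
    (D : Matrix (Fin m) (Fin m) (LaurentSeries V)) (β : Fin m) : V →+ LaurentSeries V :=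
  ∑ α, (opMul d (D β α)).comp ((br.flip (θ α)).toAddMonoidHom)

theorem diracCoef_apply (β : Fin m) (a : V) :
    diracCoef d br θ D β a = ∑ α, opMul d (D β α) (br a (θ α)) := by
  simp [diracCoef]

theorem dirac_apply (a b : V) : dirac d br θ D a b
    = br a b - ∑ β, opMul d (br (θ β) b) (diracCoef d br θ D β a) := by
  simp only [diracCoef_apply, map_sum]
  rw [Finset.sum_comm]
  simp only [← opProd_eq_opMul]
  rfl

theorem IsInverseOp.sum_right (hD : IsInverseOp d (constraintMatrix br θ) D) (α γ : Fin m) :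
    ∑ β, opMul d (br (θ β) (θ α)) (D β γ) = if α = γ then 1 else 0 := by
  rw [← hD.1 α γ]
  exact Finset.sum_congr rfl fun β _ => (opProd_eq_opMul _ _ _).symm

theorem IsInverseOp.sum_left (hD : IsInverseOp d (constraintMatrix br θ) D) (α γ : Fin m) :
    ∑ β, opMul d (D α β) (br (θ γ) (θ β)) = if α = γ then 1 else 0 := by
  rw [← hD.2 α γ]
  exact Finset.sum_congr rfl fun β _ => (opProd_eq_opMul _ _ _).symm

theorem sum_opMul_ite (X : Fin m → LaurentSeries V) (γ : Fin m) :
    ∑ β, opMul d (if γ = β then 1 else 0) (X β) = X γ := by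
  rw [Finset.sum_eq_single γ]
  · rw [if_pos rfl, opMul_one_left]
  · intro β _ h
    rw [if_neg h.symm, map_zero, AddMonoidHom.zero_apply]
  · simp

/-- The coefficients of the constraints solve the linear system given by the constraint matrix. -/
theorem sum_opMul_diracCoef (hD : IsInverseOp d (constraintMatrix br θ) D) (a : V) (γ : Fin m) :
    ∑ β, opMul d (br (θ β) (θ γ)) (diracCoef d br θ D β a) = br a (θ γ) := by
  simp only [diracCoef_apply, map_sum, ← opMul_assoc]
  rw [Finset.sum_comm]
  simp only [← AddMonoidHom.finsetSum_apply, ← map_sum, hD.sum_right]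
  exact sum_opMul_ite _ _

theorem dirac_constraint_right (hD : IsInverseOp d (constraintMatrix br θ) D) (a : V)
    (i : Fin m) : dirac d br θ D a (θ i) = 0 := by
  rw [dirac_apply, sum_opMul_diracCoef hD, sub_self]

theorem diracCoef_constraint (hD : IsInverseOp d (constraintMatrix br θ) D) (i β : Fin m) :
    diracCoef d br θ D β (θ i) = if β = i then 1 else 0 := by
  rw [diracCoef_apply, hD.sum_left]

/-- Here C⁻¹ is used as a left inverse, whereas vanishing in the second argument uses it as a right
inverse. -/
theorem dirac_constraint_left (hD : IsInverseOp d (constraintMatrix br θ) D) (a : V)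
    (i : Fin m) : dirac d br θ D (θ i) a = 0 := by
  rw [dirac_apply, Finset.sum_eq_single i]
  · rw [diracCoef_constraint hD, if_pos rfl, opMul_one_right, sub_self]
  · intro β _ h
    rw [diracCoef_constraint hD, if_neg h, map_zero]
  · simp

theorem diracCoef_der (hbr : IsPVABracket d br) (β : Fin m) (a : V) :
    diracCoef d br θ D β (d a) = -twist 0 (diracCoef d br θ D β a) := by
  simp only [diracCoef_apply, hbr.twist_left, map_neg, opMul_twist_zero, Finset.sum_neg_distrib,
    map_sum]

theorem diracCoef_mul (hbr : IsPVABracket d br) (β : Fin m) (a b : V) :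
    diracCoef d br θ D β (a * b) = opMul d (diracCoef d br θ D β a) (C b)
      + opMul d (diracCoef d br θ D β b) (C a) := by
  simp only [diracCoef_apply, hbr.mul_left, map_add, ← opMul_assoc, Finset.sum_add_distrib,
    map_sum, AddMonoidHom.finsetSum_apply]

theorem dirac_twist_left (hbr : IsPVABracket d br) (a b : V) :
    dirac d br θ D (d a) b = -twist 0 (dirac d br θ D a b) := by
  simp only [dirac_apply, hbr.twist_left, diracCoef_der hbr, map_neg, opMul_twist_zero, map_sub,
    map_sum, Finset.sum_neg_distrib]
  abel

theorem dirac_twist_right (hbr : IsPVABracket d br) (a b : V) :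
    dirac d br θ D a (d b) = twist (derEnd d) (dirac d br θ D a b) := by
  simp only [dirac_apply, hbr.twist_right, ← twist_opMul, map_sub, map_sum]

theorem dirac_mul_right (hbr : IsPVABracket d br) (a b c : V) :
    dirac d br θ D a (b * c) = b • dirac d br θ D a c + c • dirac d br θ D a b := by
  simp only [dirac_apply, hbr.leibniz_left, map_add, AddMonoidHom.add_apply, opMul_smul_left,
    Finset.sum_add_distrib, smul_sub, Finset.smul_sum]
  abel

theorem dirac_mul_left (hbr : IsPVABracket d br) (a b c : V) :
    dirac d br θ D (a * b) c = opMul d (dirac d br θ D a c) (C b)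
      + opMul d (dirac d br θ D b c) (C a) := by
  simp only [dirac_apply, hbr.mul_left, diracCoef_mul hbr, map_add, map_sub,
    AddMonoidHom.sub_apply, ← opMul_assoc, Finset.sum_add_distrib, map_sum,
    AddMonoidHom.finsetSum_apply]
  abel

/-- Skewsymmetry of the bracket makes C skew-adjoint. Hence minus the adjoint of C⁻¹ is again an
inverse of C, and inverses are unique. -/
theorem reflect_inverse (hbr : IsPVABracket d br)
    (hD : IsInverseOp d (constraintMatrix br θ) D) (α β : Fin m) :
    reflectHom d (D α β) = -D β α := by
  have h1 : ∀ γ δ, ∑ ε, opMul d (-reflectHom d (D ε δ)) (br (θ γ) (θ ε))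
      = if γ = δ then 1 else 0 := by
    intro γ δ
    have := congrArg (reflectHom d) (hD.sum_right γ δ)
    rw [map_sum, apply_ite (reflectHom d), reflectHom_apply d 1, ← reflectHom_apply, reflect_one,
      map_zero] at this
    rw [← this]
    refine Finset.sum_congr rfl fun ε _ => ?_
    rw [reflect_opMul, hbr.skew' (θ ε) (θ γ), map_neg, map_neg, AddMonoidHom.neg_apply, neg_neg]
  -- Uniqueness of the inverse: the triple product (−D*) C D is evaluated with the two bracketings.
  have h2 : ∑ γ, ∑ ε, opMul d (opMul d (-reflectHom d (D ε β)) (br (θ γ) (θ ε))) (D γ α)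
      = -reflectHom d (D α β) := by
    rw [Finset.sum_comm]
    simp only [opMul_assoc, ← map_sum, hD.sum_right]
    rw [Finset.sum_eq_single α]
    · rw [if_pos rfl, opMul_one_right]
    · intro ε _ h
      rw [if_neg h, map_zero]
    · simp
  simp only [← AddMonoidHom.finsetSum_apply, ← map_sum, h1] at h2
  rw [← neg_eq_iff_eq_neg, ← h2, Finset.sum_eq_single β]
  · rw [if_pos rfl, opMul_one_left]
  · intro γ _ h
    rw [if_neg h, map_zero, AddMonoidHom.zero_apply]
  · simp

/-- The adjoint reverses the triple product in the correction; its three factors each change sign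
and are transposed, so the correction is skew like the bracket. -/
theorem dirac_skew (hbr : IsPVABracket d br)
    (hD : IsInverseOp d (constraintMatrix br θ) D) (a b : V) :
    dirac d br θ D b a = -reflectHom d (dirac d br θ D a b) := by
  simp only [dirac_apply, diracCoef_apply, map_sub, map_sum, reflect_opMul, neg_sub,
    hbr.skew' a b, opMul_assoc]
  rw [sub_eq_sub_iff_add_eq_add, neg_add_eq_sub]
  have : ∀ α β, opMul d (reflectHom d (br a (θ β))) (opMul d (reflectHom d (D α β))
      (reflectHom d (br (θ α) b))) = -opMul d (br (θ β) a) (opMul d (D β α) (br b (θ α))) := by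
    intro α β
    rw [reflect_inverse hbr hD, hbr.skew' a (θ β), hbr.skew' (θ α) b]
    simp
  simp only [this, Finset.sum_neg_distrib]
  rw [Finset.sum_comm]
  abel

/-- The generators ∂ᵏθ_i have zero bracket, by centrality and sesquilinearity; the Leibniz rule
extends this to the ideal, modulo the ideal. -/
theorem dirac_mem_diffIdeal_right (hbr : IsPVABracket d br)
    (hD : IsInverseOp d (constraintMatrix br θ) D) {x : V} (hx : x ∈ diffIdeal d θ) (a : V)
    (n : ℤ) : (dirac d br θ D a x).coeff n ∈ diffIdeal d θ := by
  unfold diffIdeal at hx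
  induction hx using Submodule.span_induction generalizing n with
  | mem x h =>
    obtain ⟨i, k, rfl⟩ := h
    have : dirac d br θ D a (((d : V →ₗ[F] V) ^ k) (θ i)) = 0 := by
      induction k with
      | zero => exact dirac_constraint_right hD a i
      | succ k ih =>
        rw [pow_succ', Module.End.mul_apply]
        exact (dirac_twist_right hbr a _).trans (by rw [ih, map_zero])
    rw [this]
    exact zero_mem _
  | zero => simp
  | add x y _ _ hx hy =>
    rw [map_add]
    exact add_mem (hx n) (hy n)
  | smul v x hx' hx =>
    rw [smul_eq_mul, dirac_mul_right hbr]
    exact add_mem (Ideal.mul_mem_left _ _ (hx n)) (Ideal.mul_mem_right _ _ hx')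

theorem der_pow_mem_diffIdeal (k : ℕ) {x : V} (hx : x ∈ diffIdeal d θ) :
    ((d : V →ₗ[F] V) ^ k) x ∈ diffIdeal d θ := by
  induction k with
  | zero => exact hx
  | succ k ih =>
    rw [pow_succ', Module.End.mul_apply]
    exact diffIdeal_stable d θ _ ih

theorem dirac_mem_diffIdeal_left (hbr : IsPVABracket d br)
    (hD : IsInverseOp d (constraintMatrix br θ) D) {x : V} (hx : x ∈ diffIdeal d θ) (a : V)
    (n : ℤ) : (dirac d br θ D x a).coeff n ∈ diffIdeal d θ := by
  rw [dirac_skew hbr hD a x, coeff_neg, reflectHom_apply, coeff_reflect]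
  refine neg_mem (finsum_induction (· ∈ diffIdeal d θ) (zero_mem _) (fun _ _ => add_mem)
    fun k => ?_)
  exact zsmul_mem (zsmul_mem (der_pow_mem_diffIdeal k
    (dirac_mem_diffIdeal_right hbr hD hx a _)) _) _

end Dirac

/-! ### Series in three variables and the operators x + δ on them -/

section Series

variable {V : Type*} [CommRing V]

/-- The exponents of the three inverse variables. -/
def dir : Fin 3 → ℤ × ℤ × ℤ := ![(1, 0, 0), (0, 1, 0), (0, 0, 1)]

/-- The coordinates of an exponent. -/
def coord (q : ℤ × ℤ × ℤ) : Fin 3 → ℤ := ![q.1, q.2.1, q.2.2]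

theorem le_iff_coord {q q' : ℤ × ℤ × ℤ} : q ≤ q' ↔ ∀ i, coord q i ≤ coord q' i := by
  obtain ⟨l, m, n⟩ := q
  obtain ⟨l', m', n'⟩ := q'
  refine ⟨fun h i => ?_, fun h => ⟨h 0, h 1, h 2⟩⟩
  fin_cases i
  exacts [h.1, h.2.1, h.2.2]

@[simp] theorem coord_add (q q' : ℤ × ℤ × ℤ) (i : Fin 3) :
    coord (q + q') i = coord q i + coord q' i := by
  fin_cases i <;> rfl

@[simp] theorem coord_sub (q q' : ℤ × ℤ × ℤ) (i : Fin 3) :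
    coord (q - q') i = coord q i - coord q' i := by
  fin_cases i <;> rfl

@[simp] theorem coord_zero (i : Fin 3) : coord 0 i = 0 := by
  fin_cases i <;> rfl

@[simp] theorem coord_smul (t : ℤ) (q : ℤ × ℤ × ℤ) (i : Fin 3) :
    coord (t • q) i = t * coord q i := by
  fin_cases i <;> rfl

theorem coord_dir (i j : Fin 3) : coord (dir i) j = if i = j then 1 else 0 := by
  fin_cases i <;> fin_cases j <;> rfl

/-- The total degree of an exponent. -/
def totalDegree : ℤ × ℤ × ℤ →+ ℤ := AddMonoidHom.mk' (fun q => q.1 + q.2.1 + q.2.2)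
  (fun a b => by simp only [Prod.fst_add, Prod.snd_add]; ring)

theorem totalDegree_apply (q : ℤ × ℤ × ℤ) : totalDegree q = q.1 + q.2.1 + q.2.2 := rfl

@[simp] theorem totalDegree_dir (i : Fin 3) : totalDegree (dir i) = 1 := by
  fin_cases i <;> rfl

theorem totalDegree_mono {q q' : ℤ × ℤ × ℤ} (h : q ≤ q') : totalDegree q ≤ totalDegree q' := by
  have h1 := h.1
  have h2 := h.2.1
  have h3 := h.2.2
  simp only [totalDegree_apply]
  omega

theorem isPWO_of_le {s : Set (ℤ × ℤ × ℤ)} {a : ℤ × ℤ × ℤ} (h : ∀ q ∈ s, a ≤ q) : s.IsPWO := by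
  have hI : ∀ n : ℤ, (Set.Ici n).IsPWO := fun n => (bddBelow_Ici (a := n)).isWF.isPWO
  exact ((hI a.1).prod ((hI a.2.1).prod (hI a.2.2))).mono fun q hq =>
    ⟨(h q hq).1, (h q hq).2.1, (h q hq).2.2⟩

/-- The series in three variables with given coefficients, the exponents being bounded. -/
def ofBounded (f : ℤ × ℤ × ℤ → V) (hf : ∃ a, ∀ q, f q ≠ 0 → a ≤ q) : Series₃ V :=
  ⟨f, isPWO_of_le hf.choose_spec⟩

/-- The series with exponents bounded by `a`. -/
def box (V : Type*) [CommRing V] (a : ℤ × ℤ × ℤ) : AddSubgroup (Series₃ V) where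
  carrier := {P | ∀ q, P.coeff q ≠ 0 → a ≤ q}
  zero_mem' q h := absurd rfl h
  add_mem' {P Q} hP hQ q h := by
    by_cases h' : P.coeff q = 0
    · exact hQ q fun h'' => h (by rw [coeff_add, h', h'', add_zero])
    · exact hP q h'
  neg_mem' {P} hP q h := hP q fun h' => h (by rw [coeff_neg, h', neg_zero])

theorem exists_mem_box (P : Series₃ V) : ∃ a, P ∈ box V a := by
  obtain ⟨n, hn⟩ := bounded_coeff P
  exact ⟨(n, n, n), fun ⟨l, m, k⟩ h => hn l m k h⟩

/-- The filtration by the total degree. -/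
def totFilt (V : Type*) [CommRing V] (n : ℤ) : AddSubgroup (Series₃ V) where
  carrier := {P | ∀ q, P.coeff q ≠ 0 → n ≤ totalDegree q}
  zero_mem' q h := absurd rfl h
  add_mem' {P Q} hP hQ q h := by
    by_cases h' : P.coeff q = 0
    · exact hQ q fun h'' => h (by rw [coeff_add, h', h'', add_zero])
    · exact hP q h'
  neg_mem' {P} hP q h := hP q fun h' => h (by rw [coeff_neg, h', neg_zero])

theorem antitone_totFilt : Antitone (totFilt V) := fun _ _ h _ hP q hq => h.trans (hP q hq)

theorem exists_mem_totFilt (P : Series₃ V) : ∃ n, P ∈ totFilt V n := by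
  obtain ⟨a, ha⟩ := exists_mem_box P
  exact ⟨totalDegree a, fun q hq => totalDegree_mono (ha q hq)⟩

theorem monomials₃_dense (P : Series₃ V) (n : ℤ) :
    ∃ s ∈ AddSubgroup.closure {A : Series₃ V | ∃ q v, A = single q v}, P - s ∈ totFilt V n := by
  obtain ⟨a, ha⟩ := exists_mem_box P
  -- If one coordinate exceeds that of b while the other two are at least those of a, the total
  -- degree exceeds n. So a finite box contains every exponent of degree less than n.
  let b : ℤ × ℤ × ℤ := (n - a.2.1 - a.2.2, n - a.1 - a.2.2, n - a.1 - a.2.1)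
  refine ⟨∑ q ∈ Finset.Icc a b, single q (P.coeff q), sum_mem fun q _ =>
    AddSubgroup.subset_closure ⟨q, _, rfl⟩, fun q hq => ?_⟩
  rw [coeff_sub, coeff_sum] at hq
  by_cases h : q ∈ Finset.Icc a b
  · refine absurd ?_ hq
    rw [Finset.sum_eq_single q]
    · simp
    · intro r _ hr
      exact coeff_single_of_ne hr.symm
    · exact fun h' => absurd h h'
  · rw [Finset.sum_eq_zero fun r hr => coeff_single_of_ne (fun h' => h (by rw [h']; exact hr)),
      sub_zero] at hq
    have hle := ha q hq
    rw [Finset.mem_Icc, not_and] at h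
    have h' := h hle
    by_contra hlt
    have h1 := hle.1
    have h2 := hle.2.1
    have h3 := hle.2.2
    refine h' ⟨?_, ?_, ?_⟩ <;> rw [totalDegree_apply] at hlt <;> simp only [b] <;> omega

/-- The operator `x + δ` on series in three variables, where `x` is one of the variables and where
`δ` acts on the coefficients. -/
def twist₃ (i : Fin 3) (δ : AddMonoid.End V) : Series₃ V →+ Series₃ V :=
  AddMonoidHom.mk' (fun P => ofBounded (fun q => P.coeff (q + dir i) + δ (P.coeff q)) (by
    obtain ⟨a, ha⟩ := exists_mem_box P
    refine ⟨a - dir i, fun q hq => ?_⟩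
    by_cases h : P.coeff (q + dir i) = 0
    · have h' : P.coeff q ≠ 0 := fun h' => hq (by simp [h, h'])
      refine le_trans (sub_le_self _ ?_) (ha q h')
      rw [le_iff_coord]
      intro j
      rw [coord_dir, coord_zero]
      split_ifs <;> simp
    · exact sub_le_iff_le_add.2 (ha _ h)))
    (fun P Q => by
      ext q
      simp only [ofBounded, coeff_add, map_add]
      abel)

@[simp] theorem coeff_twist₃ (i : Fin 3) (δ : AddMonoid.End V) (P : Series₃ V) (q : ℤ × ℤ × ℤ) :
    (twist₃ i δ P).coeff q = P.coeff (q + dir i) + δ (P.coeff q) := rfl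

theorem twist₃_single (i : Fin 3) (δ : AddMonoid.End V) (q : ℤ × ℤ × ℤ) (v : V) :
    twist₃ i δ (single q v) = single (q - dir i) v + single q (δ v) := by
  ext r
  rw [coeff_twist₃, coeff_add]
  congr 1
  · by_cases h : r + dir i = q
    · rw [h, coeff_single_same, eq_sub_of_add_eq h, coeff_single_same]
    · rw [coeff_single_of_ne h, coeff_single_of_ne (fun h' => h (by rw [h', sub_add_cancel]))]
  · by_cases h : r = q
    · rw [h, coeff_single_same, coeff_single_same]
    · rw [coeff_single_of_ne h, coeff_single_of_ne h, map_zero]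

theorem exists_of_binPow_ne_zero {N : Type*} [AddCommGroup N] {δ : AddMonoid.End N} {n : ℤ}
    {f : ℤ → N} {j : ℤ} (h : binPow δ n f j ≠ 0) : ∃ k : ℕ, f (j + n - k) ≠ 0 := by
  by_contra! h'
  exact h (finsum_eq_zero_of_forall_eq_zero fun k => by simp [h' k])

theorem binPow_shift {N : Type*} [AddCommGroup N] (δ : AddMonoid.End N) (n : ℤ) (f : ℤ → N)
    (j : ℤ) : binPow δ n f (j + 1) = binPow δ n (fun t => f (t + 1)) j :=
  finsum_congr fun k => by rw [show j + 1 + n - k = j + n - k + 1 by ring]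

theorem exists_lower_line (P : Series₃ V) (i : Fin 3) (q : ℤ × ℤ × ℤ) :
    ∃ a : ℤ, ∀ t < a, P.coeff (q + t • dir i) = 0 := by
  obtain ⟨a, ha⟩ := exists_mem_box P
  refine ⟨coord a i - coord q i, fun t ht => ?_⟩
  by_contra h
  have := le_iff_coord.1 (ha _ h) i
  rw [coord_add, coord_smul, coord_dir, if_pos rfl] at this
  omega

theorem le_of_binPow_ne_zero {i : Fin 3} {δ : AddMonoid.End V} {n : ℤ} {P : Series₃ V}
    {a q : ℤ × ℤ × ℤ} (hP : P ∈ box V a)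
    (h : binPow δ n (fun t => P.coeff (q + t • dir i)) 0 ≠ 0) : a - n • dir i ≤ q := by
  obtain ⟨k, hk⟩ := exists_of_binPow_ne_zero h
  have := hP _ hk
  rw [le_iff_coord] at this ⊢
  intro j
  have h := this j
  simp only [coord_add, coord_sub, coord_smul, coord_dir] at h ⊢
  split_ifs at h ⊢ <;> simp at h ⊢ <;> omega

/-- The operator `(x + δ) ^ n` on series in three variables. -/
def twistPow₃ (i : Fin 3) (δ : AddMonoid.End V) (n : ℤ) : Series₃ V →+ Series₃ V :=
  AddMonoidHom.mk' (fun P => ofBounded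
    (fun q => binPow δ n (fun t => P.coeff (q + t • dir i)) 0) (by
      obtain ⟨a, ha⟩ := exists_mem_box P
      exact ⟨a - n • dir i, fun q hq => le_of_binPow_ne_zero ha hq⟩))
    (fun P Q => by
      ext q
      obtain ⟨a, ha⟩ := exists_lower_line P i q
      obtain ⟨b, hb⟩ := exists_lower_line Q i q
      exact binPow_add δ n (a := min a b) (fun t ht => ha t (by omega))
        (fun t ht => hb t (by omega)) 0)

theorem coeff_twistPow₃ (i : Fin 3) (δ : AddMonoid.End V) (n : ℤ) (P : Series₃ V)
    (q : ℤ × ℤ × ℤ) : (twistPow₃ i δ n P).coeff q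
      = binPow δ n (fun t => P.coeff (q + t • dir i)) 0 := rfl

theorem twistPow₃_mem_box (i : Fin 3) (δ : AddMonoid.End V) (n : ℤ) {P : Series₃ V}
    {a : ℤ × ℤ × ℤ} (hP : P ∈ box V a) : twistPow₃ i δ n P ∈ box V (a - n • dir i) :=
  fun _ hq => le_of_binPow_ne_zero hP hq

theorem twistPow₃_mem_totFilt (i : Fin 3) (δ : AddMonoid.End V) (n : ℤ) {P : Series₃ V}
    {a : ℤ} (hP : P ∈ totFilt V a) : twistPow₃ i δ n P ∈ totFilt V (a - n) := fun q hq => by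
  rw [coeff_twistPow₃] at hq
  obtain ⟨k, hk⟩ := exists_of_binPow_ne_zero hq
  have := hP _ hk
  rw [map_add, map_zsmul, totalDegree_dir, smul_eq_mul] at this
  omega

theorem twistPow₃_zero (i : Fin 3) (δ : AddMonoid.End V) (P : Series₃ V) :
    twistPow₃ i δ 0 P = P := by
  ext q
  rw [coeff_twistPow₃, binPow_zero, zero_smul, add_zero]

theorem twist₃_twistPow₃ (i : Fin 3) (δ : AddMonoid.End V) (n : ℤ) (P : Series₃ V) :
    twist₃ i δ (twistPow₃ i δ n P) = twistPow₃ i δ (n + 1) P := by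
  ext q
  obtain ⟨a, ha⟩ := exists_lower_line P i q
  rw [coeff_twist₃, coeff_twistPow₃, coeff_twistPow₃, coeff_twistPow₃,
    binPow_add_one δ n ha, binPow_shift]
  congr 3
  funext t
  rw [add_smul, one_smul, add_assoc, add_comm (dir i)]

theorem twist₃_twistPow₃_comm (i j : Fin 3) {δ δ' : AddMonoid.End V}
    (h : ∀ v, δ (δ' v) = δ' (δ v)) (n : ℤ) (P : Series₃ V) :
    twist₃ i δ (twistPow₃ j δ' n P) = twistPow₃ j δ' n (twist₃ i δ P) := by
  ext q
  obtain ⟨a, ha⟩ := exists_lower_line P j q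
  obtain ⟨b, hb⟩ := exists_lower_line P j (q + dir i)
  have e : δ (binPow δ' n (fun t => P.coeff (q + t • dir j)) 0)
      = binPow δ' n (fun t => δ (P.coeff (q + t • dir j))) 0 := binPow_map _ δ' δ' h n ha 0
  rw [coeff_twist₃, coeff_twistPow₃, coeff_twistPow₃, coeff_twistPow₃, e,
    ← binPow_add δ' n (a := min a b) (fun t ht => hb t (by omega))
      (fun t ht => by rw [ha t (by omega), map_zero])]
  congr 1
  funext t
  rw [coeff_twist₃, add_right_comm]

end Series

/-! ### Shifted products P(λ + δ₀, μ + δ₁, ν + δ₂) Q -/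

section Star

variable {V : Type*} [CommRing V]

/-- The operator `(λ + δ₀)^{-l} (μ + δ₁)^{-m} (ν + δ₂)^{-n}`. -/
def kernel (δ : Fin 3 → AddMonoid.End V) (q : ℤ × ℤ × ℤ) : Series₃ V →+ Series₃ V :=
  (twistPow₃ 0 (δ 0) (-q.1)).comp
    ((twistPow₃ 1 (δ 1) (-q.2.1)).comp (twistPow₃ 2 (δ 2) (-q.2.2)))

theorem kernel_apply (δ : Fin 3 → AddMonoid.End V) (q : ℤ × ℤ × ℤ) (P : Series₃ V) :
    kernel δ q P = twistPow₃ 0 (δ 0) (-q.1) (twistPow₃ 1 (δ 1) (-q.2.1)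
      (twistPow₃ 2 (δ 2) (-q.2.2) P)) := rfl

theorem kernel_zero (δ : Fin 3 → AddMonoid.End V) (P : Series₃ V) : kernel δ 0 P = P := by
  simp [kernel_apply, twistPow₃_zero]

theorem kernel_mem_box (δ : Fin 3 → AddMonoid.End V) (q : ℤ × ℤ × ℤ) {P : Series₃ V}
    {a : ℤ × ℤ × ℤ} (hP : P ∈ box V a) : kernel δ q P ∈ box V (q + a) := by
  have := twistPow₃_mem_box 0 (δ 0) (-q.1) (twistPow₃_mem_box 1 (δ 1) (-q.2.1)
    (twistPow₃_mem_box 2 (δ 2) (-q.2.2) hP))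
  rw [← kernel_apply] at this
  convert this using 2
  ext <;> simp [dir] <;> ring

theorem kernel_mem_totFilt (δ : Fin 3 → AddMonoid.End V) (q : ℤ × ℤ × ℤ) {P : Series₃ V}
    {a : ℤ} (hP : P ∈ totFilt V a) : kernel δ q P ∈ totFilt V (totalDegree q + a) := by
  have := twistPow₃_mem_totFilt 0 (δ 0) (-q.1) (twistPow₃_mem_totFilt 1 (δ 1) (-q.2.1)
    (twistPow₃_mem_totFilt 2 (δ 2) (-q.2.2) hP))
  rw [← kernel_apply] at this
  convert this using 2
  rw [totalDegree_apply]
  ring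

/-- Commutation lets a further factor reach its own power. This is the recursion that characterizes
the kernel. -/
theorem twist₃_kernel {δ : Fin 3 → AddMonoid.End V} (h : ∀ i j v, δ i (δ j v) = δ j (δ i v))
    (i : Fin 3) (q : ℤ × ℤ × ℤ) (P : Series₃ V) :
    twist₃ i (δ i) (kernel δ q P) = kernel δ (q - dir i) P := by
  simp only [kernel_apply]
  fin_cases i
  · simp [dir, twist₃_twistPow₃, neg_add_eq_sub]
  · simp [dir, twist₃_twistPow₃_comm 1 0 (h 1 0), twist₃_twistPow₃, neg_add_eq_sub]
  · simp [dir, twist₃_twistPow₃_comm 2 0 (h 2 0), twist₃_twistPow₃_comm 2 1 (h 2 1),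
      twist₃_twistPow₃, neg_add_eq_sub]

theorem kernel_dir (δ : Fin 3 → AddMonoid.End V) (i : Fin 3) (r : ℤ) (P : Series₃ V) :
    kernel δ (r • dir i) P = twistPow₃ i (δ i) (-r) P := by
  fin_cases i <;> simp [kernel_apply, dir, twistPow₃_zero]

theorem star_support (δ : Fin 3 → AddMonoid.End V) {P Q : Series₃ V} {a b : ℤ × ℤ × ℤ}
    (hP : P ∈ box V a) (hQ : Q ∈ box V b) (g : ℤ × ℤ × ℤ) :
    (Function.support fun q => P.coeff q * (kernel δ q Q).coeff g) ⊆
      (Finset.Icc a (g - b) : Finset (ℤ × ℤ × ℤ)) := by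
  intro q hq
  rw [Finset.coe_Icc, Set.mem_Icc]
  exact ⟨hP q (left_ne_zero_of_mul hq),
    le_sub_iff_add_le.2 (kernel_mem_box δ q hQ g (right_ne_zero_of_mul hq))⟩

theorem star_support_finite (δ : Fin 3 → AddMonoid.End V) (P Q : Series₃ V) (g : ℤ × ℤ × ℤ) :
    (Function.support fun q => P.coeff q * (kernel δ q Q).coeff g).Finite := by
  obtain ⟨a, ha⟩ := exists_mem_box P
  obtain ⟨b, hb⟩ := exists_mem_box Q
  exact (Finset.finite_toSet _).subset (star_support δ ha hb g)

/-- The series `P(λ + δ₀, μ + δ₁, ν + δ₂) Q(λ, μ, ν)`. -/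
def star (δ : Fin 3 → AddMonoid.End V) : Series₃ V →+ Series₃ V →+ Series₃ V :=
  AddMonoidHom.mk' (fun P => AddMonoidHom.mk' (fun Q =>
    ofBounded (fun g => ∑ᶠ q, P.coeff q * (kernel δ q Q).coeff g) (by
      obtain ⟨a, ha⟩ := exists_mem_box P
      obtain ⟨b, hb⟩ := exists_mem_box Q
      refine ⟨a + b, fun g hg => ?_⟩
      by_contra h
      refine hg ?_
      rw [finsum_eq_finsetSum_of_support_subset _ (star_support δ ha hb g),
        Finset.Icc_eq_empty (fun h' => h (le_sub_iff_add_le.1 h')), Finset.sum_empty]))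
    (fun Q Q' => by
      ext g
      simp only [ofBounded, coeff_add, map_add, mul_add]
      exact finsum_add_distrib (star_support_finite δ P Q g) (star_support_finite δ P Q' g)))
    (fun P P' => by
      ext Q g
      simp only [AddMonoidHom.mk'_apply, AddMonoidHom.add_apply, ofBounded, coeff_add, add_mul]
      exact finsum_add_distrib (star_support_finite δ P Q g) (star_support_finite δ P' Q g))

theorem coeff_star (δ : Fin 3 → AddMonoid.End V) (P Q : Series₃ V) (g : ℤ × ℤ × ℤ) :
    (star δ P Q).coeff g = ∑ᶠ q, P.coeff q * (kernel δ q Q).coeff g := rfl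

theorem star_single (δ : Fin 3 → AddMonoid.End V) (q : ℤ × ℤ × ℤ) (v : V) (Q : Series₃ V) :
    star δ (single q v) Q = v • kernel δ q Q := by
  ext g
  rw [coeff_star, finsum_eq_single _ q]
  · rw [coeff_single_same]
    rfl
  · intro r hr
    rw [coeff_single_of_ne hr, zero_mul]

theorem star_mem_totFilt (δ : Fin 3 → AddMonoid.End V) {P Q : Series₃ V} {a b : ℤ}
    (hP : P ∈ totFilt V a) (hQ : Q ∈ totFilt V b) : star δ P Q ∈ totFilt V (a + b) := by
  intro g hg
  rw [coeff_star] at hg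
  obtain ⟨q, hq⟩ : ∃ q, P.coeff q * (kernel δ q Q).coeff g ≠ 0 := by
    by_contra! h
    exact hg (finsum_eq_zero_of_forall_eq_zero h)
  have h1 := hP q (left_ne_zero_of_mul hq)
  have h2 := kernel_mem_totFilt δ q hQ g (right_ne_zero_of_mul hq)
  omega

theorem isFiltered_star (δ : Fin 3 → AddMonoid.End V) (Q : Series₃ V) :
    IsFiltered (totFilt V) (totFilt V) (fun P => star δ P Q) := by
  obtain ⟨b, hb⟩ := exists_mem_totFilt Q
  exact ⟨fun P P' => by rw [map_add, AddMonoidHom.add_apply], b, fun n P hP =>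
    star_mem_totFilt δ hP hb⟩

/-- A Laurent series as a series in one of the three variables. -/
def embed (i : Fin 3) : LaurentSeries V →+ Series₃ V :=
  AddMonoidHom.mk' (fun A => ofBounded
    (fun q => if q = coord q i • dir i then A.coeff (coord q i) else 0) (by
      obtain ⟨a, ha⟩ := exists_lower A
      refine ⟨min a 0 • dir i, fun q hq => ?_⟩
      simp only [ne_eq, ite_eq_right_iff, not_forall] at hq
      obtain ⟨h, h'⟩ := hq
      have hle : a ≤ coord q i := by
        by_contra! hlt
        exact h' (ha _ hlt)
      rw [h, le_iff_coord]
      intro j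
      simp only [coord_smul, coord_dir]
      split_ifs
      · omega
      · simp))
    (fun A B => by
      ext q
      simp only [ofBounded, coeff_add]
      split_ifs <;> simp)

theorem coeff_embed (i : Fin 3) (A : LaurentSeries V) (q : ℤ × ℤ × ℤ) :
    (embed i A).coeff q = if q = coord q i • dir i then A.coeff (coord q i) else 0 := rfl

theorem embed_single (i : Fin 3) (r : ℤ) (v : V) :
    embed i (single r v) = single (r • dir i) v := by
  ext q
  rw [coeff_embed]
  by_cases h : q = r • dir i
  · have : coord q i = r := by
      rw [h, coord_smul, coord_dir, if_pos rfl, mul_one]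
    rw [this, if_pos h, h, coeff_single_same, coeff_single_same]
  · rw [coeff_single_of_ne h]
    split_ifs with h'
    · exact coeff_single_of_ne fun h'' => h (by rw [h', h''])
    · rfl

theorem embed_mem_totFilt (i : Fin 3) {A : LaurentSeries V} {n : ℤ} (hA : A ∈ ordFilt V n) :
    embed i A ∈ totFilt V n := by
  intro q hq
  rw [coeff_embed] at hq
  simp only [ne_eq, ite_eq_right_iff, not_forall] at hq
  obtain ⟨h, h'⟩ := hq
  rw [h, map_zsmul, totalDegree_dir, smul_eq_mul, mul_one]
  by_contra! hlt
  exact h' (mem_ordFilt.1 hA _ hlt)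

theorem isFiltered_embed (i : Fin 3) :
    IsFiltered (ordFilt V) (totFilt V) (embed i) :=
  ⟨map_add _, 0, fun n A hA => by rw [add_zero]; exact embed_mem_totFilt i hA⟩

theorem isFiltered_star_embed (δ : Fin 3 → AddMonoid.End V) (i : Fin 3) (Q : Series₃ V) :
    IsFiltered (ordFilt V) (totFilt V) (fun A => star δ (embed i A) Q) :=
  (isFiltered_star δ Q).comp (isFiltered_embed i)

end Star

/-! ### Expansions as substitutions, and their effect on shifted products -/

section Expansion

variable {V : Type*} [CommRing V]

/-- The filtration of iterated Laurent series by the total degree. -/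
abbrev totFilt₂ (V : Type*) [CommRing V] : ℤ → AddSubgroup (LaurentSeries (LaurentSeries V)) :=
  laurentFilt (ordFilt V)

theorem totFilt₂_sep (X : LaurentSeries (LaurentSeries V)) (h : ∀ n, X ∈ totFilt₂ V n) : X = 0 :=
  laurentFilt_sep ordFilt_sep X h

/-- A map from series in three variables to iterated Laurent series that is a substitution of the
variables, the variable `i` being mapped to the multiplication operator `t i`. -/
structure IsExpansion (ι : Series₃ V →ₗ[V] LaurentSeries (LaurentSeries V))
    (t : Fin 3 → LaurentSeries (LaurentSeries V) →+ LaurentSeries (LaurentSeries V)) : Prop where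
  filtered : IsFiltered (totFilt V) (totFilt₂ V) ι
  map_shift : ∀ i P, ι (twist₃ i 0 P) = t i (ι P)
  map_coeff : ∀ (δ : AddMonoid.End V) (P Q : Series₃ V), (∀ q, Q.coeff q = δ (P.coeff q)) →
    ι Q = lmap (lmap δ) (ι P)
  map_one : ι 1 = 1

variable {ι : Series₃ V →ₗ[V] LaurentSeries (LaurentSeries V)}
  {t : Fin 3 → LaurentSeries (LaurentSeries V) →+ LaurentSeries (LaurentSeries V)}

theorem IsExpansion.map_twist₃ (hι : IsExpansion ι t) (i : Fin 3) (δ : AddMonoid.End V)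
    (P : Series₃ V) : ι (twist₃ i δ P) = t i (ι P) + lmap (lmap δ) (ι P) := by
  rw [← hι.map_shift, ← hι.map_coeff δ P (twist₃ i δ P - twist₃ i 0 P), ← map_add,
    add_sub_cancel]
  intro q
  simp

theorem IsExpansion.isFiltered_star (hι : IsExpansion ι t) (δ : Fin 3 → AddMonoid.End V)
    (Q : Series₃ V) : IsFiltered (totFilt V) (totFilt₂ V) (fun P => ι (star δ P Q)) :=
  hι.filtered.comp (PVA.isFiltered_star δ Q)

theorem eq_of_descending {Y : Type*} {T : Y → Y} (hT : Function.Injective T)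
    {g g' : ℤ → Y} (hg : ∀ n, T (g n) = g (n - 1)) (hg' : ∀ n, T (g' n) = g' (n - 1))
    (h : g 0 = g' 0) (n : ℤ) : g n = g' n := by
  have := eq_of_injective_recursion hT (g := fun n => g (-n)) (g' := fun n => g' (-n))
    (fun n => by rw [hg, neg_add']) (fun n => by rw [hg', neg_add']) (by simpa using h) (-n)
  simpa using this

/-- The one-variable recursion is applied to the three coordinates in turn, bringing each of them to
0. -/
theorem eq_of_descending₃ {Y : Type*} {T : Fin 3 → Y → Y} (hT : ∀ i, Function.Injective (T i))
    {g g' : ℤ × ℤ × ℤ → Y} (hg : ∀ i q, T i (g q) = g (q - dir i))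
    (hg' : ∀ i q, T i (g' q) = g' (q - dir i)) (h : g 0 = g' 0) (q : ℤ × ℤ × ℤ) :
    g q = g' q := by
  obtain ⟨l, m, n⟩ := q
  refine eq_of_descending (hT 0) (g := fun l => g (l, m, n)) (g' := fun l => g' (l, m, n))
    (fun l => by rw [hg]; simp [dir]) (fun l => by rw [hg']; simp [dir]) ?_ l
  refine eq_of_descending (hT 1) (g := fun m => g (0, m, n)) (g' := fun m => g' (0, m, n))
    (fun m => by rw [hg]; simp [dir]) (fun m => by rw [hg']; simp [dir]) ?_ m
  exact eq_of_descending (hT 2) (g := fun n => g (0, 0, n)) (g' := fun n => g' (0, 0, n))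
    (fun n => by rw [hg]; simp [dir]) (fun n => by rw [hg']; simp [dir]) h n

theorem monomial_eq_smul (q : ℤ × ℤ × ℤ) (v : V) :
    (single q v : Series₃ V) = v • (single q 1 : Series₃ V) := by
  ext r
  rw [coeff_smul]
  by_cases h : r = q
  · rw [h, coeff_single_same, coeff_single_same, smul_eq_mul, mul_one]
  · rw [coeff_single_of_ne h, coeff_single_of_ne h, smul_zero]

theorem map_star_single (ι : Series₃ V →ₗ[V] LaurentSeries (LaurentSeries V))
    (δ : Fin 3 → AddMonoid.End V) (q : ℤ × ℤ × ℤ) (v : V) (Q : Series₃ V) :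
    ι (star δ (single q v) Q) = v • ι (kernel δ q Q) := by
  rw [star_single]
  exact ι.map_smul v _

theorem map_monomial (ι : Series₃ V →ₗ[V] LaurentSeries (LaurentSeries V))
    (q : ℤ × ℤ × ℤ) (v : V) : ι (single q v) = v • ι (single q 1) := by
  rw [monomial_eq_smul]
  exact ι.map_smul v _

/-- An expansion of `P(λ + δ₀, μ + δ₁, ν + δ₂) Q` is obtained by applying to the expansion of `P`
the operator `S` that commutes with the variables and maps `1` to the expansion of `Q`. -/
theorem IsExpansion.map_star (hι : IsExpansion ι t) {δ : Fin 3 → AddMonoid.End V}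
    (hδ : ∀ i, δ i 1 = 0) (hcomm : ∀ i j v, δ i (δ j v) = δ j (δ i v))
    {T : Fin 3 → LaurentSeries (LaurentSeries V) → LaurentSeries (LaurentSeries V)}
    (hT : ∀ i X, t i X + lmap (lmap (δ i)) X = T i X) (hinj : ∀ i, Function.Injective (T i))
    {S : LaurentSeries (LaurentSeries V) → LaurentSeries (LaurentSeries V)}
    (hS : IsFiltered (totFilt₂ V) (totFilt₂ V) S) (hsmul : ∀ (v : V) X, S (v • X) = v • S X)
    (hST : ∀ i X, S (T i X) = T i (S X)) {Q : Series₃ V} (h1 : S 1 = ι Q) (P : Series₃ V) :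
    ι (star δ P Q) = S (ι P) := by
  refine IsFiltered.ext_dense (G := totFilt V) (G' := totFilt₂ V) (f := fun P => ι (star δ P Q)) (g := fun P => S (ι P))
    antitone_totFilt totFilt₂_sep monomials₃_dense
    (hι.isFiltered_star δ Q) (hS.comp hι.filtered) ?_ P
  rintro _ ⟨q, v, rfl⟩
  rw [map_star_single, map_monomial, hsmul]
  congr 1
  -- Both families lower the exponent by applying the same injective operators T i, where δ i 1 = 0
  -- serves the right-hand one; at q = 0 they reduce to ι Q and S 1.
  refine eq_of_descending₃ hinj (g := fun q => ι (kernel δ q Q))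
    (g' := fun q => S (ι (single q 1))) (fun i q => ?_) (fun i q => ?_) ?_ q
  · rw [← twist₃_kernel hcomm, hι.map_twist₃, hT]
  · rw [← hST, ← hT, ← hι.map_twist₃, twist₃_single, hδ, map_zero, add_zero]
  · simp only [kernel_zero]
    rw [← h1, ← hι.map_one]
    rfl

/-- The counterpart of `IsExpansion.map_star` for a left factor in a single variable. Now the right
factor is fixed, and W supplies the integral powers of T. -/
theorem IsExpansion.map_star_embed (hι : IsExpansion ι t) {δ : Fin 3 → AddMonoid.End V}
    (i : Fin 3) {T : LaurentSeries (LaurentSeries V) → LaurentSeries (LaurentSeries V)}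
    (hT : ∀ X, t i X + lmap (lmap (δ i)) X = T X) (hinj : Function.Injective T)
    (W : ℤ → LaurentSeries (LaurentSeries V) → LaurentSeries (LaurentSeries V))
    (hW0 : ∀ X, W 0 X = X) (hW : ∀ n X, T (W n X) = W (n + 1) X) (P : Series₃ V)
    {L : LaurentSeries V → LaurentSeries (LaurentSeries V)}
    (hL : IsFiltered (ordFilt V) (totFilt₂ V) L)
    (hLs : ∀ r v, L (single r v) = v • W (-r) (ι P)) (A : LaurentSeries V) :
    ι (star δ (embed i A) P) = L A := by
  refine IsFiltered.ext_single (G' := totFilt₂ V) totFilt₂_sep (f := fun A => ι (star δ (embed i A) P)) (g := L)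
    (hι.filtered.comp (isFiltered_star_embed δ i P)) hL (fun r v => ?_) A
  rw [embed_single, map_star_single, hLs, kernel_dir]
  congr 1
  refine eq_of_injective_recursion hinj (g := fun n => ι (twistPow₃ i (δ i) n P))
    (g' := fun n => W n (ι P)) (fun n => ?_) (fun n => hW n _) ?_ (-r)
  · rw [← twist₃_twistPow₃, hι.map_twist₃, hT]
  · simp only [twistPow₃_zero, hW0]

end Expansion

/-! ### The three embeddings as expansions -/

section Iota

variable {V : Type*} [CommRing V]

/-- Multiplication by e becomes multiplication by u + s w, because the expansion kills the multiples
of e − u − s w. -/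
theorem expandCoeff_third (s : ℤˣ) {p : ℤ → ℤ → ℤ → V} (hp : Bounded p) (i j : ℤ) :
    expandCoeff s (fun i j r => p i j (r + 1)) i j
      = expandCoeff s p (i + 1) j + (s : ℤ) • expandCoeff s p i (j + 1) := by
  have h1 : expandCoeff s p (i + 1) j = expandCoeff s (fun i j r => p (i + 1) j r) i j :=
    finsum_congr fun q => by rw [add_right_comm]
  have h2 : (s : ℤ) • expandCoeff s p i (j + 1)
      = expandCoeff s (fun i j r => ((s : ℤ) : V) * p i (j + 1) r) i j := by
    rw [expandCoeff_smul s (p := fun i j r => p i (j + 1) r), zsmul_eq_mul]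
    · congr 1
      exact finsum_congr fun q => by rw [show j + 1 - q.2 - q.1 = j - q.2 - q.1 + 1 by ring]
    · obtain ⟨n, hn⟩ := hp
      exact ⟨n - 1, fun i j r h => by have := hn _ _ _ h; omega⟩
  have hb1 : Bounded fun i j r => p (i + 1) j r := by
    obtain ⟨n, hn⟩ := hp
    exact ⟨n - 1, fun i j r h => by have := hn _ _ _ h; omega⟩
  have hb2 : Bounded fun i j r => ((s : ℤ) : V) * p i (j + 1) r := by
    obtain ⟨n, hn⟩ := hp
    exact ⟨n - 1, fun i j r h => by have := hn _ _ _ (right_ne_zero_of_mul h); omega⟩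
  have hb3 : Bounded fun i j r => p i j (r + 1) - p (i + 1) j r - (s : ℤ) • p i (j + 1) r := by
    obtain ⟨n, hn⟩ := hp
    refine ⟨n - 1, fun i j r h => ?_⟩
    by_cases h1 : p i j (r + 1) = 0
    · by_cases h2 : p (i + 1) j r = 0
      · have h3 : p i (j + 1) r ≠ 0 := fun h3 => h (by simp [h1, h2, h3])
        have := hn _ _ _ h3
        omega
      · have := hn _ _ _ h2
        omega
    · have := hn _ _ _ h1
      omega
  have hb4 : Bounded fun i j r => p (i + 1) j r + ((s : ℤ) : V) * p i (j + 1) r := by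
    obtain ⟨n, hn⟩ := hp
    refine ⟨n - 1, fun i j r h => ?_⟩
    by_cases h1 : p (i + 1) j r = 0
    · have h2 : p i (j + 1) r ≠ 0 := fun h2 => h (by simp [h1, h2])
      have := hn _ _ _ h2
      omega
    · have := hn _ _ _ h1
      omega
  have e := expandCoeff_add s hb3 hb4 i j
  rw [expandCoeff_rel s hp, zero_add, expandCoeff_add s hb1 hb2, ← h1, ← h2] at e
  rw [← e]
  congr 1
  funext i j r
  rw [zsmul_eq_mul]
  ring

theorem expandCoeff_first (s : ℤˣ) (p : ℤ → ℤ → ℤ → V) (i j : ℤ) :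
    expandCoeff s (fun i j r => p (i + 1) j r) i j = expandCoeff s p (i + 1) j :=
  finsum_congr fun q => by rw [add_right_comm]

theorem expandCoeff_second (s : ℤˣ) (p : ℤ → ℤ → ℤ → V) (i j : ℤ) :
    expandCoeff s (fun i j r => p i (j + 1) r) i j = expandCoeff s p i (j + 1) :=
  finsum_congr fun q => by rw [show j + 1 - q.2 - q.1 = j - q.2 - q.1 + 1 by ring]

theorem expandCoeff_map {W : Type*} [CommRing W] (s : ℤˣ) (δ : V →+ W) {p : ℤ → ℤ → ℤ → V}
    (hp : Bounded p) (i j : ℤ) :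
    expandCoeff s (fun i j r => δ (p i j r)) i j = δ (expandCoeff s p i j) := by
  unfold expandCoeff
  rw [δ.map_finsum (finite_aux hp _ i j)]
  exact finsum_congr fun q => (map_zsmul δ _ _).symm

theorem expandCoeff_of_third (s : ℤˣ) {p : ℤ → ℤ → ℤ → V} (hp : ∀ i j r, r ≠ 0 → p i j r = 0)
    (i j : ℤ) : expandCoeff s p i j = p i j 0 := by
  unfold expandCoeff
  rw [finsum_eq_single _ (0, 0)]
  · simp
  · rintro ⟨k, r⟩ h
    by_cases hr : r = 0
    · have hk : 0 < k := Nat.pos_of_ne_zero fun hk => h (by rw [hk, hr])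
      simp [hr, Ring.choose_zero_pos _ hk]
    · rw [hp _ _ _ hr, smul_zero]

theorem expandCoeff_eq_zero (s : ℤˣ) {p : ℤ → ℤ → ℤ → V} {n : ℤ}
    (hp : ∀ i j r, p i j r ≠ 0 → n ≤ i + j + r) {i j : ℤ} (h : i + j < n) :
    expandCoeff s p i j = 0 := by
  refine finsum_eq_zero_of_forall_eq_zero fun q => ?_
  by_cases h' : p (i + q.1) (j - q.2 - q.1) q.2 = 0
  · rw [h', smul_zero]
  · have := hp _ _ _ h'
    omega

theorem mem_totFilt₂ {n : ℤ} {X : LaurentSeries (LaurentSeries V)} :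
    X ∈ totFilt₂ V n ↔ ∀ i j, i + j < n → (X.coeff j).coeff i = 0 := by
  simp only [mem_laurentFilt, mem_trivFilt, sub_pos]
  exact ⟨fun h i j hij => h j i (by omega), fun h j i hij => h i j (by omega)⟩

/-- The first embedding on series in three variables. -/
def iota₁ (V : Type*) [CommRing V] : Series₃ V →ₗ[V] LaurentSeries (LaurentSeries V) :=
  (iotaMuLam V).comp (relSubmodule V).mkQ

/-- The second embedding on series in three variables. -/
def iota₂ (V : Type*) [CommRing V] : Series₃ V →ₗ[V] LaurentSeries (LaurentSeries V) :=
  (iotaLamMu V).comp (relSubmodule V).mkQ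

/-- The third embedding on series in three variables. -/
def iota₃ (V : Type*) [CommRing V] : Series₃ V →ₗ[V] LaurentSeries (LaurentSeries V) :=
  (iotaLamNu V).comp (relSubmodule V).mkQ

theorem coeff_iota₁ (P : Series₃ V) (i j : ℤ) : ((iota₁ V P).coeff j).coeff i
    = expandCoeff 1 (fun i j r => P.coeff (i, j, r)) i j := rfl

theorem coeff_iota₂ (P : Series₃ V) (i j : ℤ) : ((iota₂ V P).coeff j).coeff i
    = expandCoeff 1 (fun i j r => P.coeff (j, i, r)) i j := rfl

theorem coeff_iota₃ (P : Series₃ V) (i j : ℤ) : ((iota₃ V P).coeff j).coeff i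
    = expandCoeff (-1) (fun i j r => P.coeff (j, r, i)) i j := rfl

theorem bounded₁ (P : Series₃ V) : Bounded fun i j r => P.coeff (i, j, r) :=
  bounded_coeff P

theorem bounded₂ (P : Series₃ V) : Bounded fun i j r => P.coeff (j, i, r) :=
  (bounded_coeff P).imp fun _ h i j r h0 => by have := h j i r h0; omega

theorem bounded₃ (P : Series₃ V) : Bounded fun i j r => P.coeff (j, r, i) :=
  (bounded_coeff P).imp fun _ h i j r h0 => by have := h j r i h0; omega

/-- Multiplication by the inner variable. -/
abbrev innerVar (V : Type*) [CommRing V] :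
    LaurentSeries (LaurentSeries V) →+ LaurentSeries (LaurentSeries V) := lmap (twist 0)

/-- Multiplication by the outer variable. -/
abbrev outerVar (V : Type*) [CommRing V] :
    LaurentSeries (LaurentSeries V) →+ LaurentSeries (LaurentSeries V) := twist 0

theorem one_coeff_coeff (i j : ℤ) : ((1 : LaurentSeries (LaurentSeries V)).coeff j).coeff i
    = if i = 0 ∧ j = 0 then 1 else 0 := by
  rw [coeff_one]
  by_cases hj : j = 0
  · simp [hj, coeff_one]
  · simp [hj]

theorem one_coeff₃ (i j r : ℤ) : (1 : Series₃ V).coeff (i, j, r)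
    = if i = 0 ∧ j = 0 ∧ r = 0 then 1 else 0 := by
  rw [coeff_one]
  simp only [Prod.mk_eq_zero]

theorem isExpansion_iota₁ :
    IsExpansion (iota₁ V) ![innerVar V, outerVar V, innerVar V + outerVar V] where
  filtered := ⟨map_add _, 0, fun n P hP => by
    rw [mem_totFilt₂]
    intro i j hij
    refine expandCoeff_eq_zero 1 (p := fun i j r => P.coeff (i, j, r)) (n := n)
      (fun i j r h => ?_) (by omega)
    have := hP (i, j, r) h
    rw [totalDegree_apply] at this
    dsimp only at this
    omega⟩
  map_shift i P := by
    ext b a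
    fin_cases i
    · simpa [coeff_iota₁, dir] using expandCoeff_first 1 (fun i j r => P.coeff (i, j, r)) a b
    · simpa [coeff_iota₁, dir] using expandCoeff_second 1 (fun i j r => P.coeff (i, j, r)) a b
    · simpa [coeff_iota₁, dir] using expandCoeff_third 1 (bounded₁ P) a b
  map_coeff δ P Q h := by
    ext b a
    simp only [coeff_iota₁, coeff_lmap, h]
    exact expandCoeff_map 1 δ (bounded₁ P) a b
  map_one := by
    ext b a
    rw [coeff_iota₁, expandCoeff_of_third, one_coeff_coeff, one_coeff₃]
    · simp
    · intro i j r hr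
      rw [one_coeff₃, if_neg (by tauto)]

theorem isExpansion_iota₂ :
    IsExpansion (iota₂ V) ![outerVar V, innerVar V, innerVar V + outerVar V] where
  filtered := ⟨map_add _, 0, fun n P hP => by
    rw [mem_totFilt₂]
    intro i j hij
    refine expandCoeff_eq_zero 1 (p := fun i j r => P.coeff (j, i, r)) (n := n)
      (fun i j r h => ?_) (by omega)
    have := hP (j, i, r) h
    rw [totalDegree_apply] at this
    dsimp only at this
    omega⟩
  map_shift i P := by
    ext b a
    fin_cases i
    · simpa [coeff_iota₂, dir] using expandCoeff_second 1 (fun i j r => P.coeff (j, i, r)) a b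
    · simpa [coeff_iota₂, dir] using expandCoeff_first 1 (fun i j r => P.coeff (j, i, r)) a b
    · simpa [coeff_iota₂, dir] using expandCoeff_third 1 (bounded₂ P) a b
  map_coeff δ P Q h := by
    ext b a
    simp only [coeff_iota₂, coeff_lmap, h]
    exact expandCoeff_map 1 δ (bounded₂ P) a b
  map_one := by
    ext b a
    rw [coeff_iota₂, expandCoeff_of_third, one_coeff_coeff, one_coeff₃]
    · simp [and_comm]
    · intro i j r hr
      rw [one_coeff₃, if_neg (by tauto)]

theorem isExpansion_iota₃ :
    IsExpansion (iota₃ V) ![outerVar V, innerVar V - outerVar V, innerVar V] where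
  filtered := ⟨map_add _, 0, fun n P hP => by
    rw [mem_totFilt₂]
    intro i j hij
    refine expandCoeff_eq_zero (-1) (p := fun i j r => P.coeff (j, r, i)) (n := n)
      (fun i j r h => ?_) (by omega)
    have := hP (j, r, i) h
    rw [totalDegree_apply] at this
    dsimp only at this
    omega⟩
  map_shift i P := by
    ext b a
    fin_cases i
    · simpa [coeff_iota₃, dir] using expandCoeff_second (-1) (fun i j r => P.coeff (j, r, i)) a b
    · simpa [coeff_iota₃, dir, sub_eq_add_neg] using expandCoeff_third (-1) (bounded₃ P) a b
    · simpa [coeff_iota₃, dir] using expandCoeff_first (-1) (fun i j r => P.coeff (j, r, i)) a b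
  map_coeff δ P Q h := by
    ext b a
    simp only [coeff_iota₃, coeff_lmap, h]
    exact expandCoeff_map (-1) δ (bounded₃ P) a b
  map_one := by
    ext b a
    rw [coeff_iota₃, expandCoeff_of_third, one_coeff_coeff, one_coeff₃]
    · simp [and_comm]
    · intro i j r hr
      rw [one_coeff₃, if_neg (by tauto)]

theorem iota₁_embed_zero (A : LaurentSeries V) : iota₁ V (embed 0 A) = C A := by
  ext b a
  rw [coeff_iota₁, expandCoeff_of_third, C_apply, coeff_embed]
  · by_cases hb : b = 0
    · simp [hb, coord, dir]
    · simp [hb, coord, dir, coeff_single_of_ne hb]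
  · intro i j r hr
    rw [coeff_embed, if_neg (by simp [coord, dir, hr])]

theorem iota₁_embed_one (A : LaurentSeries V) :
    iota₁ V (embed 1 A) = lmap (C : V →+* LaurentSeries V).toAddMonoidHom A := by
  ext b a
  rw [coeff_iota₁, expandCoeff_of_third, coeff_embed]
  · by_cases ha : a = 0
    · simp [ha, coord, dir]
    · simp [ha, coord, dir, coeff_single_of_ne ha]
  · intro i j r hr
    rw [coeff_embed, if_neg (by simp [coord, dir, hr])]

theorem iota₂_embed_one (A : LaurentSeries V) : iota₂ V (embed 1 A) = C A := by
  ext b a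
  rw [coeff_iota₂, expandCoeff_of_third, C_apply, coeff_embed]
  · by_cases hb : b = 0
    · simp [hb, coord, dir]
    · simp [hb, coord, dir, coeff_single_of_ne hb]
  · intro i j r hr
    rw [coeff_embed, if_neg (by simp [coord, dir, hr])]

theorem iota₂_embed_zero (A : LaurentSeries V) :
    iota₂ V (embed 0 A) = lmap (C : V →+* LaurentSeries V).toAddMonoidHom A := by
  ext b a
  rw [coeff_iota₂, expandCoeff_of_third, coeff_embed]
  · by_cases ha : a = 0
    · simp [ha, coord, dir]
    · simp [ha, coord, dir, coeff_single_of_ne ha]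
  · intro i j r hr
    rw [coeff_embed, if_neg (by simp [coord, dir, hr])]

theorem iota₃_embed_zero (A : LaurentSeries V) :
    iota₃ V (embed 0 A) = lmap (C : V →+* LaurentSeries V).toAddMonoidHom A := by
  ext b a
  rw [coeff_iota₃, expandCoeff_of_third, coeff_embed]
  · by_cases ha : a = 0
    · simp [ha, coord, dir]
    · simp [ha, coord, dir, coeff_single_of_ne ha]
  · intro i j r hr
    rw [coeff_embed, if_neg (by simp [coord, dir, hr])]

/-- The series `A(ν - λ)`, expanded in the domain `|λ| > |ν|`. -/
def difference : LaurentSeries V →+ LaurentSeries (LaurentSeries V) :=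
  (iota₃ V).toAddMonoidHom.comp (embed 1)

theorem difference_apply (A : LaurentSeries V) : difference A = iota₃ V (embed 1 A) := rfl

theorem isFiltered_difference : IsFiltered (ordFilt V) (totFilt₂ V) difference :=
  isExpansion_iota₃.filtered.comp (isFiltered_embed 1)

/-- For |λ| > |ν| the powers of ν − λ are expanded in non-negative powers of ν, so the exponent of λ
never exceeds that of ν − λ. This makes the map continuous also for the order in the outer variable,
the filtration for which products are continuous without further assumption. -/
theorem isFiltered_difference_outer :
    IsFiltered (ordFilt V) (ordFilt (LaurentSeries V)) difference := by
  refine ⟨map_add _, 0, fun n A hA => ?_⟩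
  rw [mem_ordFilt] at hA ⊢
  intro b hb
  ext a
  rw [difference_apply, coeff_iota₃]
  refine finsum_eq_zero_of_forall_eq_zero fun q => ?_
  dsimp only
  rw [coeff_embed]
  split_ifs with h
  -- The exponent lies on the axis of μ, so q.2 = b − q.1 ≤ b, which is below the order of A.
  · have h0 : b - q.2 - q.1 = 0 := by simpa [coord, dir] using congrArg (fun q => q.1) h
    have : A.coeff q.2 = 0 := hA _ (by omega)
    simp only [coord, Matrix.cons_val_one, Matrix.cons_val_zero, this, smul_zero]
  · rw [smul_zero]

theorem difference_one : difference (1 : LaurentSeries V) = 1 := by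
  rw [difference_apply, ← isExpansion_iota₃.map_one]
  congr 1
  exact (embed_single 1 0 1).trans (by rw [zero_smul]; rfl)

end Iota

/-! ### Coefficient formulas for both forms of additive endomorphisms -/

section Coefficients

variable {N : Type*} [AddCommGroup N]

@[simp] theorem coeff_lmap_end (α : AddMonoid.End N) (A : LaurentSeries N) (j : ℤ) :
    (lmap α A).coeff j = α (A.coeff j) := rfl

@[simp] theorem coeff_twist_hom (δ : N →+ N) (A : LaurentSeries N) (j : ℤ) :
    (twist δ A).coeff j = A.coeff (j + 1) + δ (A.coeff j) := rfl

end Coefficients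

/-! ### Products on iterated Laurent series -/

section Operations

variable {F V : Type*} [CommRing F] [CommRing V] [Algebra F V] (d : Derivation F V V)

/-- The inclusion of the coefficients in the Laurent series. -/
abbrev constHom (V : Type*) [CommRing V] : V →+ LaurentSeries V :=
  (C : V →+* LaurentSeries V).toAddMonoidHom

/-- The series `X(x + ∂, y) A(x)`, where `x` is the inner variable. -/
def innerMul (A : LaurentSeries V) :
    LaurentSeries (LaurentSeries V) →+ LaurentSeries (LaurentSeries V) :=
  lmap ((opMul d).flip A)

/-- The series `X(x, y + ∂) A(y)`, where `y` is the outer variable. -/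
def outerMul : LaurentSeries (LaurentSeries V) →+ LaurentSeries V →+
    LaurentSeries (LaurentSeries V) :=
  gop (AddMonoidHom.smul (R := V) (M := LaurentSeries V)).flip (derEnd d)

/-- The series `A(x + y + ∂) X(x, y)`, where `y` is the outer variable. -/
def leftMul : LaurentSeries V →+ LaurentSeries (LaurentSeries V) →+
    LaurentSeries (LaurentSeries V) :=
  gop (AddMonoidHom.smul (R := V) (M := LaurentSeries V)) (twist (derEnd d))

/-- The series `X(x + ∂, y + ∂) A(y)`, where `y` is the outer variable. -/
def bothMul : LaurentSeries (LaurentSeries V) →+ LaurentSeries V →+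
    LaurentSeries (LaurentSeries V) :=
  gop ((opMul d).compl₂ (constHom V)) (derEnd d)

/-- The series `X(x + ∂, y) Y(x, y)`. -/
def iterMul : LaurentSeries (LaurentSeries V) →+ LaurentSeries (LaurentSeries V) →+
    LaurentSeries (LaurentSeries V) :=
  gop (opMul d) 0

theorem smul_mem_ordFilt {k l : ℤ} {v : V} {A : LaurentSeries V} (hv : v ∈ trivFilt V k)
    (hA : A ∈ ordFilt V l) : v • A ∈ ordFilt V (k + l) := fun j => by
  rw [add_sub_assoc]
  exact trivFilt_mul AddMonoidHom.mul k (l - j) v (A.coeff j) hv (hA j)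

theorem const_mem_ordFilt {k : ℤ} {v : V} (hv : v ∈ trivFilt V k) :
    constHom V v ∈ ordFilt V k := by
  rw [mem_ordFilt]
  intro j hj
  by_cases h : j = 0
  · have : v = 0 := mem_trivFilt.1 hv (by omega)
    simp [this]
  · exact coeff_single_of_ne h

theorem twist_mem_ordFilt {N : Type*} [AddCommGroup N] (δ : AddMonoid.End N) (k : ℤ)
    (A : LaurentSeries N) (h : A ∈ ordFilt N k) : twist δ A ∈ ordFilt N (k - 1) := by
  rw [mem_ordFilt] at h ⊢
  intro j hj
  rw [coeff_twist, h _ (by omega), h _ (by omega), map_zero, add_zero]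

theorem isFiltered_innerMul (A : LaurentSeries V) :
    IsFiltered (totFilt₂ V) (totFilt₂ V) (innerMul d A) := by
  obtain ⟨a, ha⟩ := exists_mem_ordFilt A
  exact isFiltered_lmap _ a fun k x hx => gop_mem_ord _ _ hx ha

theorem isFiltered_outerMul (A : LaurentSeries V) :
    IsFiltered (totFilt₂ V) (totFilt₂ V) (fun X => outerMul d X A) := by
  obtain ⟨a, ha⟩ := exists_mem_ordFilt A
  refine ⟨fun X Y => by rw [map_add, AddMonoidHom.add_apply], a, fun n X hX =>
    gop_mem _ _ (map_trivFilt_pred _) (fun k l x v hx hv => ?_) hX ha⟩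
  rw [add_comm]
  exact smul_mem_ordFilt hv hx

/-- The bound on X is a genuine condition: an iterated Laurent series need not have bounded total
degree. Images of series in three variables do. -/
theorem isFiltered_leftMul {X : LaurentSeries (LaurentSeries V)} {n : ℤ}
    (hX : X ∈ totFilt₂ V n) :
    IsFiltered (ordFilt V) (totFilt₂ V) (fun A => leftMul d A X) :=
  ⟨fun A B => by rw [map_add, AddMonoidHom.add_apply], n, fun _ _ hA =>
    gop_mem (H := trivFilt V) (H' := ordFilt V) (H'' := ordFilt V)
      (AddMonoidHom.smul (R := V) (M := LaurentSeries V)) (twist (derEnd d))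
      (twist_mem_ordFilt _) (fun _ _ _ _ hv hx => smul_mem_ordFilt hv hx) hA hX⟩

theorem isFiltered_bothMul (A : LaurentSeries V) :
    IsFiltered (totFilt₂ V) (totFilt₂ V) (fun X => bothMul d X A) := by
  obtain ⟨a, ha⟩ := exists_mem_ordFilt A
  exact ⟨fun X Y => by rw [map_add, AddMonoidHom.add_apply], a, fun n X hX =>
    gop_mem (H := ordFilt V) (H' := trivFilt V) (H'' := ordFilt V)
      ((opMul d).compl₂ (constHom V)) (derEnd d) (map_trivFilt_pred _)
      (fun k l x v hx hv => gop_mem_ord _ _ hx (const_mem_ordFilt hv)) hX ha⟩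

theorem isFiltered_iterMul {Y : LaurentSeries (LaurentSeries V)} {n : ℤ}
    (hY : Y ∈ totFilt₂ V n) :
    IsFiltered (totFilt₂ V) (totFilt₂ V) (fun X => iterMul d X Y) :=
  ⟨fun A B => by rw [map_add, AddMonoidHom.add_apply], n, fun _ _ hX =>
    gop_mem (H := ordFilt V) (H' := ordFilt V) (H'' := ordFilt V) (opMul d) 0
      (fun _ _ _ => zero_mem _) (fun _ _ _ _ hx hy => gop_mem_ord _ _ hx hy) hX hY⟩

theorem lmap_injective {M N : Type*} [AddCommGroup M] [AddCommGroup N] {α : M →+ N}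
    (h : Function.Injective α) : Function.Injective (lmap α) := by
  intro A B hAB
  ext j
  exact h (congrArg (fun X => X.coeff j) hAB)

/-- Up to sign, α − y is the operator y + δ with δ = −α. It serves for μ = ν − λ in the third
expansion. -/
theorem lmap_sub_twist_injective {N : Type*} [AddCommGroup N] (α : AddMonoid.End N) :
    Function.Injective (fun A : LaurentSeries N => lmap α A - twist 0 A) := by
  have : (fun A : LaurentSeries N => lmap α A - twist 0 A) = fun A => -twist (-α) A := by
    funext A
    ext j
    change α (A.coeff j) - (A.coeff (j + 1) + 0) = -(A.coeff (j + 1) + -α (A.coeff j))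
    abel
  rw [this]
  exact neg_injective.comp (twist_injective _)

/-- The derivations in `P(λ + ∂, μ, ν + ∂)`. -/
def derLam : Fin 3 → AddMonoid.End V := ![derEnd d, 0, derEnd d]

/-- The derivations in `P(λ, μ + ∂, ν + ∂)`. -/
def derMu : Fin 3 → AddMonoid.End V := ![0, derEnd d, derEnd d]

theorem derLam_one (i : Fin 3) : derLam d i 1 = 0 := by
  fin_cases i <;> simp [derLam]

theorem derMu_one (i : Fin 3) : derMu d i 1 = 0 := by
  fin_cases i <;> simp [derMu]

theorem derLam_comm (i j : Fin 3) (v : V) :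
    derLam d i (derLam d j v) = derLam d j (derLam d i v) := by
  fin_cases i <;> fin_cases j <;> simp [derLam]

theorem derMu_comm (i j : Fin 3) (v : V) :
    derMu d i (derMu d j v) = derMu d j (derMu d i v) := by
  fin_cases i <;> fin_cases j <;> simp [derMu]

/-- The series `P(λ + ∂, μ, ν + ∂) A(λ)`. -/
def starLam (A : LaurentSeries V) : Series₃ V →+ Series₃ V :=
  (star (derLam d)).flip (embed 0 A)

/-- The series `P(λ, μ + ∂, ν + ∂) A(μ)`. -/
def starMu (A : LaurentSeries V) : Series₃ V →+ Series₃ V :=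
  (star (derMu d)).flip (embed 1 A)

/-- The series `A(ν + ∂) P(λ, μ, ν)`. -/
def starNu (A : LaurentSeries V) : Series₃ V →+ Series₃ V :=
  star (derLam d) (embed 2 A)

/-! ### The operators commute with the variables -/

theorem innerMul_smul (A : LaurentSeries V) (v : V) (X : LaurentSeries (LaurentSeries V)) :
    innerMul d A (v • X) = v • innerMul d A X := by
  ext1
  funext j
  exact opMul_smul_left d v _ A

theorem innerMul_lmap_twist (A : LaurentSeries V) (X : LaurentSeries (LaurentSeries V)) :
    innerMul d A (lmap (twist (derEnd d)) X) = lmap (twist (derEnd d)) (innerMul d A X) := by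
  ext1
  funext j
  exact (twist_opMul d _ A).symm

theorem innerMul_twist (A : LaurentSeries V) (X : LaurentSeries (LaurentSeries V)) :
    innerMul d A (twist 0 X) = twist 0 (innerMul d A X) :=
  twist_lmap _ (δ' := 0) (fun x => by simp) X

theorem innerMul_twist_twist (A : LaurentSeries V) (X : LaurentSeries (LaurentSeries V)) :
    innerMul d A (twist (twist (derEnd d)) X) = twist (twist (derEnd d)) (innerMul d A X) :=
  twist_lmap _ (δ' := twist (derEnd d)) (fun x => (twist_opMul d x A).symm) X

theorem innerMul_one (A : LaurentSeries V) : innerMul d A 1 = C A := by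
  have : innerMul d A (single 0 1) = single 0 (opMul d 1 A) := lmap_single _ _ _
  rwa [opMul_one_left] at this

theorem outerMul_smul (A : LaurentSeries V) (v : V) (X : LaurentSeries (LaurentSeries V)) :
    outerMul d (v • X) A = v • outerMul d X A :=
  (lmap_gop (δ := derEnd d) (δ' := derEnd d)
    (AddMonoidHom.smul (R := V) (M := LaurentSeries V)).flip
    (AddMonoidHom.smul (R := V) (M := LaurentSeries V)).flip
    (AddMonoidHom.smul (M := LaurentSeries V) v)
    (AddMonoidHom.id V) (AddMonoidHom.smul (M := LaurentSeries V) v) (fun _ => rfl)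
    (fun x w => smul_comm v w x) X A).symm

theorem outerMul_lmap_twist (A : LaurentSeries V) (X : LaurentSeries (LaurentSeries V)) :
    outerMul d (lmap (twist 0) X) A = lmap (twist 0) (outerMul d X A) :=
  (lmap_gop (δ := derEnd d) (δ' := derEnd d) _ _ (twist 0)
    (AddMonoidHom.id V) (twist 0) (fun _ => rfl) (fun x _ => by ext j; simp) X A).symm

theorem outerMul_twist (A : LaurentSeries V) (X : LaurentSeries (LaurentSeries V)) :
    outerMul d (twist (lmap (derEnd d)) X) A = twist (lmap (derEnd d)) (outerMul d X A) :=
  (twist_gop _ (fun x w => by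
    ext j
    change d (w * x.coeff j) = w * d (x.coeff j) + d w * x.coeff j
    rw [Derivation.leibniz, smul_eq_mul, smul_eq_mul, mul_comm (x.coeff j)]) X A).symm

theorem outerMul_twist_twist (A : LaurentSeries V) (X : LaurentSeries (LaurentSeries V)) :
    outerMul d (twist (twist (derEnd d)) X) A = twist (twist (derEnd d)) (outerMul d X A) :=
  (twist_gop _ (fun x w => by
    ext j
    change w * x.coeff (j + 1) + d (w * x.coeff j)
      = w * (x.coeff (j + 1) + d (x.coeff j)) + d w * x.coeff j
    rw [Derivation.leibniz, smul_eq_mul, smul_eq_mul]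
    ring) X A).symm

theorem outerMul_one (A : LaurentSeries V) : outerMul d 1 A = lmap (constHom V) A := by
  refine (gop_single _ _ 0 _ A).trans ?_
  rw [neg_zero, twistPow_zero]
  ext j i
  simp [coeff_one, coeff_single]

theorem bothMul_smul (A : LaurentSeries V) (v : V) (X : LaurentSeries (LaurentSeries V)) :
    bothMul d (v • X) A = v • bothMul d X A :=
  (lmap_gop (δ := derEnd d) (δ' := derEnd d) ((opMul d).compl₂ (constHom V))
    ((opMul d).compl₂ (constHom V)) (AddMonoidHom.smul (M := LaurentSeries V) v)
    (AddMonoidHom.id V) (AddMonoidHom.smul (M := LaurentSeries V) v) (fun _ => rfl)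
    (fun x _ => (opMul_smul_left d v x _).symm) X A).symm

theorem bothMul_lmap_twist (A : LaurentSeries V) (X : LaurentSeries (LaurentSeries V)) :
    bothMul d (lmap (twist (derEnd d)) X) A = lmap (twist (derEnd d)) (bothMul d X A) :=
  (lmap_gop (δ := derEnd d) (δ' := derEnd d) _ _ (twist (derEnd d))
    (AddMonoidHom.id V) (twist (derEnd d)) (fun _ => rfl)
    (fun x _ => twist_opMul d x _) X A).symm

/-- On symbols, ∂ acting on the coefficients is the commutator with ∂, the difference of λ + ∂ and
λ; hence it is a derivation of the product. -/
theorem lmap_der_opMul (A B : LaurentSeries V) : lmap (derEnd d) (opMul d A B)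
    = opMul d (lmap (derEnd d) A) B + opMul d A (lmap (derEnd d) B) := by
  have e : ∀ A : LaurentSeries V, lmap (derEnd d) A = twist (derEnd d) A - twist 0 A := by
    intro A
    ext j
    simp
  rw [e, e, e, twist_opMul, map_sub, map_sub, AddMonoidHom.sub_apply, opMul_twist_zero,
    opMul_twist]
  abel

theorem bothMul_twist (A : LaurentSeries V) (X : LaurentSeries (LaurentSeries V)) :
    bothMul d (twist (lmap (derEnd d)) X) A = twist (lmap (derEnd d)) (bothMul d X A) :=
  (twist_gop _ (fun x w => by
    refine (lmap_der_opMul d x (constHom V w)).trans (congrArg _ ?_)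
    exact congrArg (opMul d x) (lmap_single (derEnd d) 0 w)) X A).symm

theorem bothMul_one (A : LaurentSeries V) : bothMul d 1 A = lmap (constHom V) A := by
  refine (gop_single _ _ 0 _ A).trans ?_
  rw [neg_zero, twistPow_zero]
  ext1
  funext j
  exact opMul_one_left d _

theorem iterMul_smul (Y : LaurentSeries (LaurentSeries V)) (v : V)
    (X : LaurentSeries (LaurentSeries V)) :
    iterMul d (v • X) Y = v • iterMul d X Y :=
  (lmap_gop (δ := 0) (δ' := 0) (opMul d) (opMul d) (AddMonoidHom.smul (M := LaurentSeries V) v)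
    (AddMonoidHom.id _) (AddMonoidHom.smul (M := LaurentSeries V) v) (fun _ => rfl)
    (fun x _ => (opMul_smul_left d v x _).symm) X Y).symm

theorem iterMul_lmap_twist (Y : LaurentSeries (LaurentSeries V))
    (X : LaurentSeries (LaurentSeries V)) :
    iterMul d (lmap (twist (derEnd d)) X) Y = lmap (twist (derEnd d)) (iterMul d X Y) :=
  (lmap_gop (δ := 0) (δ' := 0) _ _ (twist (derEnd d))
    (AddMonoidHom.id _) (twist (derEnd d)) (fun _ => rfl)
    (fun x _ => twist_opMul d x _) X Y).symm

theorem iterMul_twist (Y : LaurentSeries (LaurentSeries V))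
    (X : LaurentSeries (LaurentSeries V)) :
    iterMul d (twist 0 X) Y = twist 0 (iterMul d X Y) :=
  (twist_gop _ (fun x _ => by simp) X Y).symm

theorem iterMul_one (Y : LaurentSeries (LaurentSeries V)) : iterMul d 1 Y = Y := by
  refine (gop_single _ _ 0 _ Y).trans ?_
  rw [neg_zero, twistPow_zero]
  ext1
  funext j
  exact opMul_one_left d _

end Operations

/-! ### The expansions carry shifted products to iterated products -/

section Intertwine

variable {F V : Type*} [CommRing F] [CommRing V] [Algebra F V] (d : Derivation F V V)

theorem innerVar_add_der (X : LaurentSeries (LaurentSeries V)) :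
    innerVar V X + lmap (lmap (derEnd d)) X = lmap (twist (derEnd d)) X := by
  ext j i
  simp

theorem outerVar_add_der (X : LaurentSeries (LaurentSeries V)) :
    outerVar V X + lmap (lmap (derEnd d)) X = twist (lmap (derEnd d)) X := by
  ext j i
  simp

theorem sumVar_add_der (X : LaurentSeries (LaurentSeries V)) :
    (innerVar V + outerVar V) X + lmap (lmap (derEnd d)) X = twist (twist (derEnd d)) X := by
  ext j i
  simp
  abel

theorem add_lmap_lmap_zero (X Y : LaurentSeries (LaurentSeries V)) :
    X + lmap (lmap (0 : AddMonoid.End V)) Y = X := by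
  ext j i
  simp

/-- With ν = λ + μ, shifting λ and ν by ∂ amounts to shifting the inner variable λ alone. -/
theorem iota₁_starLam (A : LaurentSeries V) (P : Series₃ V) :
    iota₁ V (starLam d A P) = innerMul d A (iota₁ V P) := by
  refine isExpansion_iota₁.map_star (derLam_one d) (derLam_comm d)
    (T := ![lmap (twist (derEnd d)), twist 0, twist (twist (derEnd d))]) (fun i X => ?_)
    (fun i => ?_) (isFiltered_innerMul d A) (innerMul_smul d A) (fun i X => ?_)
    ((innerMul_one d A).trans (iota₁_embed_zero A).symm) P
  · fin_cases i
    exacts [innerVar_add_der d X, add_lmap_lmap_zero _ X, sumVar_add_der d X]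
  · fin_cases i
    exacts [lmap_injective (twist_injective _), twist_injective _, twist_injective _]
  · fin_cases i
    exacts [innerMul_lmap_twist d A X, innerMul_twist d A X, innerMul_twist_twist d A X]

theorem iota₁_starMu (A : LaurentSeries V) (P : Series₃ V) :
    iota₁ V (starMu d A P) = outerMul d (iota₁ V P) A := by
  refine isExpansion_iota₁.map_star (derMu_one d) (derMu_comm d)
    (T := ![lmap (twist 0), twist (lmap (derEnd d)), twist (twist (derEnd d))]) (fun i X => ?_)
    (fun i => ?_) (isFiltered_outerMul d A) (outerMul_smul d A) (fun i X => ?_)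
    ((outerMul_one d A).trans (iota₁_embed_one A).symm) P
  · fin_cases i
    exacts [add_lmap_lmap_zero _ X, outerVar_add_der d X, sumVar_add_der d X]
  · fin_cases i
    exacts [lmap_injective (twist_injective _), twist_injective _, twist_injective _]
  · fin_cases i
    exacts [outerMul_lmap_twist d A X, outerMul_twist d A X, outerMul_twist_twist d A X]

theorem iota₂_starMu (A : LaurentSeries V) (P : Series₃ V) :
    iota₂ V (starMu d A P) = innerMul d A (iota₂ V P) := by
  refine isExpansion_iota₂.map_star (derMu_one d) (derMu_comm d)
    (T := ![twist 0, lmap (twist (derEnd d)), twist (twist (derEnd d))]) (fun i X => ?_)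
    (fun i => ?_) (isFiltered_innerMul d A) (innerMul_smul d A) (fun i X => ?_)
    ((innerMul_one d A).trans (iota₂_embed_one A).symm) P
  · fin_cases i
    exacts [add_lmap_lmap_zero _ X, innerVar_add_der d X, sumVar_add_der d X]
  · fin_cases i
    exacts [twist_injective _, lmap_injective (twist_injective _), twist_injective _]
  · fin_cases i
    exacts [innerMul_twist d A X, innerMul_lmap_twist d A X, innerMul_twist_twist d A X]

theorem iota₂_starLam (A : LaurentSeries V) (P : Series₃ V) :
    iota₂ V (starLam d A P) = outerMul d (iota₂ V P) A := by
  refine isExpansion_iota₂.map_star (derLam_one d) (derLam_comm d)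
    (T := ![twist (lmap (derEnd d)), lmap (twist 0), twist (twist (derEnd d))]) (fun i X => ?_)
    (fun i => ?_) (isFiltered_outerMul d A) (outerMul_smul d A) (fun i X => ?_)
    ((outerMul_one d A).trans (iota₂_embed_zero A).symm) P
  · fin_cases i
    exacts [outerVar_add_der d X, add_lmap_lmap_zero _ X, sumVar_add_der d X]
  · fin_cases i
    exacts [twist_injective _, lmap_injective (twist_injective _), twist_injective _]
  · fin_cases i
    exacts [outerMul_twist d A X, outerMul_lmap_twist d A X, outerMul_twist_twist d A X]

/-- Here λ and ν are the independent variables, both are shifted, and μ = ν − λ is not. -/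
theorem iota₃_starLam (A : LaurentSeries V) (P : Series₃ V) :
    iota₃ V (starLam d A P) = bothMul d (iota₃ V P) A := by
  -- ν − λ = (ν + ∂) − (λ + ∂).
  have e : ∀ X : LaurentSeries (LaurentSeries V), (innerVar V - outerVar V) X
      = lmap (twist (derEnd d)) X - twist (lmap (derEnd d)) X := by
    intro X
    rw [← innerVar_add_der, ← outerVar_add_der, AddMonoidHom.sub_apply]
    abel
  refine isExpansion_iota₃.map_star (derLam_one d) (derLam_comm d)
    (T := ![twist (lmap (derEnd d)), innerVar V - outerVar V, lmap (twist (derEnd d))])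
    (fun i X => ?_) (fun i => ?_) (isFiltered_bothMul d A) (bothMul_smul d A) (fun i X => ?_)
    ((bothMul_one d A).trans (iota₃_embed_zero A).symm) P
  · fin_cases i
    · exact outerVar_add_der d X
    · exact add_lmap_lmap_zero _ X
    · exact innerVar_add_der d X
  · fin_cases i
    exacts [twist_injective _, lmap_sub_twist_injective _, lmap_injective (twist_injective _)]
  · fin_cases i
    · exact bothMul_twist d A X
    · change bothMul d ((innerVar V - outerVar V) X) A
        = (innerVar V - outerVar V) (bothMul d X A)
      rw [e, e, map_sub, AddMonoidHom.sub_apply, bothMul_twist, bothMul_lmap_twist]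
    · exact bothMul_lmap_twist d A X

/-- Only the inner variable ν is shifted, and then μ + ∂ = (ν + ∂) − λ. The right factor A(μ)
becomes the expansion of A(ν − λ). -/
theorem iota₃_starMu (A : LaurentSeries V) (P : Series₃ V) :
    iota₃ V (starMu d A P) = iterMul d (iota₃ V P) (difference A) := by
  obtain ⟨a, ha⟩ := exists_mem_ordFilt A
  obtain ⟨c, hc⟩ := (isFiltered_difference (V := V)).bound
  refine isExpansion_iota₃.map_star (derMu_one d) (derMu_comm d)
    (T := ![twist 0, fun X => lmap (twist (derEnd d)) X - twist 0 X, lmap (twist (derEnd d))])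
    (fun i X => ?_) (fun i => ?_) (isFiltered_iterMul d (hc a A ha))
    (fun v X => iterMul_smul d _ v X) (fun i X => ?_)
    ((iterMul_one d _).trans (difference_apply A)) P
  · fin_cases i
    · exact add_lmap_lmap_zero _ X
    · change (innerVar V - outerVar V) X + lmap (lmap (derEnd d)) X
        = lmap (twist (derEnd d)) X - twist 0 X
      rw [← innerVar_add_der, AddMonoidHom.sub_apply]
      abel
    · exact innerVar_add_der d X
  · fin_cases i
    exacts [twist_injective _, lmap_sub_twist_injective _, lmap_injective (twist_injective _)]
  · fin_cases i
    · exact iterMul_twist d _ X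
    · change iterMul d (lmap (twist (derEnd d)) X - twist 0 X) _ = _
      rw [map_sub, AddMonoidHom.sub_apply, iterMul_twist, iterMul_lmap_twist]
      rfl
    · exact iterMul_lmap_twist d _ X

theorem exists_mem_totFilt₂ {ι : Series₃ V →ₗ[V] LaurentSeries (LaurentSeries V)}
    {t : Fin 3 → LaurentSeries (LaurentSeries V) →+ LaurentSeries (LaurentSeries V)}
    (hι : IsExpansion ι t) (P : Series₃ V) : ∃ n, ι P ∈ totFilt₂ V n := by
  obtain ⟨a, ha⟩ := exists_mem_totFilt P
  obtain ⟨c, hc⟩ := hι.filtered.bound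
  exact ⟨_, hc a P ha⟩

/-- The first two expansions are treated together, as in both ν is the sum of the inner and outer
variables. Of `derLam` only the shift of ν matters here. -/
theorem iota_starNu {ι : Series₃ V →ₗ[V] LaurentSeries (LaurentSeries V)}
    {t : Fin 3 → LaurentSeries (LaurentSeries V) →+ LaurentSeries (LaurentSeries V)}
    (hι : IsExpansion ι t) (ht : t 2 = innerVar V + outerVar V) (A : LaurentSeries V)
    (P : Series₃ V) : ι (starNu d A P) = leftMul d A (ι P) := by
  obtain ⟨n, hn⟩ := exists_mem_totFilt₂ hι P
  exact hι.map_star_embed 2 (T := twist (twist (derEnd d)))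
    (fun X => by rw [ht]; exact sumVar_add_der d X) (twist_injective _)
    (fun n X => twistPow (twist (derEnd d)) n X) (twistPow_zero _) (twist_twistPow _) P
    (isFiltered_leftMul d hn) (fun r v => gop_single _ _ r v _) A

theorem iota₁_starNu (A : LaurentSeries V) (P : Series₃ V) :
    iota₁ V (starNu d A P) = leftMul d A (iota₁ V P) :=
  iota_starNu d isExpansion_iota₁ rfl A P

theorem iota₂_starNu (A : LaurentSeries V) (P : Series₃ V) :
    iota₂ V (starNu d A P) = leftMul d A (iota₂ V P) :=
  iota_starNu d isExpansion_iota₂ rfl A P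

theorem lmap_opMul_mem {X : LaurentSeries (LaurentSeries V)} {n : ℤ} (hX : X ∈ totFilt₂ V n) :
    IsFiltered (ordFilt V) (totFilt₂ V) (fun A => lmap (opMul d A) X) :=
  ⟨fun A B => by ext j; simp, n, fun k A hA j => by
    rw [add_sub_assoc]
    exact gop_mem_ord _ _ hA (hX j)⟩

theorem iota₃_starNu (A : LaurentSeries V) (P : Series₃ V) :
    iota₃ V (starNu d A P) = lmap (opMul d A) (iota₃ V P) := by
  obtain ⟨n, hn⟩ := exists_mem_totFilt₂ isExpansion_iota₃ P
  refine isExpansion_iota₃.map_star_embed 2 (δ := derLam d) (T := lmap (twist (derEnd d)))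
    (fun X => innerVar_add_der d X) (lmap_injective (twist_injective _))
    (fun n X => lmap (twistPow (derEnd d) n) X) (fun X => ?_) (fun n X => ?_) P
    (lmap_opMul_mem d hn) (fun r v => ?_) A
  · ext1
    funext j
    exact twistPow_zero _ _
  · ext1
    funext j
    exact twist_twistPow _ _ _
  · ext1
    funext j
    exact opMul_single d r v _

end Intertwine

/-! ### The substitution μ = ν − λ -/

section Difference

variable {F V : Type*} [CommRing F] [CommRing V] [Algebra F V] (d : Derivation F V V)

theorem embed_smul (i : Fin 3) (v : V) (A : LaurentSeries V) :
    embed i (v • A) = v • embed i A := by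
  ext q
  rw [coeff_smul, coeff_embed, coeff_embed]
  split_ifs <;> simp

theorem embed_twist (i : Fin 3) (δ : AddMonoid.End V) (A : LaurentSeries V) :
    embed i (twist δ A) = twist₃ i δ (embed i A) := by
  have h : ∀ q : ℤ × ℤ × ℤ, coord (q + dir i) i = coord q i + 1 := by
    intro q
    fin_cases i <;> simp [coord, dir]
  ext q
  simp only [coeff_twist₃, coeff_embed, h, add_smul, one_smul, add_left_inj]
  split_ifs <;> simp

theorem difference_smul (v : V) (A : LaurentSeries V) :
    difference (v • A) = v • difference A := by
  rw [difference_apply, embed_smul, map_smul, difference_apply]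

theorem difference_C (v : V) : difference (C v) = single 0 (C v : LaurentSeries V) := by
  have : (C v : LaurentSeries V) = v • 1 := by
    ext j
    simp [coeff_one, coeff_single]
  rw [this, difference_smul, difference_one]
  ext j
  simp only [coeff_smul, coeff_one, coeff_single]
  split_ifs <;> simp

/-- ν − λ + ∂ = −(λ − (ν + ∂)), and λ is the outer variable. -/
theorem difference_twist (A : LaurentSeries V) :
    difference (twist (derEnd d) A) = -twist (-twist (derEnd d)) (difference A) := by
  rw [difference_apply, embed_twist, isExpansion_iota₃.map_twist₃]
  change (innerVar V - outerVar V) (difference A) + _ = _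
  have h : innerVar V (difference A) + lmap (lmap (derEnd d)) (difference A)
      = lmap (twist (derEnd d)) (difference A) := innerVar_add_der d _
  rw [AddMonoidHom.sub_apply, sub_add_eq_add_sub]
  refine (congrArg (fun X => X - outerVar V (difference A)) h).trans ?_
  ext1
  funext j
  change twist (derEnd d) ((difference A).coeff j) - ((difference A).coeff (j + 1) + 0)
    = -((difference A).coeff (j + 1) + -twist (derEnd d) ((difference A).coeff j))
  abel

theorem difference_twistPow (n : ℤ) (A : LaurentSeries V) :
    difference (twistPow (derEnd d) n A)
      = (n.negOnePow : ℤ) • twistPow (-twist (derEnd d)) n (difference A) := by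
  refine map_twistPow difference (derEnd d) (t := fun X => -twist (-twist (derEnd d)) X)
    (neg_injective.comp (twist_injective _)) (difference_twist d) A
    (g := fun n => (n.negOnePow : ℤ) • twistPow (-twist (derEnd d)) n (difference A))
    (fun n => ?_) ?_ n
  · rw [map_zsmul, negOnePow_add_one, neg_smul]
    exact congrArg (fun X => -((n.negOnePow : ℤ) • X)) (twist_twistPow _ n _)
  · rw [Int.negOnePow_zero, Units.val_one, one_smul]
    exact twistPow_zero _ _

end Difference

/-! ### The product in which only the inner variable is shifted -/

section IterMul

variable {F V : Type*} [CommRing F] [CommRing V] [Algebra F V] (d : Derivation F V V)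

theorem iterMul_assoc (X Y Z : LaurentSeries (LaurentSeries V)) :
    iterMul d (iterMul d X Y) Z = iterMul d X (iterMul d Y Z) :=
  (gop_assoc (opMul d) (opMul d) (opMul d) (opMul d) (δN := 0) (δP := 0) (δQ := 0)
    (fun n p => by simp) (fun m n p => (opMul_assoc d m n p).symm) X Y Z).symm

theorem iterMul_lmap_twist_right (X Y : LaurentSeries (LaurentSeries V)) :
    iterMul d X (lmap (twist (derEnd d)) Y) = iterMul d (lmap (twist 0) X) Y := by
  refine IsFiltered.ext_single ordFilt_sep
    (f := fun X => iterMul d X (lmap (twist (derEnd d)) Y))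
    (g := fun X => iterMul d (lmap (twist 0) X) Y) (isFiltered_gop_left _ _ _)
    ((isFiltered_gop_left _ _ _).comp (isFiltered_lmap_ord _)) (fun r x => ?_) X
  refine (gop_single _ _ r x _).trans (Eq.trans ?_ ((congrArg (fun X => iterMul d X Y)
    (lmap_single (twist 0) r x)).trans (gop_single _ _ r _ _)).symm)
  rw [← twistPow_lmap (twist (derEnd d)) (δ := 0) (fun x => by simp)]
  ext1
  funext j
  exact opMul_twist d x _

/-- The factor λ − (ν + ∂) on Y moves to X as λ − ν, the operator version of moving ∂ across a
composition. -/
theorem iterMul_twist_right (X Y : LaurentSeries (LaurentSeries V)) :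
    iterMul d X (twist (-twist (derEnd d)) Y) = iterMul d (twist (-twist 0) X) Y := by
  have e : ∀ (δ : AddMonoid.End V) (X : LaurentSeries (LaurentSeries V)),
      twist (-twist δ) X = twist 0 X - lmap (twist δ) X := by
    intro δ X
    ext1
    funext j
    change X.coeff (j + 1) + -twist δ (X.coeff j) = X.coeff (j + 1) + 0 - twist δ (X.coeff j)
    abel
  rw [e, e, map_sub, map_sub, AddMonoidHom.sub_apply, iterMul_lmap_twist_right]
  congr 1
  exact gop_twist_right _ _ _ _

theorem iterMul_twistPow_right (n : ℤ) (X Y : LaurentSeries (LaurentSeries V)) :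
    iterMul d X (twistPow (-twist (derEnd d)) n Y) = iterMul d (twistPow (-twist 0) n X) Y :=
  balanced_twistPow (fun X Y => iterMul d X Y) _ _ (iterMul_twist_right d) n X Y

theorem iterMul_single_zero (X : LaurentSeries (LaurentSeries V)) (w : LaurentSeries V) :
    iterMul d X (single 0 w) = lmap ((opMul d).flip w) X := by
  refine IsFiltered.ext_single ordFilt_sep (f := fun X => iterMul d X (single 0 w))
    (g := fun X => lmap ((opMul d).flip w) X) (isFiltered_gop_left _ _ _)
    (isFiltered_lmap_ord _) (fun r x => ?_) X
  have : twistPow 0 (-r) (single 0 w : LaurentSeries (LaurentSeries V)) = single r w := by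
    have := map_twistPow (fun A => A) (0 : AddMonoid.End (LaurentSeries V)) (twist_injective _)
      (fun _ => rfl) (single 0 w) (g := fun n => single (-n) w)
      (fun n => by rw [twist_single, neg_add, ← sub_eq_add_neg]; simp) (by simp) (-r)
    rwa [neg_neg] at this
  refine (gop_single _ _ r x _).trans ?_
  rw [this]
  exact (lmap_single (opMul d x) r w).trans (lmap_single ((opMul d).flip w) r x).symm

theorem twistPow_iterMul (n : ℤ) (X Y : LaurentSeries (LaurentSeries V)) :
    twistPow (-twist (derEnd d)) n (iterMul d X Y)
      = iterMul d (twistPow (-twist (derEnd d)) n X) Y :=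
  twistPow_gop (opMul d) (δ := 0) (fun x y => by
    change -twist (derEnd d) (opMul d x y) = opMul d (-twist (derEnd d) x) y + opMul d x 0
    rw [twist_opMul, map_neg, map_zero, add_zero, AddMonoidHom.neg_apply]) n X Y

theorem difference_single (r : ℤ) (v : V) : difference (single r v)
    = v • ((r.negOnePow : ℤ) • twistPow (-twist (derEnd d)) (-r) 1) := by
  have h : (single r v : LaurentSeries V) = v • twistPow (derEnd d) (-r) 1 := by
    rw [twistPow_one, neg_neg, smul_single, mul_one]
  rw [h, difference_smul, difference_twistPow, difference_one, Int.negOnePow_neg]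

/-- Replacing μ by ν − λ turns μ + ∂ into (ν + ∂) − λ, so the product in μ becomes the product in ν
with λ as a parameter. -/
theorem difference_opMul (A B : LaurentSeries V) :
    difference (opMul d A B) = iterMul d (difference A) (difference B) := by
  refine IsFiltered.ext_single ordFilt_sep (f := fun A => difference (opMul d A B))
    (g := fun A => iterMul d (difference A) (difference B))
    (isFiltered_difference_outer.comp (isFiltered_gop_left _ _ _))
    ((isFiltered_gop_left _ _ _).comp isFiltered_difference_outer) (fun r v => ?_) A
  rw [opMul_single, difference_smul, difference_twistPow, difference_single d, iterMul_smul,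
    map_zsmul, AddMonoidHom.zsmul_apply, ← twistPow_iterMul, iterMul_one, Int.negOnePow_neg]

end IterMul

/-! ### Leibniz rules for brackets with products of symbols -/

section OuterMul

variable {F V : Type*} [CommRing F] [CommRing V] [Algebra F V] (d : Derivation F V V)

theorem leftMul_assoc (A B : LaurentSeries V) (X : LaurentSeries (LaurentSeries V)) :
    leftMul d (opMul d A B) X = leftMul d A (leftMul d B X) := by
  refine (gop_assoc (AddMonoidHom.smul (R := V) (M := LaurentSeries V))
    (AddMonoidHom.smul (R := V) (M := LaurentSeries V))
    (AddMonoidHom.smul (R := V) (M := LaurentSeries V)) AddMonoidHom.mul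
    (δN := derEnd d) (δP := twist (derEnd d)) (δQ := twist (derEnd d)) (fun w x => ?_)
    (fun v w x => (mul_smul v w x).symm) A B X).symm
  ext j
  change w * x.coeff (j + 1) + d (w * x.coeff j)
    = d w * x.coeff j + w * (x.coeff (j + 1) + d (x.coeff j))
  rw [Derivation.leibniz, smul_eq_mul, smul_eq_mul]
  ring

theorem leftMul_one (X : LaurentSeries (LaurentSeries V)) : leftMul d 1 X = X := by
  refine (gop_single _ _ 0 1 X).trans ?_
  rw [neg_zero]
  refine (congrArg _ (twistPow_zero _ X)).trans ?_
  ext1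
  funext j
  exact one_smul V _

theorem innerMul_outerMul (A B : LaurentSeries V) (X : LaurentSeries (LaurentSeries V)) :
    innerMul d A (outerMul d X B) = outerMul d (innerMul d A X) B :=
  lmap_gop (δ := derEnd d) (δ' := derEnd d)
    (AddMonoidHom.smul (R := V) (M := LaurentSeries V)).flip
    (AddMonoidHom.smul (R := V) (M := LaurentSeries V)).flip ((opMul d).flip A)
    (AddMonoidHom.id V) ((opMul d).flip A) (fun _ => rfl)
    (fun x w => opMul_smul_left d w x A) X B

variable {d}

/-- An operator that acts by derivations in its argument, applied to a product of symbols. -/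
theorem lmap_opMul {X : V →+ LaurentSeries V} (hmul : ∀ v w, X (v * w) = v • X w + w • X v)
    (hder : ∀ v, X (d v) = twist (derEnd d) (X v)) (A B : LaurentSeries V) :
    lmap X (opMul d A B) = outerMul d (lmap X A) B + leftMul d A (lmap X B) := by
  refine IsFiltered.ext_single ordFilt_sep (f := fun A => lmap X (opMul d A B))
    (g := fun A => outerMul d (lmap X A) B + leftMul d A (lmap X B))
    ((isFiltered_lmap_ord _).comp (isFiltered_gop_left _ _ _))
    (((isFiltered_gop_left _ _ _).comp (isFiltered_lmap_ord _)).add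
      (antitone_laurentFilt antitone_trivFilt) (isFiltered_gop_left _ _ _)) (fun r v => ?_) A
  -- For A = v y^(−r), the Leibniz rule gives one term for each factor; in the second,
  -- sesquilinearity turns ∂ into x + ∂, with x the inner variable.
  have h₁ : outerMul d (lmap X (single r v)) B
      = lmap ((AddMonoidHom.smul (R := V) (M := LaurentSeries V)).flip (X v))
        (twistPow (derEnd d) (-r) B) := by
    rw [lmap_single]
    exact gop_single _ _ r _ B
  have h₂ : leftMul d (single r v) (lmap X B)
      = lmap (AddMonoidHom.smul (R := V) (M := LaurentSeries V) v)
        (lmap X (twistPow (derEnd d) (-r) B)) := by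
    rw [twistPow_lmap X (δ' := twist (derEnd d)) hder]
    exact gop_single _ _ r _ _
  rw [h₁, h₂, opMul_single, add_comm]
  ext1
  funext j
  exact hmul v _

/-- A bracket in its first argument, applied to a product of symbols. -/
theorem lmap_opMul_of_skew {Z : V →+ LaurentSeries V}
    (hmul : ∀ v w, Z (v * w) = opMul d (Z v) (C w) + opMul d (Z w) (C v))
    (hder : ∀ v, Z (d v) = -twist 0 (Z v)) (A B : LaurentSeries V) :
    lmap Z (opMul d A B) = bothMul d (lmap Z A) B
      + iterMul d (lmap Z B) (difference (reflectHom d A)) := by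
  refine IsFiltered.ext_single ordFilt_sep (f := fun A => lmap Z (opMul d A B))
    (g := fun A => bothMul d (lmap Z A) B
      + iterMul d (lmap Z B) (difference (reflectHom d A)))
    ((isFiltered_lmap_ord _).comp (isFiltered_gop_left _ _ _))
    (((isFiltered_gop_left _ _ _).comp (isFiltered_lmap_ord _)).add
      (antitone_laurentFilt antitone_trivFilt)
      ((isFiltered_gop_right _ _ _).comp
        (isFiltered_difference_outer.comp (isFiltered_reflect d)))) (fun r v => ?_) A
  have h₁ : bothMul d (lmap Z (single r v)) B
      = lmap ((opMul d).compl₂ (constHom V) (Z v)) (twistPow (derEnd d) (-r) B) := by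
    rw [lmap_single]
    exact gop_single _ _ r _ B
  have h₂ : iterMul d (lmap Z B) (difference (reflectHom d (single r v)))
      = lmap ((opMul d).flip (C v)) (lmap Z (twistPow (derEnd d) (-r) B)) := by
    -- Two signs (−1)^r cancel, one from the adjoint and one from the substitution ν − λ. There
    -- remains (λ − ν)^(−r), which is what (λ + ∂)^(−r) becomes under Z, as Z turns ∂ into −ν.
    rw [reflect_single, map_zsmul, difference_twistPow, difference_C, map_zsmul, map_zsmul,
      iterMul_twistPow_right, iterMul_single_zero, smul_smul, Int.negOnePow_neg,
      ← Units.val_mul, ← Int.negOnePow_add, Int.negOnePow_even _ ⟨r, rfl⟩, Units.val_one,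
      one_smul, twistPow_lmap Z (δ' := -twist 0) hder]
  rw [h₁, h₂, opMul_single]
  ext1
  funext j
  exact hmul v _

end OuterMul

/-! ### The Dirac modification of the Jacobi identity -/

section Reduction

variable {F V : Type*} [Field F] [CommRing V] [Algebra F V] (d : Derivation F V V)
  (br : V →ₗ[F] V →ₗ[F] LaurentSeries V) {m : ℕ} (θ : Fin m → V)
  (D : Matrix (Fin m) (Fin m) (LaurentSeries V))

/-- The correction of a family of series in three variables in its first argument. -/
def reduceLam (J : V → V → V → Series₃ V) (a b c : V) : Series₃ V :=
  J a b c - ∑ γ, starLam d (diracCoef d br θ D γ a) (J (θ γ) b c)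

/-- The correction of a family of series in three variables in its first two arguments. -/
def reduceMu (J : V → V → V → Series₃ V) (a b c : V) : Series₃ V :=
  reduceLam d br θ D J a b c
    - ∑ β, starMu d (diracCoef d br θ D β b) (reduceLam d br θ D J a (θ β) c)

/-- The Dirac modification of a family of series in three variables. -/
def reduceNu (J : V → V → V → Series₃ V) (a b c : V) : Series₃ V :=
  reduceMu d br θ D J a b c
    - ∑ β, starNu d (br (θ β) c) (∑ α, starNu d (D β α) (reduceMu d br θ D J a b (θ α)))

theorem reduceLam_sub (J J' : V → V → V → Series₃ V) :
    reduceLam d br θ D (J - J') = reduceLam d br θ D J - reduceLam d br θ D J' := by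
  funext a b c
  simp only [reduceLam, Pi.sub_apply, map_sub, Finset.sum_sub_distrib]
  abel

theorem reduceMu_sub (J J' : V → V → V → Series₃ V) :
    reduceMu d br θ D (J - J') = reduceMu d br θ D J - reduceMu d br θ D J' := by
  funext a b c
  simp only [reduceMu, reduceLam_sub, Pi.sub_apply, map_sub, Finset.sum_sub_distrib]
  abel

theorem reduceNu_sub (J J' : V → V → V → Series₃ V) :
    reduceNu d br θ D (J - J') = reduceNu d br θ D J - reduceNu d br θ D J' := by
  funext a b c
  simp only [reduceNu, reduceMu_sub, Pi.sub_apply, map_sub, Finset.sum_sub_distrib]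
  abel

variable {d br θ D}

theorem lmap_sum_sub {ι M N : Type*} [AddCommGroup M] [AddCommGroup N] (s : Finset ι)
    {X Y : M →+ N} {Z : ι → M →+ N} (h : ∀ v, X v = Y v - ∑ i ∈ s, Z i v)
    (A : LaurentSeries M) : lmap X A = lmap Y A - ∑ i ∈ s, lmap (Z i) A := by
  ext j
  rw [coeff_sub, coeff_lmap, coeff_lmap, h, coeff_sum]
  rfl

/-- The Dirac bracket `{a_λ ·}` applied to a series. -/
theorem lmap_dirac (a : V) (A : LaurentSeries V) :
    lmap (dirac d br θ D a).toAddMonoidHom A = lmap (br a).toAddMonoidHom A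
      - ∑ γ, innerMul d (diracCoef d br θ D γ a) (lmap (br (θ γ)).toAddMonoidHom A) :=
  lmap_sum_sub Finset.univ
    (Z := fun γ => ((opMul d).flip (diracCoef d br θ D γ a)).comp (br (θ γ)).toAddMonoidHom)
    (fun v => dirac_apply a v) A

theorem lmap_dirac_opMul (hbr : IsPVABracket d br) (a : V) (A B : LaurentSeries V) :
    lmap (dirac d br θ D a).toAddMonoidHom (opMul d A B)
      = outerMul d (lmap (dirac d br θ D a).toAddMonoidHom A) B
        + leftMul d A (lmap (dirac d br θ D a).toAddMonoidHom B) :=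
  lmap_opMul (fun v w => dirac_mul_right hbr a v w) (fun v => dirac_twist_right hbr a v) A B

theorem sum_leftMul_ite (X : Fin m → LaurentSeries (LaurentSeries V)) (γ : Fin m) :
    ∑ β, leftMul d (if γ = β then 1 else 0) (X β) = X γ := by
  rw [Finset.sum_eq_single γ]
  · rw [if_pos rfl, leftMul_one]
  · intro β _ h
    rw [if_neg h.symm, map_zero, AddMonoidHom.zero_apply]
  · simp

variable (d br θ D) in
/-- The part of `{a_λ {b_μ c}ᴰ}ᴰ` in which the outer bracket does not act on the coefficients of
the inner one. -/
def iterated (a b c : V) : LaurentSeries (LaurentSeries V) :=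
  lmap (dirac d br θ D a).toAddMonoidHom (br b c) - ∑ β, outerMul d
    (lmap (dirac d br θ D a).toAddMonoidHom (br (θ β) c)) (diracCoef d br θ D β b)

/-- The Leibniz rule leaves the unknowns Y_β = {a_λ X_β(b)}ᴰ. They are found by taking for c the
constraints and inverting C(λ+μ+∂), so that no bracket with an entry of C⁻¹ is ever computed. -/
theorem lmap_dirac_dirac (hbr : IsPVABracket d br)
    (hD : IsInverseOp d (constraintMatrix br θ) D) (a b c : V) :
    lmap (dirac d br θ D a).toAddMonoidHom (dirac d br θ D b c) = iterated d br θ D a b c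
      - ∑ β, leftMul d (br (θ β) c)
          (∑ α, leftMul d (D β α) (iterated d br θ D a b (θ α))) := by
  have key : ∀ c, lmap (dirac d br θ D a).toAddMonoidHom (dirac d br θ D b c)
      = iterated d br θ D a b c - ∑ β, leftMul d (br (θ β) c)
        (lmap (dirac d br θ D a).toAddMonoidHom (diracCoef d br θ D β b)) := by
    intro c
    rw [dirac_apply b c, map_sub, map_sum, iterated]
    simp only [lmap_dirac_opMul hbr, Finset.sum_add_distrib]
    abel
  -- For c = θ_α the left-hand side of `key` vanishes: this is the linear system for the Y_β.
  have hθ : ∀ α, iterated d br θ D a b (θ α) = ∑ β, leftMul d (br (θ β) (θ α))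
      (lmap (dirac d br θ D a).toAddMonoidHom (diracCoef d br θ D β b)) := by
    intro α
    have := key (θ α)
    rwa [dirac_constraint_right hD, map_zero, eq_comm, sub_eq_zero] at this
  rw [key c]
  congr 1
  refine Finset.sum_congr rfl fun γ _ => congrArg _ ?_
  simp only [hθ, map_sum, ← leftMul_assoc]
  rw [Finset.sum_comm]
  simp only [← AddMonoidHom.finsetSum_apply, ← map_sum, hD.sum_left]
  exact (sum_leftMul_ite (d := d) (fun β => lmap (dirac d br θ D a).toAddMonoidHom
    (diracCoef d br θ D β b)) γ).symm

variable {J : V → V → V → Series₃ V}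

theorem iota₁_reduceNu (hbr : IsPVABracket d br) (hD : IsInverseOp d (constraintMatrix br θ) D)
    (hJ : ∀ a b c, iota₁ V (J a b c) = lmap (br a).toAddMonoidHom (br b c)) (a b c : V) :
    iota₁ V (reduceNu d br θ D J a b c)
      = lmap (dirac d br θ D a).toAddMonoidHom (dirac d br θ D b c) := by
  have h₁ : ∀ a b c, iota₁ V (reduceLam d br θ D J a b c)
      = lmap (dirac d br θ D a).toAddMonoidHom (br b c) := by
    intro a b c
    simp only [reduceLam, map_sub, map_sum, iota₁_starLam, hJ, lmap_dirac]
  have h₂ : ∀ c, iota₁ V (reduceMu d br θ D J a b c) = iterated d br θ D a b c := by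
    intro c
    simp only [reduceMu, map_sub, map_sum, iota₁_starMu, h₁, iterated]
  rw [lmap_dirac_dirac hbr hD]
  simp only [reduceNu, map_sub, map_sum, iota₁_starNu, h₂]

theorem iota₂_reduceNu (hbr : IsPVABracket d br) (hD : IsInverseOp d (constraintMatrix br θ) D)
    (hJ : ∀ a b c, iota₂ V (J a b c) = lmap (br b).toAddMonoidHom (br a c)) (a b c : V) :
    iota₂ V (reduceNu d br θ D J a b c)
      = lmap (dirac d br θ D b).toAddMonoidHom (dirac d br θ D a c) := by
  -- The roles of a and b are exchanged: the correction in a is now the outer one. It may still be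
  -- made first, since `innerMul` and `outerMul` commute.
  have h₂ : ∀ c, iota₂ V (reduceMu d br θ D J a b c) = iterated d br θ D b a c := by
    intro c
    simp only [reduceMu, reduceLam, map_sub, map_sum, iota₂_starMu, iota₂_starLam, hJ, iterated,
      lmap_dirac, AddMonoidHom.sub_apply, AddMonoidHom.finsetSum_apply, innerMul_outerMul,
      Finset.sum_sub_distrib]
    rw [Finset.sum_comm]
    abel
  rw [lmap_dirac_dirac hbr hD]
  simp only [reduceNu, map_sub, map_sum, iota₂_starNu, h₂]

/-- After the correction in a, the left Leibniz rule leaves a term with {b_μ θ_γ}. For b = θ_β only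
that term survives, so the correction in b contributes the sum of {θ_β μ+∂ θ_γ}_→ X_β(b) over β,
which is again {b_μ θ_γ} and cancels it. -/
theorem iota₃_reduceMu (hbr : IsPVABracket d br) (hD : IsInverseOp d (constraintMatrix br θ) D)
    (hJ : ∀ a b c, iota₃ V (J a b c) = lmap (br.flip c).toAddMonoidHom (br a b)) (a b c : V) :
    iota₃ V (reduceMu d br θ D J a b c)
      = lmap (br.flip c).toAddMonoidHom (dirac d br θ D a b) := by
  have h₁ : ∀ b, iota₃ V (reduceLam d br θ D J a b c)
      = lmap (br.flip c).toAddMonoidHom (dirac d br θ D a b)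
        - ∑ γ, iterMul d (lmap (br.flip c).toAddMonoidHom (diracCoef d br θ D γ a))
          (difference (br b (θ γ))) := by
    intro b
    have h : ∀ γ, bothMul d (lmap (br.flip c).toAddMonoidHom (br (θ γ) b))
        (diracCoef d br θ D γ a)
        = lmap (br.flip c).toAddMonoidHom (opMul d (br (θ γ) b) (diracCoef d br θ D γ a))
          + iterMul d (lmap (br.flip c).toAddMonoidHom (diracCoef d br θ D γ a))
            (difference (br b (θ γ))) := by
      intro γ
      -- Skewsymmetry replaces the adjoint of {θ_γ λ b} by −{b_λ θ_γ}.
      rw [lmap_opMul_of_skew (fun v w => hbr.mul_left v w c) (fun v => hbr.twist_left v c),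
        hbr.skew' (θ γ) b, map_neg difference, map_neg]
      abel
    rw [dirac_apply a b]
    simp only [reduceLam, map_sub, map_sum, iota₃_starLam, hJ, h, Finset.sum_add_distrib]
    abel
  simp only [reduceMu, map_sub, map_sum, iota₃_starMu, h₁, dirac_constraint_right hD, map_zero,
    zero_sub, AddMonoidHom.neg_apply, AddMonoidHom.finsetSum_apply, iterMul_assoc,
    ← difference_opMul, map_neg]
  rw [Finset.sum_neg_distrib, Finset.sum_comm]
  simp only [← map_sum, sum_opMul_diracCoef hD]
  abel

theorem iota₃_reduceNu (hbr : IsPVABracket d br) (hD : IsInverseOp d (constraintMatrix br θ) D)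
    (hJ : ∀ a b c, iota₃ V (J a b c) = lmap (br.flip c).toAddMonoidHom (br a b)) (a b c : V) :
    iota₃ V (reduceNu d br θ D J a b c)
      = lmap ((dirac d br θ D).flip c).toAddMonoidHom (dirac d br θ D a b) := by
  have h : lmap ((dirac d br θ D).flip c).toAddMonoidHom (dirac d br θ D a b)
      = lmap (br.flip c).toAddMonoidHom (dirac d br θ D a b) - ∑ β, lmap (opMul d (br (θ β) c))
        (lmap (diracCoef d br θ D β) (dirac d br θ D a b)) :=
    lmap_sum_sub Finset.univ
      (Z := fun β => (opMul d (br (θ β) c)).comp (diracCoef d br θ D β))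
      (fun v => dirac_apply v c) _
  have h' : ∀ β, lmap (diracCoef d br θ D β) (dirac d br θ D a b)
      = ∑ α, lmap (opMul d (D β α)) (lmap (br.flip (θ α)).toAddMonoidHom
          (dirac d br θ D a b)) := by
    intro β
    ext1
    funext j
    rw [coeff_lmap, diracCoef_apply, coeff_sum]
    rfl
  simp only [reduceNu, map_sub, map_sum, iota₃_starNu, iota₃_reduceMu hbr hD hJ, h, h']

theorem isPVABracket_dirac (hbr : IsPVABracket d br)
    (hD : IsInverseOp d (constraintMatrix br θ) D) : IsPVABracket d (dirac d br θ D) := by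
  have hJ : ∀ a b c, ∃ P Q : Series₃ V, iota₁ V P = lmap (br a).toAddMonoidHom (br b c) ∧
      iota₂ V Q = lmap (br b).toAddMonoidHom (br a c) ∧
      iota₃ V (P - Q) = lmap (br.flip c).toAddMonoidHom (br a b) := by
    intro a b c
    obtain ⟨P, Q, R, hP, hQ, hR, h⟩ := hbr.jacobi a b c
    obtain ⟨P, rfl⟩ := Submodule.mkQ_surjective _ P
    obtain ⟨Q, rfl⟩ := Submodule.mkQ_surjective _ Q
    refine ⟨P, Q, hP, hQ, ?_⟩
    rw [← h, ← map_sub] at hR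
    exact hR
  -- Lifts are chosen for all triples at once, because the reduction also evaluates the families at
  -- the constraints. The third family is P − Q itself, so additivity of `reduceNu` gives the Jacobi
  -- identity.
  choose P Q hP hQ hR using hJ
  have h₁ := iota₁_reduceNu hbr hD hP
  have h₂ := iota₂_reduceNu hbr hD hQ
  have h₃ := iota₃_reduceNu hbr hD (J := P - Q) hR
  exact {
    sesq_left := fun a b => by rw [dirac_twist_left hbr, lam_mul]
    sesq_right := fun a b => by rw [dirac_twist_right hbr, lam_mul_add_map]
    leibniz_left := dirac_mul_right hbr
    leibniz_right := fun a b c => by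
      rw [dirac_mul_left hbr, opProd_eq_opMul, opProd_eq_opMul]
    skew := dirac_skew hbr hD
    admissible := fun a b c => ⟨Submodule.mkQ _ (reduceNu d br θ D P a b c), h₁ a b c⟩
    jacobi := fun a b c => ⟨Submodule.mkQ _ (reduceNu d br θ D P a b c),
      Submodule.mkQ _ (reduceNu d br θ D Q a b c),
      Submodule.mkQ _ (reduceNu d br θ D (P - Q) a b c), h₁ a b c, h₂ a b c, h₃ a b c, by
        rw [reduceNu_sub, Pi.sub_apply, Pi.sub_apply, Pi.sub_apply, map_sub]⟩ }

end Reduction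

/-! ### Compatibility with homomorphisms of the coefficients -/

section Coefficients

variable {V W : Type*} [CommRing V] [CommRing W] (π : V →+* W)

theorem iota₁_map (P : Series₃ V) :
    iota₁ W (P.map π) = lmap (lmap π.toAddMonoidHom) (iota₁ V P) := by
  ext j i
  exact expandCoeff_map 1 π.toAddMonoidHom (bounded₁ P) i j

theorem iota₂_map (P : Series₃ V) :
    iota₂ W (P.map π) = lmap (lmap π.toAddMonoidHom) (iota₂ V P) := by
  ext j i
  exact expandCoeff_map 1 π.toAddMonoidHom (bounded₂ P) i j

theorem iota₃_map (P : Series₃ V) :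
    iota₃ W (P.map π) = lmap (lmap π.toAddMonoidHom) (iota₃ V P) := by
  ext j i
  exact expandCoeff_map (-1) π.toAddMonoidHom (bounded₃ P) i j

variable {F : Type*} [CommRing F] [Algebra F V] [Algebra F W] {d : Derivation F V V}
  {d' : Derivation F W W}

theorem lmap_opMul_hom (h : ∀ v, π (d v) = d' (π v)) (A B : LaurentSeries V) :
    lmap π.toAddMonoidHom (opMul d A B)
      = opMul d' (lmap π.toAddMonoidHom A) (lmap π.toAddMonoidHom B) := by
  have hδ : ∀ v, π.toAddMonoidHom (derEnd d v) = derEnd d' (π.toAddMonoidHom v) := h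
  have hφ : ∀ v w, π.toAddMonoidHom ((AddMonoidHom.mul (R := V)) v w)
      = (AddMonoidHom.mul (R := W)) (π.toAddMonoidHom v) (π.toAddMonoidHom w) :=
    fun v w => map_mul π v w
  exact lmap_gop _ _ _ _ _ hδ hφ A B

theorem lmap_C_hom (v : V) : lmap π.toAddMonoidHom (C v) = C (π v) :=
  lmap_single _ _ _

theorem lmap_reflect_hom (h : ∀ v, π (d v) = d' (π v)) (A : LaurentSeries V) :
    lmap π.toAddMonoidHom (reflect d A) = reflect d' (lmap π.toAddMonoidHom A) := by
  have hk : ∀ (k : ℕ) v, π (((d : V →ₗ[F] V) ^ k) v) = ((d' : W →ₗ[F] W) ^ k) (π v) := by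
    intro k
    induction k with
    | zero => exact fun v => rfl
    | succ k ih =>
      intro v
      rw [pow_succ', pow_succ', Module.End.mul_apply, Module.End.mul_apply, ← ih]
      exact h _
  ext j
  rw [coeff_lmap, coeff_reflect, coeff_reflect,
    AddMonoidHom.map_finsum π.toAddMonoidHom (reflect_finite d A j)]
  refine finsum_congr fun k => ?_
  rw [map_zsmul, map_zsmul]
  exact congrArg (fun w => (((k : ℤ) - j).negOnePow : ℤ) • Ring.choose ((k : ℤ) - j) k • w)
    (hk k _)

theorem lmap_twist_hom (h : ∀ v, π (d v) = d' (π v)) (A : LaurentSeries V) :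
    lmap π.toAddMonoidHom (twist (derEnd d) A) = twist (derEnd d') (lmap π.toAddMonoidHom A) :=
  twist_lmap π.toAddMonoidHom h A

theorem lmap_twist_zero_hom (A : LaurentSeries V) :
    lmap π.toAddMonoidHom (twist 0 A) = twist 0 (lmap π.toAddMonoidHom A) :=
  twist_lmap π.toAddMonoidHom (δ := 0) (δ' := 0) (fun _ => map_zero π) A

end Coefficients

/-! ### The bracket on the quotient by a differential ideal -/

section Quotient

variable {F V : Type*} [Field F] [CommRing V] [Algebra F V] {d : Derivation F V V}
  {br : V →ₗ[F] V →ₗ[F] LaurentSeries V} {I : Ideal V}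

theorem map_mk_eq (h₁ : ∀ x ∈ I, ∀ a n, (br x a).coeff n ∈ I)
    (h₂ : ∀ x ∈ I, ∀ a n, (br a x).coeff n ∈ I) {a a' b b' : V}
    (ha : Ideal.Quotient.mk I a = Ideal.Quotient.mk I a')
    (hb : Ideal.Quotient.mk I b = Ideal.Quotient.mk I b') :
    (br a b).map (Ideal.Quotient.mk I) = (br a' b').map (Ideal.Quotient.mk I) := by
  rw [Ideal.Quotient.eq] at ha hb
  ext n
  refine Ideal.Quotient.eq.2 ?_
  have : (br a b).coeff n - (br a' b').coeff n
      = (br (a - a') b).coeff n + (br a' (b - b')).coeff n := by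
    simp
  rw [this]
  exact add_mem (h₁ _ ha _ _) (h₂ _ hb _ _)

variable (br) in
/-- The bracket induced on the quotient by an ideal. -/
def quotBracket (h₁ : ∀ x ∈ I, ∀ a n, (br x a).coeff n ∈ I)
    (h₂ : ∀ x ∈ I, ∀ a n, (br a x).coeff n ∈ I) :
    (V ⧸ I) →ₗ[F] (V ⧸ I) →ₗ[F] LaurentSeries (V ⧸ I) :=
  -- The chosen representatives respect the operations only modulo I, which suffices by `map_mk_eq`.
  have hadd : ∀ x y : V ⧸ I, Ideal.Quotient.mk I (x + y).out
      = Ideal.Quotient.mk I (x.out + y.out) := fun x y => by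
    rw [map_add, Ideal.Quotient.mk_out, Ideal.Quotient.mk_out, Ideal.Quotient.mk_out]
  have hsmul : ∀ (c : F) (x : V ⧸ I), Ideal.Quotient.mk I (c • x).out
      = Ideal.Quotient.mk I (c • x.out) := fun c x => by
    rw [Ideal.Quotient.mk_out]
    conv_lhs => rw [← Ideal.Quotient.mk_out x]
    rfl
  LinearMap.mk₂ F (fun x y => (br x.out y.out).map (Ideal.Quotient.mk I))
    (fun x x' y => by
      rw [map_mk_eq h₁ h₂ (hadd x x') rfl]
      ext n
      simp)
    (fun c x y => by
      rw [map_mk_eq h₁ h₂ (hsmul c x) rfl]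
      ext n
      rw [map_smul, LinearMap.smul_apply]
      rfl)
    (fun x y y' => by
      rw [map_mk_eq h₁ h₂ rfl (hadd y y')]
      ext n
      simp)
    (fun c x y => by
      rw [map_mk_eq h₁ h₂ rfl (hsmul c y)]
      ext n
      rw [map_smul]
      rfl)

theorem quotBracket_mk (h₁ : ∀ x ∈ I, ∀ a n, (br x a).coeff n ∈ I)
    (h₂ : ∀ x ∈ I, ∀ a n, (br a x).coeff n ∈ I) (a b : V) :
    quotBracket br h₁ h₂ (Ideal.Quotient.mk I a) (Ideal.Quotient.mk I b)
      = lmap (Ideal.Quotient.mk I).toAddMonoidHom (br a b) :=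
  map_mk_eq h₁ h₂ (Ideal.Quotient.mk_out _) (Ideal.Quotient.mk_out _)

/-- Every axiom is the image of the one on V under reduction of the coefficients; the expansions
commute with it, so the preimages in three variables descend too. -/
theorem isPVABracket_quotBracket (hbr : IsPVABracket d br) (hI : ∀ x ∈ I, d x ∈ I)
    (h₁ : ∀ x ∈ I, ∀ a n, (br x a).coeff n ∈ I) (h₂ : ∀ x ∈ I, ∀ a n, (br a x).coeff n ∈ I) :
    IsPVABracket (quotDer d I hI) (quotBracket br h₁ h₂) := by
  have hd : ∀ v, Ideal.Quotient.mk I (d v) = quotDer d I hI (Ideal.Quotient.mk I v) :=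
    fun v => (quotDer_mk d I hI v).symm
  have hr : ∀ a (A : LaurentSeries V), (lmap (Ideal.Quotient.mk I).toAddMonoidHom A).map
      (quotBracket br h₁ h₂ (Ideal.Quotient.mk I a))
      = lmap (lmap (Ideal.Quotient.mk I).toAddMonoidHom) (A.map (br a)) := by
    intro a A
    ext1
    funext j
    exact quotBracket_mk h₁ h₂ a _
  have hl : ∀ c (A : LaurentSeries V), (lmap (Ideal.Quotient.mk I).toAddMonoidHom A).map
      ((quotBracket br h₁ h₂).flip (Ideal.Quotient.mk I c))
      = lmap (lmap (Ideal.Quotient.mk I).toAddMonoidHom) (A.map (br.flip c)) := by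
    intro c A
    ext1
    funext j
    exact quotBracket_mk h₁ h₂ _ c
  have hsmul : ∀ v (A : LaurentSeries V), lmap (Ideal.Quotient.mk I).toAddMonoidHom (v • A)
      = Ideal.Quotient.mk I v • lmap (Ideal.Quotient.mk I).toAddMonoidHom A := by
    intro v A
    ext j
    exact map_mul (Ideal.Quotient.mk I) _ _
  have surj := Ideal.Quotient.mk_surjective (I := I)
  refine ⟨surj.forall₂.2 fun a b => ?_, surj.forall₂.2 fun a b => ?_, surj.forall₃.2
    fun a b c => ?_, surj.forall₃.2 fun a b c => ?_, surj.forall₂.2 fun a b => ?_,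
    surj.forall₃.2 fun a b c => ?_, surj.forall₃.2 fun a b c => ?_⟩
  · rw [← hd, quotBracket_mk, quotBracket_mk, hbr.twist_left, map_neg, lmap_twist_zero_hom,
      lam_mul]
  · rw [← hd, quotBracket_mk, quotBracket_mk, hbr.twist_right, lam_mul_add_map,
      lmap_twist_hom _ hd]
  · rw [← map_mul, quotBracket_mk, quotBracket_mk, quotBracket_mk, hbr.leibniz_left, map_add,
      hsmul, hsmul]
  · rw [← map_mul, quotBracket_mk, quotBracket_mk, quotBracket_mk, hbr.mul_left, map_add,
      lmap_opMul_hom _ hd, lmap_opMul_hom _ hd, lmap_C_hom, lmap_C_hom, opProd_eq_opMul,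
      opProd_eq_opMul]
  · rw [quotBracket_mk, quotBracket_mk, hbr.skew, map_neg, lmap_reflect_hom _ hd]
  · obtain ⟨P, hP⟩ := hbr.admissible a b c
    obtain ⟨P, rfl⟩ := Submodule.mkQ_surjective _ P
    refine ⟨Submodule.mkQ _ (P.map (Ideal.Quotient.mk I)), ?_⟩
    rw [quotBracket_mk, hr, ← hP]
    exact iota₁_map _ P
  · obtain ⟨P, Q, R, hP, hQ, hR, h⟩ := hbr.jacobi a b c
    obtain ⟨P, rfl⟩ := Submodule.mkQ_surjective _ P
    obtain ⟨Q, rfl⟩ := Submodule.mkQ_surjective _ Q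
    rw [← h, ← map_sub] at hR
    refine ⟨Submodule.mkQ _ (P.map (Ideal.Quotient.mk I)),
      Submodule.mkQ _ (Q.map (Ideal.Quotient.mk I)),
      Submodule.mkQ _ ((P - Q).map (Ideal.Quotient.mk I)), ?_, ?_, ?_, ?_⟩
    · rw [quotBracket_mk, hr, ← hP]
      exact iota₁_map _ P
    · rw [quotBracket_mk, hr, ← hQ]
      exact iota₂_map _ Q
    · rw [quotBracket_mk, hl, ← hR]
      exact iota₃_map _ (P - Q)
    · rw [← map_sub]
      congr 1

end Quotient

end PVA

end

/-! ### The theorem -/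

theorem theorem3p1 {F V : Type*} [Field F] [CharZero F] [CommRing V] [Algebra F V]
    (d : Derivation F V V) (br : V →ₗ[F] V →ₗ[F] LaurentSeries V) (hbr : PVA.IsPVABracket d br)
    {m : ℕ} (θ : Fin m → V) (D : Matrix (Fin m) (Fin m) (LaurentSeries V))
    (hD : PVA.IsInverseOp d (PVA.constraintMatrix br θ) D) :
    PVA.IsPVABracket d (PVA.dirac d br θ D) ∧
    (∀ i, PVA.IsCentral (PVA.dirac d br θ D) (θ i)) ∧
    (∀ x ∈ PVA.diffIdeal d θ, ∀ a : V, ∀ n : ℤ,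
      (PVA.dirac d br θ D x a).coeff n ∈ PVA.diffIdeal d θ ∧
      (PVA.dirac d br θ D a x).coeff n ∈ PVA.diffIdeal d θ) ∧
    ∃ brQ : (V ⧸ PVA.diffIdeal d θ) →ₗ[F] (V ⧸ PVA.diffIdeal d θ) →ₗ[F]
        LaurentSeries (V ⧸ PVA.diffIdeal d θ),
      (∀ a b : V, brQ (Ideal.Quotient.mk _ a) (Ideal.Quotient.mk _ b)
        = (PVA.dirac d br θ D a b).map (Ideal.Quotient.mk (PVA.diffIdeal d θ))) ∧
      PVA.IsPVABracket (PVA.quotDer d (PVA.diffIdeal d θ) (PVA.diffIdeal_stable d θ)) brQ := by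
  have hleft := fun x hx a n => PVA.dirac_mem_diffIdeal_left hbr hD (x := x) hx a n
  have hright := fun x hx a n => PVA.dirac_mem_diffIdeal_right hbr hD (x := x) hx a n
  exact ⟨PVA.isPVABracket_dirac hbr hD,
    fun i a => ⟨PVA.dirac_constraint_right hD a i, PVA.dirac_constraint_left hD a i⟩,
    fun x hx a n => ⟨hleft x hx a n, hright x hx a n⟩,
    PVA.quotBracket (PVA.dirac d br θ D) hleft hright,
    PVA.quotBracket_mk hleft hright,
    PVA.isPVABracket_quotBracket (PVA.isPVABracket_dirac hbr hD) _ hleft hright⟩
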